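/- Definitions. All graphs are finite and simple. An \emph{AT-graph} is a pair $(G,\mathcal X)$ where $G$ is a graph and $\mathcal X$ is a set of unordered pairs of independent (that is, nonadjacent) edges of $G$; it is \emph{complete} if $G$ is a complete graph. An \emph{AT-subgraph} of $(G,\mathcal X)$ is an AT-graph $(H,\mathcal Y)$ where $H$ is a subgraph of $G$ and $\mathcal Y=\mathcal X\cap\binom{E(H)}{2}$. An AT-graph $(G,\mathcal X)$ is called an \emph{even} (\emph{odd}) $G$ if $|\mathcal X|$ is even (odd). A \emph{drawing} of $G$ represents the vertices by distinct points of the plane and the edges by simple curves connecting the corresponding points, so that (1) the edges pass through no vertices except their endpoints, (2) every two edges have finitely many common points, (3) every common point of two edges is a common endpoint or a proper crossing, and (4) no three edges pass through the same crossing. The AT-graph $(G,\mathcal X)$ is \emph{independently $\mathbb Z_2$-realizable} if $G$ has a drawing in which $\mathcal X$ is exactly the set of pairs of independent edges that cross an odd number of times. For a complete graph $K_n$, let $M$ be the number of unordered pairs of independent edges, and identify each $\mathbf x\in\mathbb Z_2^M$ with the AT-graph on $K_n$ whose set of pairs has characteristic vector $\mathbf x$. For an edge $e$ and a vertex $v\notin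 e$, let $\mathbf w_{(e,v)}\in\mathbb Z_2^M$ be the vector whose components equal to $1$ are exactly those indexed by the pairs $\{e,f\}$ of independent edges with $f$ incident to $v$. Theorem. (a) A complete AT-graph is independently $\mathbb Z_2$-realizable if and only if it contains no even $K_5$ and no odd $2K_3$ (disjoint union of two triangles) as an AT-subgraph. (b) Every complete AT-graph that is not independently $\mathbb Z_2$-realizable has an AT-subgraph on at most six vertices that is not independently $\mathbb Z_2$-realizable. (c) For every $n$, the linear span of the vectors $\mathbf w_{(e,v)}$ in $\mathbb Z_2^M$ is equal to the set of all vectors $\mathbf x\in\mathbb Z_2^M$ whose AT-graph on $K_n$ contains no odd $K_5$ and no odd $2K_3$ as an AT-subgraph. -/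

import Mathlib

open scoped SimpleGraph

/-- Two edges are independent (nonadjacent) if they have no common endpoint. -/
def IndependentEdges {V : Type*} (e f : Sym2 V) : Prop :=
  ∀ v : V, ¬ (v ∈ e ∧ v ∈ f)

/-- The set of unordered pairs of independent edges of `G`. -/
def indepPairs {V : Type*} (G : SimpleGraph V) : Set (Sym2 (Sym2 V)) :=
  {p | ∃ e f : Sym2 V, e ∈ G.edgeSet ∧ f ∈ G.edgeSet ∧ IndependentEdges e f ∧ p = s(e, f)}

/-- An abstract topological graph `(G, 𝒳)`: a graph together with a set of pairs of
independent edges. -/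
structure ATGraph (V : Type*) where
  graph : SimpleGraph V
  pairs : Set (Sym2 (Sym2 V))
  pairs_subset : pairs ⊆ indepPairs graph

/-- `p` is a proper crossing of the curves `a` and `b`: in some local coordinates of the plane
around `p`, the curve `a` is the horizontal axis and `b` is the vertical axis. The plane is
modelled by `ℂ`, of which only the topology is used. -/
def IsProperCrossing (a b : Set ℂ) (p : ℂ) : Prop :=
  ∃ φ : OpenPartialHomeomorph ℂ ℂ, p ∈ φ.source ∧ φ p = 0 ∧
    ∀ z ∈ φ.source, (z ∈ a ↔ (φ z).im = 0) ∧ (z ∈ b ↔ (φ z).re = 0)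

/-- A topological graph: a drawing of `G` in the plane in general position. -/
structure Drawing {V : Type*} (G : SimpleGraph V) where
  /-- the points representing the vertices -/
  vert : V → ℂ
  vert_injective : Function.Injective vert
  /-- the curves representing the edges -/
  edge : G.edgeSet → Set ℂ
  /-- every edge is a simple curve connecting the points that represent its endpoints -/
  edge_arc : ∀ e : G.edgeSet, ∃ γ : C(unitInterval, ℂ), Function.Injective γ ∧
    Set.range γ = edge e ∧ s(γ 0, γ 1) = (e : Sym2 V).map vert
  /-- edges pass through no vertices except their endpoints -/
  vert_mem_edge : ∀ (v : V) (e : G.edgeSet), vert v ∈ edge e → v ∈ (e : Sym2 V)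
  /-- two edges have finitely many common points -/
  inter_finite : ∀ e f : G.edgeSet, e ≠ f → (edge e ∩ edge f).Finite
  /-- every common point of two edges is a common endpoint or a proper crossing -/
  inter_proper : ∀ e f : G.edgeSet, e ≠ f → ∀ p ∈ edge e ∩ edge f,
    (∃ v : V, v ∈ (e : Sym2 V) ∧ v ∈ (f : Sym2 V) ∧ vert v = p) ∨
      IsProperCrossing (edge e) (edge f) p
  /-- no three edges pass through the same crossing -/
  no_triple : ∀ e f g : G.edgeSet, e ≠ f → e ≠ g → f ≠ g →
    ∀ p, p ∈ edge e → p ∈ edge f → p ∈ edge g → p ∈ Set.range vert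

/-- The crossings of two edges: their common points other than common endpoints. -/
def Drawing.crossings {V : Type*} {G : SimpleGraph V} (D : Drawing G) (e f : G.edgeSet) :
    Set ℂ :=
  (D.edge e ∩ D.edge f) \ Set.range D.vert

namespace ATGraph

/-- `A` is complete if its underlying graph is. -/
def IsComplete {V : Type*} (A : ATGraph V) : Prop := A.graph = ⊤

/-- `D` is an independent `ℤ₂`-realization of `A`: the pairs of `A` are exactly the pairs of
independent edges that cross an odd number of times in `D`. -/
def IsIndepZ2Realization {V : Type*} (A : ATGraph V) (D : Drawing A.graph) : Prop :=
  ∀ e f : A.graph.edgeSet, IndependentEdges (e : Sym2 V) (f : Sym2 V) →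
    (s((e : Sym2 V), (f : Sym2 V)) ∈ A.pairs ↔ Odd (D.crossings e f).ncard)

/-- `A` is independently `ℤ₂`-realizable. -/
def IndepZ2Realizable {V : Type*} (A : ATGraph V) : Prop :=
  ∃ D : Drawing A.graph, A.IsIndepZ2Realization D

/-- The AT-subgraph of `A` whose underlying graph is the subgraph `H`; its pairs are all the
pairs of `A` formed by edges of `H`. -/
def sub {V : Type*} (A : ATGraph V) (H : A.graph.Subgraph) : ATGraph H.verts where
  graph := H.coe
  pairs := {p | p ∈ indepPairs H.coe ∧ p.map (Sym2.map Subtype.val) ∈ A.pairs}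
  pairs_subset := fun _ hp => hp.1

/-- `A` has an even `K` as an AT-subgraph. -/
def ContainsEven {V W : Type*} (A : ATGraph V) (K : SimpleGraph W) : Prop :=
  ∃ H : A.graph.Subgraph, Nonempty (H.coe ≃g K) ∧ Even (A.sub H).pairs.ncard

/-- `A` has an odd `K` as an AT-subgraph. -/
def ContainsOdd {V W : Type*} (A : ATGraph V) (K : SimpleGraph W) : Prop :=
  ∃ H : A.graph.Subgraph, Nonempty (H.coe ≃g K) ∧ Odd (A.sub H).pairs.ncard

/-- The AT-graph on `G` with characteristic vector `x`. -/
def ofVector {V : Type*} {G : SimpleGraph V} (x : indepPairs G → ZMod 2) : ATGraph V where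
  graph := G
  pairs := {p | ∃ h : p ∈ indepPairs G, x ⟨p, h⟩ = 1}
  pairs_subset := fun _ hp => hp.1

end ATGraph

/-- The complete graph on five vertices. -/
abbrev graphK5 : SimpleGraph (Fin 5) := ⊤

/-- The disjoint union of two triangles. -/
abbrev graph2K3 : SimpleGraph (Fin 3 ⊕ Fin 3) :=
  (⊤ : SimpleGraph (Fin 3)) ⊕g (⊤ : SimpleGraph (Fin 3))

open Classical in
/-- The vector of the edge-vertex switch `(e, v)`: its components equal to `1` are those indexed
by the pairs `{e, f}` with `f` incident to `v`. -/
noncomputable def switchVector {V : Type*} (G : SimpleGraph V) (e : Sym2 V) (v : V) :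
    indepPairs G → ZMod 2 :=
  fun p => if ∃ f : Sym2 V, v ∈ f ∧ (p : Sym2 (Sym2 V)) = s(e, f) then 1 else 0

/-- The space spanned by the vectors of all edge-vertex switches `(e, v)` with `v ∉ e`. -/
noncomputable def switchSpace {V : Type*} (G : SimpleGraph V) :
    Submodule (ZMod 2) (indepPairs G → ZMod 2) :=
  Submodule.span (ZMod 2)
    {w | ∃ e ∈ G.edgeSet, ∃ v : V, v ∉ e ∧ w = switchVector G e v}

/-- The vectors with the `K₅`-property (no odd `K₅`) and the `2K₃`-property (no odd `2K₃`). -/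
def propertyVectors {V : Type*} (G : SimpleGraph V) : Set (indepPairs G → ZMod 2) :=
  {x | ¬ (ATGraph.ofVector x).ContainsOdd graphK5 ∧
    ¬ (ATGraph.ofVector x).ContainsOdd graph2K3}

/-! ### Change of the logarithm along a curve -/

/-! Crossing parities are winding numbers. For independent edges parametrized by `f` (from `a` to
`b`) and `g` (from `c` to `d`), crossings are the zeros of `f s - g t` on the unit square. A proper
crossing has odd local index: in a chart with inverse `ψ` the map becomes `ψ u - ψ (i v)`, which
deforms, without further zeros, to an odd map (`rectIndex_axes_odd`). So the parity of the crossings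
is read off the boundary of the square, that is, from how `f` turns around `c`, `d` and `g` around
`a`, `b`. Measured against the principal logarithm, this shows that every drawing has a vector of
the form `flipSum t + switchSum y`, where `t` is a tournament on the vertices and `y e v` is the
parity of the turns of `e` around `v` (`Drawing.exists_parity`).

Double counting gives `switchSum y` the sum 0 over every K₅ and every 2K₃, and `flipSum t` the sum 1
over K₅ and 0 over 2K₃. This proves necessity in (a). The argument does not need completeness, so
even K₅'s and odd 2K₃'s are themselves not realizable, which yields (b) once (a) is known.

Sufficiency has an algebraic and a geometric half. Algebra (`exists_switchSum_eq_of_sums`): on a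
complete graph, a vector whose sums over all K₅ and 2K₃ vanish is some `switchSum Y`; together with
`mem_switchSpace_iff` this is also (c). Geometry (`exists_drawing_of_switches`): with the vertices
fixed on the real axis, `t` is fixed and every `y` occurs. An edge is drawn as a polynomial curve
that passes each other vertex on a prescribed side, and switching the side changes the number of
turns around that vertex by one. A small perturbation within a pencil of curves, generic by Sard's
theorem in dimension one, puts the curves in general position. Adding `flipSum t` to the vector of
an AT-graph as in (a) leaves some `switchSum Y`, and the drawing for `Y` realizes the AT-graph. -/

open Complex in
theorem exists_log_lift_of_retraction {E : Type*} [AddCommGroup E] [Module ℝ E]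
    [TopologicalSpace E] [ContinuousAdd E] [ContinuousSMul ℝ E] [LocallyPathConnectedSpace E]
    {K : Set E} {r : E → E} (hr : Continuous r) (hrK : ∀ x, r x ∈ K) (hid : ∀ x ∈ K, r x = x)
    {F : E → ℂ} (hF : ContinuousOn F K) (h0 : ∀ x ∈ K, F x ≠ 0) :
    ∃ L : E → ℂ, ContinuousOn L K ∧ ∀ x ∈ K, exp (L x) = F x := by
  have hc : Continuous fun x => F (r x) :=
    hF.comp_continuous hr hrK
  -- Precomposing with the retraction moves the problem to the whole contractible space `E`, where
  -- maps to the punctured plane lift through the covering `exp`.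
  obtain ⟨L, ⟨-, hL⟩, -⟩ := isCoveringMapOn_exp.existsUnique_continuousMap_lifts
    (⟨fun x => F (r x), hc⟩ : C(E, ℂ)) (a₀ := 0)
    (e₀ := log (F (r 0))) (exp_log (h0 _ (hrK 0))) (fun x => by simpa using h0 _ (hrK x))
  refine ⟨L, L.continuous.continuousOn, fun x hx => ?_⟩
  have := congrFun hL x
  simpa [hid x hx] using this

open Complex in
theorem exists_log_lift {F : ℝ → ℂ} {a b : ℝ} (hF : ContinuousOn F (Set.uIcc a b))
    (h0 : ∀ x ∈ Set.uIcc a b, F x ≠ 0) :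
    ∃ L : ℝ → ℂ, ContinuousOn L (Set.uIcc a b) ∧ ∀ x ∈ Set.uIcc a b, exp (L x) = F x := by
  refine exists_log_lift_of_retraction (K := Set.uIcc a b)
    (r := fun x => (Set.projIcc (min a b) (max a b) inf_le_sup x : ℝ))
    (continuous_subtype_val.comp continuous_projIcc) (fun x => Subtype.mem _) (fun x hx => ?_) hF h0
  exact congrArg Subtype.val (Set.projIcc_of_mem _ hx)

open Complex in
theorem exists_log_lift_prod {F : ℝ × ℝ → ℂ} {a b c d : ℝ}
    (hF : ContinuousOn F (Set.uIcc a b ×ˢ Set.uIcc c d))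
    (h0 : ∀ x ∈ Set.uIcc a b ×ˢ Set.uIcc c d, F x ≠ 0) :
    ∃ L : ℝ × ℝ → ℂ, ContinuousOn L (Set.uIcc a b ×ˢ Set.uIcc c d) ∧
      ∀ x ∈ Set.uIcc a b ×ˢ Set.uIcc c d, exp (L x) = F x := by
  refine exists_log_lift_of_retraction
    (K := Set.uIcc a b ×ˢ Set.uIcc c d)
    (r := fun x => ((Set.projIcc (min a b) (max a b) inf_le_sup x.1 : ℝ),
      (Set.projIcc (min c d) (max c d) inf_le_sup x.2 : ℝ)))
    ((continuous_subtype_val.comp (continuous_projIcc.comp continuous_fst)).prodMk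
      (continuous_subtype_val.comp (continuous_projIcc.comp continuous_snd)))
    (fun x => ⟨Subtype.mem _, Subtype.mem _⟩) (fun x hx => ?_) hF h0
  exact Prod.ext (congrArg Subtype.val (Set.projIcc_of_mem inf_le_sup hx.1))
    (congrArg Subtype.val (Set.projIcc_of_mem inf_le_sup hx.2))

/-- `L` is a continuous logarithm of `F` between `a` and `b`. -/
def IsLogLift (F : ℝ → ℂ) (a b : ℝ) (L : ℝ → ℂ) : Prop :=
  ContinuousOn L (Set.uIcc a b) ∧ ∀ x ∈ Set.uIcc a b, Complex.exp (L x) = F x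

open Classical in
/-- The change of a continuous logarithm of `F` from `a` to `b`. -/
noncomputable def logChange (F : ℝ → ℂ) (a b : ℝ) : ℂ :=
  -- The value 0 in the absence of a lift lets `logChange_congr` and `logChange_symm` hold without
  -- hypotheses.
  if h : ∃ L, IsLogLift F a b L then h.choose b - h.choose a else 0

-- The difference of two lifts, divided by `2πi`, is continuous with integer values on an interval,
-- hence constant. This makes `logChange` independent of the chosen lift.
open Complex in
theorem IsLogLift.sub_eq {F : ℝ → ℂ} {a b : ℝ} {L L' : ℝ → ℂ} (h : IsLogLift F a b L)
    (h' : IsLogLift F a b L') : L b - L a = L' b - L' a := by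
  have key : ∀ x ∈ Set.uIcc a b, ∃ n : ℤ, L x - L' x = n * (2 * Real.pi * I) := fun x hx => by
    have := (h.2 x hx).trans (h'.2 x hx).symm
    obtain ⟨n, hn⟩ := exp_eq_exp_iff_exists_int.1 this
    exact ⟨n, by rw [hn]; ring⟩
  have hc : ContinuousOn (fun x => (L x - L' x) / (2 * Real.pi * I)) (Set.uIcc a b) :=
    (h.1.sub h'.1).div_const _
  have hpi : (2 * Real.pi * I : ℂ) ≠ 0 := two_pi_I_ne_zero
  have hr : ContinuousOn (fun x => ((L x - L' x) / (2 * Real.pi * I)).re) (Set.uIcc a b) :=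
    continuous_re.comp_continuousOn hc
  have hconst : ((L a - L' a) / (2 * Real.pi * I)).re = ((L b - L' b) / (2 * Real.pi * I)).re := by
    refine isPreconnected_uIcc.constant_of_mapsTo (T := Set.range ((↑) : ℤ → ℝ)) ?_ hr ?_
      Set.left_mem_uIcc Set.right_mem_uIcc
    · exact Int.isClosedEmbedding_coe_real.isInducing.isDiscrete_range
    intro x hx
    obtain ⟨n, hn⟩ := key x hx
    refine ⟨n, ?_⟩
    simp only [hn]
    rw [mul_div_assoc, div_self hpi]; simp
  obtain ⟨n, hn⟩ := key a Set.left_mem_uIcc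
  obtain ⟨m, hm⟩ := key b Set.right_mem_uIcc
  rw [hn, hm, mul_div_assoc, div_self hpi, mul_div_assoc, div_self hpi] at hconst
  simp only [mul_one, intCast_re, Int.cast_inj] at hconst
  rw [hconst] at hn
  linear_combination hm - hn

theorem IsLogLift.logChange_eq {F : ℝ → ℂ} {a b : ℝ} {L : ℝ → ℂ} (h : IsLogLift F a b L) :
    logChange F a b = L b - L a := by
  have hex : ∃ L, IsLogLift F a b L := ⟨L, h⟩
  rw [logChange, dif_pos hex]
  exact hex.choose_spec.sub_eq h

theorem IsLogLift.mono {F : ℝ → ℂ} {a b c d : ℝ} {L : ℝ → ℂ} (h : IsLogLift F a b L)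
    (hs : Set.uIcc c d ⊆ Set.uIcc a b) : IsLogLift F c d L :=
  ⟨h.1.mono hs, fun x hx => h.2 x (hs hx)⟩

/-- `F` is continuous and has no zero between `a` and `b`. -/
def NonvanishingOn (F : ℝ → ℂ) (a b : ℝ) : Prop :=
  ContinuousOn F (Set.uIcc a b) ∧ ∀ x ∈ Set.uIcc a b, F x ≠ 0

theorem NonvanishingOn.exists_lift {F : ℝ → ℂ} {a b : ℝ} (h : NonvanishingOn F a b) :
    ∃ L, IsLogLift F a b L :=
  exists_log_lift h.1 h.2

theorem NonvanishingOn.mono {F : ℝ → ℂ} {a b c d : ℝ} (h : NonvanishingOn F a b)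
    (hs : Set.uIcc c d ⊆ Set.uIcc a b) : NonvanishingOn F c d :=
  ⟨h.1.mono hs, fun x hx => h.2 x (hs hx)⟩

theorem logChange_congr {F G : ℝ → ℂ} {a b : ℝ} (h : ∀ x ∈ Set.uIcc a b, F x = G x) :
    logChange F a b = logChange G a b := by
  have : IsLogLift F a b = IsLogLift G a b := by
    funext L
    unfold IsLogLift
    refine propext (and_congr_right fun _ => forall₂_congr fun x hx => ?_)
    rw [h x hx]
  unfold logChange
  rw [this]

theorem logChange_symm (F : ℝ → ℂ) (a b : ℝ) : logChange F b a = -logChange F a b := by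
  by_cases h : ∃ L, IsLogLift F a b L
  · obtain ⟨L, hL⟩ := h
    have hL' : IsLogLift F b a L := by unfold IsLogLift; rw [Set.uIcc_comm]; exact hL
    rw [hL.logChange_eq, hL'.logChange_eq]; ring
  · have h' : ¬ ∃ L, IsLogLift F b a L := by unfold IsLogLift at h ⊢; rwa [Set.uIcc_comm]
    rw [logChange, logChange, dif_neg h, dif_neg h', neg_zero]

theorem logChange_add {F : ℝ → ℂ} {a b c : ℝ} (hb : b ∈ Set.uIcc a c)
    (h : NonvanishingOn F a c) : logChange F a c = logChange F a b + logChange F b c := by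
  obtain ⟨L, hL⟩ := h.exists_lift
  rw [hL.logChange_eq, (hL.mono (Set.uIcc_subset_uIcc Set.left_mem_uIcc hb)).logChange_eq,
    (hL.mono (Set.uIcc_subset_uIcc hb Set.right_mem_uIcc)).logChange_eq]
  ring

theorem exp_logChange {F : ℝ → ℂ} {a b : ℝ} (h : NonvanishingOn F a b) :
    Complex.exp (logChange F a b) = F b / F a := by
  obtain ⟨L, hL⟩ := h.exists_lift
  rw [hL.logChange_eq, Complex.exp_sub, hL.2 _ Set.left_mem_uIcc, hL.2 _ Set.right_mem_uIcc]

theorem logChange_comp {G : ℝ → ℂ} {α : ℝ → ℝ} {a b m M : ℝ}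
    (hα : ContinuousOn α (Set.uIcc a b)) (hm : Set.MapsTo α (Set.uIcc a b) (Set.uIcc m M))
    (hG : NonvanishingOn G m M) :
    logChange (fun s => G (α s)) a b = logChange G (α a) (α b) := by
  obtain ⟨L, hL⟩ := hG.exists_lift
  have h1 : IsLogLift (fun s => G (α s)) a b (L ∘ α) :=
    ⟨hL.1.comp hα hm, fun x hx => hL.2 _ (hm hx)⟩
  rw [h1.logChange_eq, (hL.mono (Set.uIcc_subset_uIcc (hm Set.left_mem_uIcc)
    (hm Set.right_mem_uIcc))).logChange_eq]
  rfl

theorem logChange_neg {F : ℝ → ℂ} {a b : ℝ} (h : NonvanishingOn F a b) :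
    logChange (fun s => -F s) a b = logChange F a b := by
  obtain ⟨L, hL⟩ := h.exists_lift
  have h1 : IsLogLift (fun s => -F s) a b (fun s => L s + Real.pi * Complex.I) :=
    ⟨hL.1.add continuousOn_const, fun x hx => by
      rw [Complex.exp_add, hL.2 x hx, Complex.exp_pi_mul_I]; ring⟩
  rw [h1.logChange_eq, hL.logChange_eq]
  ring

theorem logChange_of_slitPlane {F : ℝ → ℂ} {a b : ℝ} (hF : ContinuousOn F (Set.uIcc a b))
    (h : ∀ x ∈ Set.uIcc a b, F x ∈ Complex.slitPlane) :
    logChange F a b = Complex.log (F b) - Complex.log (F a) := by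
  have : IsLogLift F a b (fun s => Complex.log (F s)) :=
    ⟨hF.clog h, fun x hx => Complex.exp_log (Complex.slitPlane_ne_zero (h x hx))⟩
  exact this.logChange_eq

/-- The change of the logarithm of `F` around the boundary of `[a, b] × [c, d]`. -/
noncomputable def rectIndex (F : ℝ → ℝ → ℂ) (a b c d : ℝ) : ℂ :=
  logChange (fun s => F s c) a b + logChange (F b) c d
    - logChange (fun s => F s d) a b - logChange (F a) c d

/-- `F` is continuous and has no zero on the sides of the rectangle with corners `(a, c)` and
`(b, d)`. -/
structure NonvanishingOnSides (F : ℝ → ℝ → ℂ) (a b c d : ℝ) : Prop where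
  bot : NonvanishingOn (fun s => F s c) a b
  top : NonvanishingOn (fun s => F s d) a b
  left : NonvanishingOn (F a) c d
  right : NonvanishingOn (F b) c d

theorem continuousOn_section_fst {F : ℝ → ℝ → ℂ} {S T : Set ℝ}
    (hF : ContinuousOn (Function.uncurry F) (S ×ˢ T)) {t : ℝ} (ht : t ∈ T) :
    ContinuousOn (fun s => F s t) S :=
  hF.comp (f := fun s => (s, t)) (by fun_prop) (fun _ hs => ⟨hs, ht⟩)

theorem continuousOn_section_snd {F : ℝ → ℝ → ℂ} {S T : Set ℝ}
    (hF : ContinuousOn (Function.uncurry F) (S ×ˢ T)) {s : ℝ} (hs : s ∈ S) :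
    ContinuousOn (F s) T :=
  hF.comp (f := fun t => (s, t)) (by fun_prop) (fun _ ht => ⟨hs, ht⟩)

/-- Without zeros there is one logarithm on the whole rectangle, and its increments along the four
sides telescope. -/
theorem rectIndex_eq_zero {F : ℝ → ℝ → ℂ} {a b c d : ℝ}
    (hF : ContinuousOn (Function.uncurry F) (Set.uIcc a b ×ˢ Set.uIcc c d))
    (h0 : ∀ s ∈ Set.uIcc a b, ∀ t ∈ Set.uIcc c d, F s t ≠ 0) : rectIndex F a b c d = 0 := by
  obtain ⟨L, hL, hexp⟩ := exists_log_lift_prod hF (fun x hx => h0 _ hx.1 _ hx.2)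
  have hl : ∀ s ∈ Set.uIcc a b, IsLogLift (F s) c d (fun t => L (s, t)) := fun s hs =>
    ⟨continuousOn_section_snd (F := fun s t => L (s, t)) hL hs,
      fun t ht => hexp (s, t) ⟨hs, ht⟩⟩
  have hb : ∀ t ∈ Set.uIcc c d, IsLogLift (fun s => F s t) a b (fun s => L (s, t)) :=
    fun t ht => ⟨continuousOn_section_fst (F := fun s t => L (s, t)) hL ht,
      fun s hs => hexp (s, t) ⟨hs, ht⟩⟩
  rw [rectIndex, (hl a Set.left_mem_uIcc).logChange_eq, (hl b Set.right_mem_uIcc).logChange_eq,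
    (hb c Set.left_mem_uIcc).logChange_eq, (hb d Set.right_mem_uIcc).logChange_eq]
  ring

theorem rectIndex_split_fst {F : ℝ → ℝ → ℂ} {a b c d m : ℝ} (hm : m ∈ Set.uIcc a b)
    (h : NonvanishingOnSides F a b c d) :
    rectIndex F a b c d = rectIndex F a m c d + rectIndex F m b c d := by
  simp only [rectIndex]
  rw [logChange_add hm h.bot, logChange_add hm h.top]
  ring

theorem rectIndex_split_snd {F : ℝ → ℝ → ℂ} {a b c d m : ℝ} (hm : m ∈ Set.uIcc c d)
    (h : NonvanishingOnSides F a b c d) :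
    rectIndex F a b c d = rectIndex F a b c m + rectIndex F a b m d := by
  simp only [rectIndex]
  rw [logChange_add hm h.left, logChange_add hm h.right]
  ring

theorem rectIndex_symm_fst (F : ℝ → ℝ → ℂ) (a b c d : ℝ) :
    rectIndex F b a c d = -rectIndex F a b c d := by
  simp only [rectIndex]
  rw [logChange_symm _ a b, logChange_symm _ a b]
  ring

theorem rectIndex_symm_snd (F : ℝ → ℝ → ℂ) (a b c d : ℝ) :
    rectIndex F a b d c = -rectIndex F a b c d := by
  simp only [rectIndex]
  rw [logChange_symm _ c d, logChange_symm _ c d]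
  ring

/-- Neither monotonicity nor orientation of `α`, `β` matters: a logarithm along a line depends only
on where the reparametrized path starts and ends. Reversed coordinates give a rectangle with
interchanged corners, hence a sign. -/
theorem rectIndex_comp {G : ℝ → ℝ → ℂ} {α β : ℝ → ℝ} {a b c d : ℝ}
    (hα : ContinuousOn α (Set.uIcc a b)) (hβ : ContinuousOn β (Set.uIcc c d))
    {m M m' M' : ℝ}
    (hmα : Set.MapsTo α (Set.uIcc a b) (Set.uIcc m M))
    (hmβ : Set.MapsTo β (Set.uIcc c d) (Set.uIcc m' M'))
    (h1 : NonvanishingOn (fun u => G u (β c)) m M) (h2 : NonvanishingOn (fun u => G u (β d)) m M)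
    (h3 : NonvanishingOn (G (α a)) m' M') (h4 : NonvanishingOn (G (α b)) m' M') :
    rectIndex (fun s t => G (α s) (β t)) a b c d = rectIndex G (α a) (α b) (β c) (β d) := by
  simp only [rectIndex]
  rw [logChange_comp hα hmα h1, logChange_comp hα hmα h2, logChange_comp hβ hmβ h3,
    logChange_comp hβ hmβ h4]

/-- The index is invariant under homotopies without zeros on the sides. -/
theorem rectIndex_homotopy {H : ℝ → ℝ → ℝ → ℂ} {a b c d : ℝ}
    (hc : ContinuousOn (fun p : ℝ × ℝ × ℝ => H p.1 p.2.1 p.2.2)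
      (Set.uIcc 0 1 ×ˢ Set.uIcc a b ×ˢ Set.uIcc c d))
    (h1 : ∀ τ ∈ Set.uIcc (0 : ℝ) 1, ∀ s ∈ Set.uIcc a b, H τ s c ≠ 0 ∧ H τ s d ≠ 0)
    (h2 : ∀ τ ∈ Set.uIcc (0 : ℝ) 1, ∀ t ∈ Set.uIcc c d, H τ a t ≠ 0 ∧ H τ b t ≠ 0) :
    rectIndex (H 0) a b c d = rectIndex (H 1) a b c d := by
  -- Each side sweeps out a rectangle in the parameter `τ` that contains no zero. The signed sum of
  -- the four vanishing indices is the difference of the indices at `τ = 0` and `τ = 1`, as the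
  -- corner contributions cancel.
  have e1 : ∀ t ∈ Set.uIcc c d, (∀ τ ∈ Set.uIcc (0 : ℝ) 1, ∀ s ∈ Set.uIcc a b, H τ s t ≠ 0) →
      rectIndex (fun τ s => H τ s t) 0 1 a b = 0 := fun t ht h =>
    rectIndex_eq_zero (hc.comp (f := fun p : ℝ × ℝ => (p.1, p.2, t)) (by fun_prop)
      (fun p hp => ⟨hp.1, hp.2, ht⟩)) h
  have e2 : ∀ s ∈ Set.uIcc a b, (∀ τ ∈ Set.uIcc (0 : ℝ) 1, ∀ t ∈ Set.uIcc c d, H τ s t ≠ 0) →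
      rectIndex (fun τ t => H τ s t) 0 1 c d = 0 := fun s hs h =>
    rectIndex_eq_zero (hc.comp (f := fun p : ℝ × ℝ => (p.1, s, p.2)) (by fun_prop)
      (fun p hp => ⟨hp.1, hs, hp.2⟩)) h
  have b1 := e1 c Set.left_mem_uIcc fun τ hτ s hs => (h1 τ hτ s hs).1
  have b2 := e1 d Set.right_mem_uIcc fun τ hτ s hs => (h1 τ hτ s hs).2
  have b3 := e2 a Set.left_mem_uIcc fun τ hτ s hs => (h2 τ hτ s hs).1
  have b4 := e2 b Set.right_mem_uIcc fun τ hτ s hs => (h2 τ hτ s hs).2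
  simp only [rectIndex] at b1 b2 b3 b4 ⊢
  linear_combination b2 - b1 + b3 - b4

open Complex in
/-- An odd map has an odd index. -/
theorem rectIndex_odd {G : ℝ → ℝ → ℂ} {r : ℝ} (hr : 0 ≤ r)
    (hodd : ∀ u v, G (-u) (-v) = -G u v) (h : NonvanishingOnSides G (-r) r (-r) r) :
    ∃ k : ℤ, Odd k ∧ rectIndex G (-r) r (-r) r = k * (2 * Real.pi * I) := by
  have hm : Set.MapsTo (fun s : ℝ => -s) (Set.uIcc (-r) r) (Set.uIcc (-r) r) := by
    intro s hs
    rw [Set.uIcc_of_le (by linarith)] at hs ⊢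
    exact ⟨by linarith [hs.2], by linarith [hs.1]⟩
  have t1 : logChange (fun s => G s r) (-r) r = -logChange (fun s => G s (-r)) (-r) r := by
    have e : ∀ s ∈ Set.uIcc (-r) r, G s r = -G (-s) (-r) := fun s _ => by rw [hodd]; simp
    rw [logChange_congr e]
    have hn : NonvanishingOn (fun s => G (-s) (-r)) (-r) r :=
      ⟨h.bot.1.comp continuous_neg.continuousOn hm, fun x hx => h.bot.2 _ (hm hx)⟩
    rw [logChange_neg hn,
      logChange_comp (G := fun s => G s (-r)) continuous_neg.continuousOn hm h.bot, neg_neg,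
      logChange_symm]
  have t2 : logChange (G (-r)) (-r) r = -logChange (G r) (-r) r := by
    have e : ∀ s ∈ Set.uIcc (-r) r, G (-r) s = -G r (-s) := fun s _ => by
      rw [← hodd r (-s)]; simp
    rw [logChange_congr e]
    have hn : NonvanishingOn (fun s => G r (-s)) (-r) r :=
      ⟨h.right.1.comp continuous_neg.continuousOn hm, fun x hx => h.right.2 _ (hm hx)⟩
    rw [logChange_neg hn,
      logChange_comp (G := G r) continuous_neg.continuousOn hm h.right, neg_neg,
      logChange_symm]
  -- The bottom and right sides join two antipodal corners, where `G` takes opposite values, so they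
  -- contribute an odd multiple of `πi`. By `t1` and `t2` the other half of the boundary contributes
  -- the same amount again.
  have hexp : exp (logChange (fun s => G s (-r)) (-r) r + logChange (G r) (-r) r)
      = exp (Real.pi * I) := by
    rw [exp_add, exp_logChange h.bot, exp_logChange h.right, exp_pi_mul_I]
    have h0 := h.bot.2 r Set.right_mem_uIcc
    have h1 := h.bot.2 (-r) Set.left_mem_uIcc
    have h2 : G r r = - G (-r) (-r) := by rw [← hodd]; simp
    dsimp only at h0 h1 ⊢
    rw [h2]
    field_simp
  obtain ⟨n, hn⟩ := exp_eq_exp_iff_exists_int.1 hexp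
  refine ⟨2 * n + 1, odd_two_mul_add_one n, ?_⟩
  rw [rectIndex, t1, t2]
  push_cast
  linear_combination 2 * hn

/-! ### Counting zeros by the index -/

/-- The zeros of `F` in `[a, b] × [c, d]`. -/
def rectZeros (F : ℝ → ℝ → ℂ) (a b c d : ℝ) : Set (ℝ × ℝ) :=
  {p | p ∈ Set.Icc a b ×ˢ Set.Icc c d ∧ F p.1 p.2 = 0}

/-- Arbitrarily small rectangles around `(s, t)` have an odd index. -/
def HasOddLocalIndex (F : ℝ → ℝ → ℂ) (s t : ℝ) : Prop :=
  ∀ ε > 0, ∃ a b c d, s - ε < a ∧ a < s ∧ s < b ∧ b < s + ε ∧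
    t - ε < c ∧ c < t ∧ t < d ∧ d < t + ε ∧
    ∃ k : ℤ, Odd k ∧ rectIndex F a b c d = k * (2 * Real.pi * Complex.I)

theorem nonvanishingOnSides_of_rect {F : ℝ → ℝ → ℂ} {A B C D a b c d : ℝ}
    (hF : ContinuousOn (Function.uncurry F) (Set.Icc A B ×ˢ Set.Icc C D))
    (hab : a ≤ b) (hcd : c ≤ d) (hA : A ≤ a) (hB : b ≤ B) (hC : C ≤ c) (hD : d ≤ D)
    (h1 : ∀ s ∈ Set.Icc a b, F s c ≠ 0 ∧ F s d ≠ 0)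
    (h2 : ∀ t ∈ Set.Icc c d, F a t ≠ 0 ∧ F b t ≠ 0) :
    NonvanishingOnSides F a b c d := by
  have hF' : ContinuousOn (Function.uncurry F) (Set.uIcc a b ×ˢ Set.uIcc c d) := by
    rw [Set.uIcc_of_le hab, Set.uIcc_of_le hcd]
    exact hF.mono (Set.prod_mono (Set.Icc_subset_Icc hA hB) (Set.Icc_subset_Icc hC hD))
  rw [← Set.uIcc_of_le hab] at h1
  rw [← Set.uIcc_of_le hcd] at h2
  exact ⟨⟨continuousOn_section_fst hF' Set.left_mem_uIcc, fun s hs => (h1 s hs).1⟩,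
    ⟨continuousOn_section_fst hF' Set.right_mem_uIcc, fun s hs => (h1 s hs).2⟩,
    ⟨continuousOn_section_snd hF' Set.left_mem_uIcc, fun s hs => (h2 s hs).1⟩,
    ⟨continuousOn_section_snd hF' Set.right_mem_uIcc, fun s hs => (h2 s hs).2⟩⟩

theorem rectIndex_eq_zero_of_le {F : ℝ → ℝ → ℂ} {A B C D a b c d : ℝ}
    (hF : ContinuousOn (Function.uncurry F) (Set.Icc A B ×ˢ Set.Icc C D))
    (hab : a ≤ b) (hcd : c ≤ d) (hA : A ≤ a) (hB : b ≤ B) (hC : C ≤ c) (hD : d ≤ D)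
    (h : ∀ s ∈ Set.Icc a b, ∀ t ∈ Set.Icc c d, F s t ≠ 0) : rectIndex F a b c d = 0 := by
  refine rectIndex_eq_zero ?_ ?_
  · rw [Set.uIcc_of_le hab, Set.uIcc_of_le hcd]
    exact hF.mono (Set.prod_mono (Set.Icc_subset_Icc hA hB) (Set.Icc_subset_Icc hC hD))
  · rwa [Set.uIcc_of_le hab, Set.uIcc_of_le hcd]

/-- The index of a rectangle containing exactly one zero, of odd local index, is odd. -/
theorem rectIndex_of_unique_zero {F : ℝ → ℝ → ℂ} {a b c d s₀ t₀ : ℝ}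
    (hF : ContinuousOn (Function.uncurry F) (Set.Icc a b ×ˢ Set.Icc c d))
    (hs : s₀ ∈ Set.Ioo a b) (ht : t₀ ∈ Set.Ioo c d)
    (huniq : ∀ s ∈ Set.Icc a b, ∀ t ∈ Set.Icc c d, F s t = 0 → s = s₀ ∧ t = t₀)
    (hloc : HasOddLocalIndex F s₀ t₀) :
    ∃ k : ℤ, Odd k ∧ rectIndex F a b c d = k * (2 * Real.pi * Complex.I) := by
  obtain ⟨hs1, hs2⟩ := hs
  obtain ⟨ht1, ht2⟩ := ht
  obtain ⟨a', b', c', d', h1, h2, h3, h4, h5, h6, h7, h8, k, hk, hkeq⟩ :=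
    hloc (min (min (s₀ - a) (b - s₀)) (min (t₀ - c) (d - t₀)))
      (lt_min (lt_min (by linarith) (by linarith)) (lt_min (by linarith) (by linarith)))
  have m1 := (min_le_left _ _ : min (min (s₀ - a) (b - s₀)) (min (t₀ - c) (d - t₀)) ≤ _)
  have m2 := (min_le_right _ _ : min (min (s₀ - a) (b - s₀)) (min (t₀ - c) (d - t₀)) ≤ _)
  have m3 := m1.trans (min_le_left _ _)
  have m4 := m1.trans (min_le_right _ _)
  have m5 := m2.trans (min_le_left _ _)
  have m6 := m2.trans (min_le_right _ _)
  have ha : a < a' := by linarith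
  have hb : b' < b := by linarith
  have hc : c < c' := by linarith
  have hd : d' < d := by linarith
  have hne : ∀ s ∈ Set.Icc a b, ∀ t ∈ Set.Icc c d, (s ≠ s₀ ∨ t ≠ t₀) → F s t ≠ 0 := by
    intro s hs t ht hor h0
    obtain ⟨e1, e2⟩ := huniq s hs t ht h0
    exact hor.elim (· e1) (· e2)
  have inS : ∀ {p q x}, a ≤ p → q ≤ b → x ∈ Set.Icc p q → x ∈ Set.Icc a b :=
    fun hp hq hx => ⟨hp.trans hx.1, hx.2.trans hq⟩
  have inT : ∀ {p q x}, c ≤ p → q ≤ d → x ∈ Set.Icc p q → x ∈ Set.Icc c d :=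
    fun hp hq hx => ⟨hp.trans hx.1, hx.2.trans hq⟩
  have sides : ∀ p q u v, a ≤ p → p ≤ q → q ≤ b → c ≤ u → u ≤ v → v ≤ d → p ≠ s₀ → q ≠ s₀ →
      u ≠ t₀ → v ≠ t₀ → NonvanishingOnSides F p q u v := fun p q u v e1 e2 e3 e4 e5 e6 e7 e8 e9 e10 =>
    nonvanishingOnSides_of_rect hF e2 e5 e1 e3 e4 e6
      (fun s hs => ⟨hne _ (inS e1 e3 hs) _ ⟨e4, e5.trans e6⟩ (Or.inr e9),
        hne _ (inS e1 e3 hs) _ ⟨e4.trans e5, e6⟩ (Or.inr e10)⟩)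
      (fun t ht => ⟨hne _ ⟨e1, e2.trans e3⟩ _ (inT e4 e6 ht) (Or.inl e7),
        hne _ ⟨e1.trans e2, e3⟩ _ (inT e4 e6 ht) (Or.inl e8)⟩)
  refine ⟨k, hk, ?_⟩
  -- The four strips around the small rectangle contain no zero, so cutting them off does not change
  -- the index.
  have s1 := rectIndex_split_fst (m := a') (Set.mem_uIcc.2 (Or.inl ⟨ha.le, by linarith⟩))
    (sides a b c d le_rfl (by linarith) le_rfl le_rfl (by linarith) le_rfl
      (by linarith) (by linarith) (by linarith) (by linarith))
  have s2 := rectIndex_split_fst (m := b') (Set.mem_uIcc.2 (Or.inl ⟨by linarith, hb.le⟩))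
    (sides a' b c d ha.le (by linarith) le_rfl le_rfl (by linarith) le_rfl
      (by linarith) (by linarith) (by linarith) (by linarith))
  have s3 := rectIndex_split_snd (m := c') (Set.mem_uIcc.2 (Or.inl ⟨hc.le, by linarith⟩))
    (sides a' b' c d ha.le (by linarith) hb.le le_rfl (by linarith) le_rfl
      (by linarith) (by linarith) (by linarith) (by linarith))
  have s4 := rectIndex_split_snd (m := d') (Set.mem_uIcc.2 (Or.inl ⟨by linarith, hd.le⟩))
    (sides a' b' c' d ha.le (by linarith) hb.le hc.le (by linarith) le_rfl
      (by linarith) (by linarith) (by linarith) (by linarith))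
  have z1 : rectIndex F a a' c d = 0 := rectIndex_eq_zero_of_le hF ha.le (by linarith) le_rfl
    (by linarith) le_rfl le_rfl fun s hs t ht =>
      hne s (inS le_rfl (by linarith) hs) t ht (Or.inl (by linarith [hs.2]))
  have z2 : rectIndex F b' b c d = 0 := rectIndex_eq_zero_of_le hF hb.le (by linarith) (by linarith)
    le_rfl le_rfl le_rfl fun s hs t ht =>
      hne s (inS (by linarith) le_rfl hs) t ht (Or.inl (by linarith [hs.1]))
  have z3 : rectIndex F a' b' c c' = 0 := rectIndex_eq_zero_of_le hF (by linarith) hc.le ha.le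
    hb.le le_rfl (by linarith) fun s hs t ht =>
      hne s (inS ha.le hb.le hs) t (inT le_rfl (by linarith) ht) (Or.inr (by linarith [ht.2]))
  have z4 : rectIndex F a' b' d' d = 0 := rectIndex_eq_zero_of_le hF (by linarith) hd.le ha.le
    hb.le (by linarith) le_rfl fun s hs t ht =>
      hne s (inS ha.le hb.le hs) t (inT (by linarith) le_rfl ht) (Or.inr (by linarith [ht.1]))
  rw [s1, z1, s2, z2, s3, z3, s4, z4, hkeq]
  ring

/-- The index counts the zeros modulo two. -/
theorem rectIndex_parity {F : ℝ → ℝ → ℂ} {A B c d : ℝ} (hcd : c ≤ d)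
    (hF : ContinuousOn (Function.uncurry F) (Set.Icc A B ×ˢ Set.Icc c d))
    (hfin : (rectZeros F A B c d).Finite)
    (hinj : ∀ s t t', F s t = 0 → F s t' = 0 → t ∈ Set.Icc c d → t' ∈ Set.Icc c d → t = t')
    (hbt : ∀ s ∈ Set.Icc A B, F s c ≠ 0 ∧ F s d ≠ 0)
    (hloc : ∀ p ∈ rectZeros F A B c d, HasOddLocalIndex F p.1 p.2) :
    ∀ (n : ℕ) (a b : ℝ), A ≤ a → a ≤ b → b ≤ B → (∀ t ∈ Set.Icc c d, F a t ≠ 0 ∧ F b t ≠ 0) →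
      (rectZeros F a b c d).ncard = n →
      ∃ k : ℤ, (k : ZMod 2) = n ∧ rectIndex F a b c d = k * (2 * Real.pi * Complex.I) := by
  intro n
  induction n using Nat.strong_induction_on with
  | _ n ih =>
  intro a b hA hab hB hlr hn
  have hsub : ∀ {a b}, A ≤ a → b ≤ B → rectZeros F a b c d ⊆ rectZeros F A B c d :=
    fun hA hB p hp => ⟨⟨⟨hA.trans hp.1.1.1, hp.1.1.2.trans hB⟩, hp.1.2⟩, hp.2⟩
  have hfin' := hfin.subset (hsub hA hB)
  rcases Nat.lt_or_ge n 2 with h2 | h2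
  · interval_cases n
    · refine ⟨0, by simp, ?_⟩
      rw [Set.ncard_eq_zero hfin'] at hn
      rw [rectIndex_eq_zero_of_le hF hab hcd hA hB le_rfl le_rfl, Int.cast_zero, zero_mul]
      intro s hs t ht h0
      have : (s, t) ∈ rectZeros F a b c d := ⟨⟨hs, ht⟩, h0⟩
      rw [hn] at this
      exact this
    · obtain ⟨⟨s₀, t₀⟩, hp⟩ := Set.ncard_eq_one.1 hn
      have hmem : (s₀, t₀) ∈ rectZeros F a b c d := by rw [hp]; rfl
      obtain ⟨⟨hs, ht⟩, h0⟩ := hmem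
      dsimp only at hs ht h0
      have hs' : s₀ ∈ Set.Ioo a b :=
        ⟨lt_of_le_of_ne hs.1 fun h => (hlr t₀ ht).1 (h ▸ h0),
          lt_of_le_of_ne hs.2 fun h => (hlr t₀ ht).2 (h ▸ h0)⟩
      have hsAB : s₀ ∈ Set.Icc A B := ⟨hA.trans hs.1, hs.2.trans hB⟩
      have ht' : t₀ ∈ Set.Ioo c d :=
        ⟨lt_of_le_of_ne ht.1 fun h => (hbt s₀ hsAB).1 (h ▸ h0),
          lt_of_le_of_ne ht.2 fun h => (hbt s₀ hsAB).2 (h ▸ h0)⟩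
      obtain ⟨k, hk, hk'⟩ := rectIndex_of_unique_zero
        (hF.mono (Set.prod_mono (Set.Icc_subset_Icc hA hB) subset_rfl)) hs' ht'
        (fun s hs t ht h => by
          have : (s, t) ∈ rectZeros F a b c d := ⟨⟨hs, ht⟩, h⟩
          rw [hp] at this
          exact Prod.ext_iff.1 this)
        (hloc (s₀, t₀) (hsub hA hB ⟨⟨hs, ht⟩, h0⟩))
      exact ⟨k, by rw [(ZMod.intCast_eq_one_iff_odd).2 hk]; simp, hk'⟩
  · obtain ⟨p, q, hp, hq, hpq⟩ := (Set.one_lt_ncard_iff hfin').1 (by omega)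
    have hne : p.1 ≠ q.1 := fun h => hpq (Prod.ext h
      (hinj p.1 p.2 q.2 hp.2 (h ▸ hq.2) hp.1.2 hq.1.2))
    wlog hlt : p.1 < q.1 generalizing p q
    · exact this q p hq hp hpq.symm hne.symm (lt_of_le_of_ne (not_lt.1 hlt) hne.symm)
    -- The two zeros have different first coordinates, so a vertical line separates them; it can
    -- avoid the finitely many first coordinates of zeros. Both halves then contain fewer zeros.
    obtain ⟨m, ⟨hm1, hm2⟩, hm⟩ := ((Set.Ioo_infinite hlt).sdiff (hfin'.image Prod.fst)).nonempty
    have hm0 : ∀ t ∈ Set.Icc c d, F m t ≠ 0 := fun t ht h0 =>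
      hm ⟨(m, t), ⟨⟨⟨hp.1.1.1.trans hm1.le, hm2.le.trans hq.1.1.2⟩, ht⟩, h0⟩, rfl⟩
    have ham : a < m := hp.1.1.1.trans_lt hm1
    have hmb : m < b := hm2.trans_le hq.1.1.2
    have hun : rectZeros F a m c d ∪ rectZeros F m b c d = rectZeros F a b c d := by
      ext ⟨s, t⟩
      simp only [rectZeros, Set.mem_union, Set.mem_ofPred_eq, Set.mem_prod, Set.mem_Icc]
      constructor
      · rintro (h | h)
        · exact ⟨⟨⟨h.1.1.1, h.1.1.2.trans hmb.le⟩, h.1.2⟩, h.2⟩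
        · exact ⟨⟨⟨ham.le.trans h.1.1.1, h.1.1.2⟩, h.1.2⟩, h.2⟩
      · intro h
        rcases le_total s m with hs | hs
        · exact Or.inl ⟨⟨⟨h.1.1.1, hs⟩, h.1.2⟩, h.2⟩
        · exact Or.inr ⟨⟨⟨hs, h.1.1.2⟩, h.1.2⟩, h.2⟩
    have hdis : Disjoint (rectZeros F a m c d) (rectZeros F m b c d) := by
      rw [Set.disjoint_left]
      rintro ⟨s, t⟩ h h'
      have : s = m := le_antisymm h.1.1.2 h'.1.1.1
      subst this
      exact hm0 t h.1.2 h.2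
    have f1 := hfin.subset (hsub hA (hmb.le.trans hB))
    have f2 := hfin.subset (hsub (hA.trans ham.le) hB)
    have hcard := Set.ncard_union_eq hdis f1 f2
    rw [hun, hn] at hcard
    have n1 : 0 < (rectZeros F a m c d).ncard :=
      (Set.ncard_pos f1).2 ⟨p, ⟨⟨hp.1.1.1, hm1.le⟩, hp.1.2⟩, hp.2⟩
    have n2 : 0 < (rectZeros F m b c d).ncard :=
      (Set.ncard_pos f2).2 ⟨q, ⟨⟨hm2.le, hq.1.1.2⟩, hq.1.2⟩, hq.2⟩
    obtain ⟨k1, hk1, hk1'⟩ := ih _ (by omega) a m hA ham.le (hmb.le.trans hB)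
      (fun t ht => ⟨(hlr t ht).1, hm0 t ht⟩) rfl
    obtain ⟨k2, hk2, hk2'⟩ := ih _ (by omega) m b (hA.trans ham.le) hmb.le hB
      (fun t ht => ⟨hm0 t ht, (hlr t ht).2⟩) rfl
    refine ⟨k1 + k2, ?_, ?_⟩
    · rw [hcard]; push_cast; rw [hk1, hk2]
    · rw [rectIndex_split_fst (Set.mem_uIcc.2 (Or.inl ⟨ham.le, hmb.le⟩))
        (nonvanishingOnSides_of_rect hF hab hcd hA hB le_rfl le_rfl
          (fun s hs => hbt s ⟨hA.trans hs.1, hs.2.trans hB⟩) hlr), hk1', hk2']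
      push_cast; ring

/-! ### The local index at a proper crossing -/

/-- A continuous injective function on an interval is strictly monotone, so the intermediate value
theorem supplies points with the values `±r`. This turns a small rectangle in curve parameters into
the symmetric square required by `rectIndex_axes_odd`. -/
theorem exists_symmetric_interval {α : ℝ → ℝ} {s₀ δ : ℝ} (hδ : 0 < δ)
    (hc : ContinuousOn α (Set.Icc (s₀ - δ) (s₀ + δ))) (hinj : Set.InjOn α (Set.Icc (s₀ - δ) (s₀ + δ)))
    (h0 : α s₀ = 0) :
    ∃ r₀ > 0, ∀ r, 0 < r → r ≤ r₀ → ∃ a b, s₀ - δ ≤ a ∧ a < s₀ ∧ s₀ < b ∧ b ≤ s₀ + δ ∧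
      (α a = -r ∧ α b = r ∨ α a = r ∧ α b = -r) ∧
      Set.MapsTo α (Set.Icc a b) (Set.Icc (-r) r) := by
  have mono : ∀ {α : ℝ → ℝ}, ContinuousOn α (Set.Icc (s₀ - δ) (s₀ + δ)) →
      StrictMonoOn α (Set.Icc (s₀ - δ) (s₀ + δ)) → α s₀ = 0 →
      ∃ r₀ > 0, ∀ r, 0 < r → r ≤ r₀ → ∃ a b, s₀ - δ ≤ a ∧ a < s₀ ∧ s₀ < b ∧ b ≤ s₀ + δ ∧
        (α a = -r ∧ α b = r) ∧ Set.MapsTo α (Set.Icc a b) (Set.Icc (-r) r) := by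
    intro α hc hm h0
    have hl : s₀ - δ ∈ Set.Icc (s₀ - δ) (s₀ + δ) := ⟨le_rfl, by linarith⟩
    have hr : s₀ + δ ∈ Set.Icc (s₀ - δ) (s₀ + δ) := ⟨by linarith, le_rfl⟩
    have hs : s₀ ∈ Set.Icc (s₀ - δ) (s₀ + δ) := ⟨by linarith, by linarith⟩
    have h1 : 0 < α (s₀ + δ) := h0 ▸ hm hs hr (by linarith)
    have h2 : α (s₀ - δ) < 0 := h0 ▸ hm hl hs (by linarith)
    refine ⟨min (α (s₀ + δ)) (-α (s₀ - δ)), lt_min h1 (by linarith), fun r hr0 hrle => ?_⟩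
    have hr1 := hrle.trans (min_le_left _ _)
    have hr2 := hrle.trans (min_le_right _ _)
    obtain ⟨b, hb, hbr⟩ := intermediate_value_Icc (by linarith : s₀ ≤ s₀ + δ)
      (hc.mono (Set.Icc_subset_Icc (by linarith) le_rfl)) (⟨by linarith, hr1⟩ : r ∈ Set.Icc _ _)
    obtain ⟨a, ha, har⟩ := intermediate_value_Icc (by linarith : s₀ - δ ≤ s₀)
      (hc.mono (Set.Icc_subset_Icc le_rfl (by linarith)))
      (⟨by linarith, by linarith⟩ : -r ∈ Set.Icc _ _)
    have haI : a ∈ Set.Icc (s₀ - δ) (s₀ + δ) := ⟨ha.1, by linarith [ha.2]⟩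
    have hbI : b ∈ Set.Icc (s₀ - δ) (s₀ + δ) := ⟨by linarith [hb.1], hb.2⟩
    refine ⟨a, b, ha.1, lt_of_le_of_ne ha.2 ?_, lt_of_le_of_ne hb.1 ?_, hb.2, ⟨har, hbr⟩, ?_⟩
    · rintro rfl; linarith
    · rintro rfl; linarith
    · intro x hx
      have hxI : x ∈ Set.Icc (s₀ - δ) (s₀ + δ) := ⟨haI.1.trans hx.1, hx.2.trans hbI.2⟩
      exact ⟨har ▸ hm.monotoneOn haI hxI hx.1, hbr ▸ hm.monotoneOn hxI hbI hx.2⟩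
  rcases hc.strictMonoOn_of_injOn_Icc' (by linarith) hinj with h | h
  · obtain ⟨r₀, hr₀, hr⟩ := mono hc h h0
    refine ⟨r₀, hr₀, fun r h1 h2 => ?_⟩
    obtain ⟨a, b, h3, h4, h5, h6, h7, h8⟩ := hr r h1 h2
    exact ⟨a, b, h3, h4, h5, h6, Or.inl h7, h8⟩
  · obtain ⟨r₀, hr₀, hr⟩ := mono (α := fun s => -α s) hc.neg h.neg (by simp [h0])
    refine ⟨r₀, hr₀, fun r h1 h2 => ?_⟩
    obtain ⟨a, b, h3, h4, h5, h6, h7, h8⟩ := hr r h1 h2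
    refine ⟨a, b, h3, h4, h5, h6, Or.inr ⟨by linarith [h7.1], by linarith [h7.2]⟩, fun x hx => ?_⟩
    have := h8 hx
    exact ⟨by linarith [this.2], by linarith [this.1]⟩

open Complex in
/-- For an injective `ψ`, the map `(u, v) ↦ ψ u - ψ (i v)` has an odd index at the origin. -/
theorem rectIndex_axes_odd {ψ : ℂ → ℂ} {ρ r : ℝ} (hψ : ContinuousOn ψ (Metric.ball 0 ρ))
    (hinj : Set.InjOn ψ (Metric.ball 0 ρ)) (hr : 0 < r) (hrρ : r < ρ) :
    ∃ k : ℤ, Odd k ∧ rectIndex (fun u v : ℝ => ψ u - ψ (I * v)) (-r) r (-r) r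
      = k * (2 * Real.pi * I) := by
  -- The two arguments of `ψ` always differ by `u - i v`, so injectivity excludes zeros away from
  -- the origin throughout the homotopy. At `τ = 1` the arguments are `±(u - i v)/2`, which makes `H
  -- 1` odd.
  set H : ℝ → ℝ → ℝ → ℂ := fun τ u v =>
    ψ (u - τ * (u + I * v) / 2) - ψ (I * v - τ * (u + I * v) / 2) with hH
  have hbound : ∀ τ ∈ Set.uIcc (0 : ℝ) 1, ∀ u ∈ Set.uIcc (-r) r, ∀ v ∈ Set.uIcc (-r) r,
      (u - τ * (u + I * v) / 2 : ℂ) ∈ Metric.ball (0 : ℂ) ρ ∧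
      (I * v - τ * (u + I * v) / 2 : ℂ) ∈ Metric.ball (0 : ℂ) ρ := by
    intro τ hτ u hu v hv
    rw [Set.uIcc_of_le zero_le_one] at hτ
    rw [Set.uIcc_of_le (by linarith)] at hu hv
    have hu' : ‖(u : ℂ)‖ ≤ r := by rw [norm_real, Real.norm_eq_abs]; exact abs_le.2 hu
    have hv' : ‖(I * v : ℂ)‖ ≤ r := by
      rw [norm_mul, norm_I, one_mul, norm_real, Real.norm_eq_abs]; exact abs_le.2 hv
    have gen : ∀ z w : ℂ, ‖z‖ ≤ r → ‖w‖ ≤ r →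
        ‖((1 - τ / 2 : ℝ) : ℂ) * z - ((τ / 2 : ℝ) : ℂ) * w‖ < ρ := by
      intro z w hz hw
      refine lt_of_le_of_lt (norm_sub_le _ _) ?_
      rw [norm_mul, norm_mul, norm_real, norm_real, Real.norm_of_nonneg (by linarith [hτ.2]),
        Real.norm_of_nonneg (by linarith [hτ.1])]
      have h1 := mul_le_mul_of_nonneg_left hz (by linarith [hτ.2] : 0 ≤ 1 - τ / 2)
      have h2 := mul_le_mul_of_nonneg_left hw (by linarith [hτ.1] : 0 ≤ τ / 2)
      nlinarith
    constructor
    · rw [mem_ball_zero_iff]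
      have := gen u (I * v) hu' hv'
      push_cast at this
      refine lt_of_eq_of_lt (congrArg _ ?_) this
      ring
    · rw [mem_ball_zero_iff]
      have := gen (I * v) u hv' hu'
      push_cast at this
      refine lt_of_eq_of_lt (congrArg _ ?_) this
      ring
  have hcont : ContinuousOn (fun p : ℝ × ℝ × ℝ => H p.1 p.2.1 p.2.2)
      (Set.uIcc 0 1 ×ˢ Set.uIcc (-r) r ×ˢ Set.uIcc (-r) r) := by
    refine ContinuousOn.sub ?_ ?_
    · exact hψ.comp (by fun_prop) fun p hp => (hbound _ hp.1 _ hp.2.1 _ hp.2.2).1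
    · exact hψ.comp (by fun_prop) fun p hp => (hbound _ hp.1 _ hp.2.1 _ hp.2.2).2
  have hne : ∀ τ ∈ Set.uIcc (0 : ℝ) 1, ∀ u ∈ Set.uIcc (-r) r, ∀ v ∈ Set.uIcc (-r) r,
      (u ≠ 0 ∨ v ≠ 0) → H τ u v ≠ 0 := by
    intro τ hτ u hu v hv hor h
    have hb := hbound τ hτ u hu v hv
    have := hinj hb.1 hb.2 (sub_eq_zero.1 h)
    have huv : (u : ℂ) = I * v := by linear_combination this
    have h1 := congrArg re huv
    have h2 := congrArg im huv
    simp at h1 h2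
    exact hor.elim (· h1) (· h2.symm)
  have hrr : r ∈ Set.uIcc (-r) r := Set.right_mem_uIcc
  have hrl : -r ∈ Set.uIcc (-r) r := Set.left_mem_uIcc
  have hr0 : r ≠ 0 := hr.ne'
  have hr0' : -r ≠ 0 := neg_ne_zero.2 hr0
  have hhom : rectIndex (H 0) (-r) r (-r) r = rectIndex (H 1) (-r) r (-r) r :=
    rectIndex_homotopy hcont
      (fun τ hτ s hs => ⟨hne τ hτ s hs _ hrl (Or.inr hr0'), hne τ hτ s hs _ hrr (Or.inr hr0)⟩)
      (fun τ hτ s hs => ⟨hne τ hτ _ hrl s hs (Or.inl hr0'), hne τ hτ _ hrr s hs (Or.inl hr0)⟩)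
  have h1mem : (1 : ℝ) ∈ Set.uIcc (0 : ℝ) 1 := Set.right_mem_uIcc
  have hH1 : ContinuousOn (Function.uncurry (H 1)) (Set.uIcc (-r) r ×ˢ Set.uIcc (-r) r) :=
    hcont.comp (f := fun p : ℝ × ℝ => ((1 : ℝ), p)) (by fun_prop) fun p hp => ⟨h1mem, hp⟩
  obtain ⟨k, hk, hk'⟩ := rectIndex_odd (G := H 1) hr.le (fun u v => by
    simp only [hH]
    rw [neg_sub]
    congr 2 <;> (push_cast; ring))
    ⟨⟨continuousOn_section_fst hH1 hrl, fun s hs => hne 1 h1mem s hs _ hrl (Or.inr hr0')⟩,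
      ⟨continuousOn_section_fst hH1 hrr, fun s hs => hne 1 h1mem s hs _ hrr (Or.inr hr0)⟩,
      ⟨continuousOn_section_snd hH1 hrl, fun s hs => hne 1 h1mem _ hrl s hs (Or.inl hr0')⟩,
      ⟨continuousOn_section_snd hH1 hrr, fun s hs => hne 1 h1mem _ hrr s hs (Or.inl hr0)⟩⟩
  refine ⟨k, hk, ?_⟩
  rw [← hk', ← hhom]
  congr 1
  funext u v
  simp [hH]

-- In the chart `φ` the curves run along the two axes, so `f s - g t = φ.symm u - φ.symm (i v)`,
-- where `u` depends only on `s` and `v` only on `t`, both injectively. A suitable rectangle is thus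
-- carried to the square `[-r, r]²`.
open Complex in
theorem hasOddLocalIndex_of_isProperCrossing {f g : ℝ → ℂ} {A B : Set ℂ} {s₀ t₀ : ℝ}
    (hf : Continuous f) (hg : Continuous g) (hfi : Set.InjOn f (Set.Icc 0 1))
    (hgi : Set.InjOn g (Set.Icc 0 1)) (hfA : Set.MapsTo f (Set.Icc 0 1) A)
    (hgB : Set.MapsTo g (Set.Icc 0 1) B) (hs₀ : s₀ ∈ Set.Ioo 0 1) (ht₀ : t₀ ∈ Set.Ioo 0 1)
    (heq : f s₀ = g t₀) (hX : IsProperCrossing A B (f s₀)) :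
    HasOddLocalIndex (fun s t => f s - g t) s₀ t₀ := by
  intro ε hε
  obtain ⟨φ, hsrc, h0, hφ⟩ := hX
  obtain ⟨ρ, hρ, hball⟩ := Metric.isOpen_iff.1 φ.open_target 0 (h0 ▸ φ.map_source hsrc)
  have near : ∀ {h : ℝ → ℂ} {x₀ : ℝ}, Continuous h → x₀ ∈ Set.Ioo (0 : ℝ) 1 → h x₀ = f s₀ →
      ∃ δ > 0, ∀ x ∈ Set.Icc (x₀ - δ) (x₀ + δ), x ∈ Set.Ioo (0 : ℝ) 1 ∧ h x ∈ φ.source ∧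
        φ (h x) ∈ Metric.ball 0 ρ ∧ x ∈ Set.Ioo (x₀ - ε) (x₀ + ε) := by
    intro h x₀ hh hx₀ hhx
    have hsrc' : h x₀ ∈ φ.source := hhx ▸ hsrc
    have e1 : ∀ᶠ x in nhds x₀, x ∈ Set.Ioo (0 : ℝ) 1 := isOpen_Ioo.mem_nhds hx₀
    have e2 : ∀ᶠ x in nhds x₀, h x ∈ φ.source :=
      hh.continuousAt.eventually (φ.open_source.mem_nhds hsrc')
    have e3 : ∀ᶠ x in nhds x₀, φ (h x) ∈ Metric.ball 0 ρ := by
      refine (ContinuousAt.comp (φ.continuousAt hsrc') hh.continuousAt).eventually ?_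
      apply Metric.isOpen_ball.mem_nhds
      rw [Function.comp_apply, hhx, h0]; exact Metric.mem_ball_self hρ
    have e4 : ∀ᶠ x in nhds x₀, x ∈ Set.Ioo (x₀ - ε) (x₀ + ε) :=
      isOpen_Ioo.mem_nhds ⟨by linarith, by linarith⟩
    obtain ⟨δ, hδ, hsub⟩ := Metric.nhds_basis_closedBall.eventually_iff.1
      (e1.and (e2.and (e3.and e4)))
    refine ⟨δ, hδ, fun x hx => hsub ?_⟩
    rwa [Real.closedBall_eq_Icc]
  obtain ⟨δ, hδ, hδ'⟩ := near hf hs₀ rfl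
  obtain ⟨η, hη, hη'⟩ := near hg ht₀ heq.symm
  have fφ : ∀ s ∈ Set.Icc (s₀ - δ) (s₀ + δ), φ (f s) = ((φ (f s)).re : ℂ) := fun s hs => by
    have h := hδ' s hs
    have := ((hφ _ h.2.1).1).1 (hfA ⟨h.1.1.le, h.1.2.le⟩)
    apply Complex.ext <;> simp [this]
  have gφ : ∀ t ∈ Set.Icc (t₀ - η) (t₀ + η), φ (g t) = I * ((φ (g t)).im : ℂ) := fun t ht => by
    have h := hη' t ht
    have := ((hφ _ h.2.1).2).1 (hgB ⟨h.1.1.le, h.1.2.le⟩)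
    apply Complex.ext <;> simp [this]
  obtain ⟨r₁, hr₁, hr₁'⟩ := exists_symmetric_interval (α := fun s => (φ (f s)).re) hδ
    (continuous_re.comp_continuousOn (φ.continuousOn.comp hf.continuousOn
      fun s hs => (hδ' s hs).2.1))
    (fun s hs s' hs' h => by
      dsimp only at h
      have e : φ (f s) = φ (f s') := by rw [fφ s hs, fφ s' hs', h]
      have a1 := hδ' s hs
      have a2 := hδ' s' hs'
      exact hfi ⟨a1.1.1.le, a1.1.2.le⟩ ⟨a2.1.1.le, a2.1.2.le⟩ (φ.injOn a1.2.1 a2.2.1 e))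
    (by simp [h0])
  obtain ⟨r₂, hr₂, hr₂'⟩ := exists_symmetric_interval (α := fun s => (φ (g s)).im) hη
    (continuous_im.comp_continuousOn (φ.continuousOn.comp hg.continuousOn
      fun s hs => (hη' s hs).2.1))
    (fun s hs s' hs' h => by
      dsimp only at h
      have e : φ (g s) = φ (g s') := by rw [gφ s hs, gφ s' hs', h]
      have a1 := hη' s hs
      have a2 := hη' s' hs'
      exact hgi ⟨a1.1.1.le, a1.1.2.le⟩ ⟨a2.1.1.le, a2.1.2.le⟩ (φ.injOn a1.2.1 a2.2.1 e))
    (by simp [← heq, h0])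
  set r := min (min r₁ r₂) (ρ / 2)
  have hr : 0 < r := lt_min (lt_min hr₁ hr₂) (by linarith)
  have hrρ : r < ρ := (min_le_right _ _).trans_lt (by linarith)
  obtain ⟨a, b, ha1, ha2, hb1, hb2, hab, hmab⟩ :=
    hr₁' r hr ((min_le_left _ _).trans (min_le_left _ _))
  obtain ⟨c, d, hc1, hc2, hd1, hd2, hcd, hmcd⟩ :=
    hr₂' r hr ((min_le_left _ _).trans (min_le_right _ _))
  obtain ⟨k, hk, hk'⟩ := rectIndex_axes_odd (φ.continuousOn_symm.mono hball)
    (φ.symm.injOn.mono hball) hr hrρ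
  have haI : a ∈ Set.Icc (s₀ - δ) (s₀ + δ) := ⟨ha1, by linarith⟩
  have hbI : b ∈ Set.Icc (s₀ - δ) (s₀ + δ) := ⟨by linarith, hb2⟩
  have hcI : c ∈ Set.Icc (t₀ - η) (t₀ + η) := ⟨hc1, by linarith⟩
  have hdI : d ∈ Set.Icc (t₀ - η) (t₀ + η) := ⟨by linarith, hd2⟩
  refine ⟨a, b, c, d, (hδ' a haI).2.2.2.1, ha2, hb1, (hδ' b hbI).2.2.2.2, (hη' c hcI).2.2.2.1, hc2,
    hd1, (hη' d hdI).2.2.2.2, ?_⟩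
  set G : ℝ → ℝ → ℂ := fun u v => φ.symm u - φ.symm (I * v) with hG
  have hab' : a ≤ b := by linarith
  have hcd' : c ≤ d := by linarith
  have hsubs : Set.Icc a b ⊆ Set.Icc (s₀ - δ) (s₀ + δ) := Set.Icc_subset_Icc ha1 hb2
  have hsubt : Set.Icc c d ⊆ Set.Icc (t₀ - η) (t₀ + η) := Set.Icc_subset_Icc hc1 hd2
  have hcongr : rectIndex (fun s t => f s - g t) a b c d =
      rectIndex (fun s t => G (φ (f s)).re (φ (g t)).im) a b c d := by
    have e : ∀ s ∈ Set.uIcc a b, ∀ t ∈ Set.uIcc c d,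
        f s - g t = G (φ (f s)).re (φ (g t)).im := by
      intro s hs t ht
      rw [Set.uIcc_of_le hab'] at hs
      rw [Set.uIcc_of_le hcd'] at ht
      simp only [hG]
      rw [← fφ s (hsubs hs), ← gφ t (hsubt ht), φ.left_inv (hδ' s (hsubs hs)).2.1,
        φ.left_inv (hη' t (hsubt ht)).2.1]
    simp only [rectIndex]
    rw [logChange_congr fun s hs => e s hs c Set.left_mem_uIcc,
      logChange_congr fun s hs => e s hs d Set.right_mem_uIcc,
      logChange_congr fun t ht => e a Set.left_mem_uIcc t ht,
      logChange_congr fun t ht => e b Set.right_mem_uIcc t ht]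
  have hGb : ∀ u ∈ Set.uIcc (-r) r, (u : ℂ) ∈ Metric.ball (0 : ℂ) ρ ∧
      (I * u : ℂ) ∈ Metric.ball (0 : ℂ) ρ := by
    intro u hu
    rw [Set.uIcc_of_le (by linarith)] at hu
    have : |u| < ρ := lt_of_le_of_lt (abs_le.2 hu) hrρ
    simpa using this
  have hGc : ContinuousOn (Function.uncurry G) (Set.uIcc (-r) r ×ˢ Set.uIcc (-r) r) := by
    refine ContinuousOn.sub ?_ ?_
    · exact (φ.continuousOn_symm.mono hball).comp (f := fun p : ℝ × ℝ => (p.1 : ℂ)) (by fun_prop)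
        fun p hp => (hGb _ hp.1).1
    · exact (φ.continuousOn_symm.mono hball).comp (f := fun p : ℝ × ℝ => (I * p.2 : ℂ))
        (by fun_prop) fun p hp => (hGb _ hp.2).2
  have hGne : ∀ u ∈ Set.uIcc (-r) r, ∀ v ∈ Set.uIcc (-r) r, (u ≠ 0 ∨ v ≠ 0) → G u v ≠ 0 := by
    intro u hu v hv hor h
    have huv := φ.symm.injOn (hball (hGb u hu).1) (hball (hGb v hv).2) (sub_eq_zero.1 h)
    have h1 := congrArg re huv
    have h2 := congrArg im huv
    simp at h1 h2
    exact hor.elim (· h1) (· h2.symm)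
  have hend : ∀ {x y : ℝ}, (x = -r ∧ y = r ∨ x = r ∧ y = -r) →
      (x ∈ Set.uIcc (-r) r ∧ x ≠ 0) ∧ (y ∈ Set.uIcc (-r) r ∧ y ≠ 0) := by
    rintro x y (⟨rfl, rfl⟩ | ⟨rfl, rfl⟩)
    · exact ⟨⟨Set.left_mem_uIcc, by linarith⟩, Set.right_mem_uIcc, by linarith⟩
    · exact ⟨⟨Set.right_mem_uIcc, by linarith⟩, Set.left_mem_uIcc, by linarith⟩
  obtain ⟨⟨ea, na⟩, eb, nb⟩ := hend hab
  obtain ⟨⟨ec, nc⟩, ed, nd⟩ := hend hcd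
  have hcomp := rectIndex_comp (G := G) (α := fun s => (φ (f s)).re) (β := fun t => (φ (g t)).im)
    (a := a) (b := b) (c := c) (d := d) (m := -r) (M := r) (m' := -r) (M' := r)
    (by
      rw [Set.uIcc_of_le hab']
      exact continuous_re.comp_continuousOn (φ.continuousOn.comp hf.continuousOn
        fun s hs => (hδ' s (hsubs hs)).2.1))
    (by
      rw [Set.uIcc_of_le hcd']
      exact continuous_im.comp_continuousOn (φ.continuousOn.comp hg.continuousOn
        fun s hs => (hη' s (hsubt hs)).2.1))
    (by rw [Set.uIcc_of_le hab', Set.uIcc_of_le (by linarith)]; exact hmab)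
    (by rw [Set.uIcc_of_le hcd', Set.uIcc_of_le (by linarith)]; exact hmcd)
    ⟨continuousOn_section_fst hGc ec, fun u hu => hGne u hu _ ec (Or.inr nc)⟩
    ⟨continuousOn_section_fst hGc ed, fun u hu => hGne u hu _ ed (Or.inr nd)⟩
    ⟨continuousOn_section_snd hGc ea, fun u hu => hGne _ ea u hu (Or.inl na)⟩
    ⟨continuousOn_section_snd hGc eb, fun u hu => hGne _ eb u hu (Or.inl nb)⟩
  rw [hcongr, hcomp]
  -- Each curve may run along its axis in either direction; a reversal only changes the sign of the
  -- index.
  rcases hab with ⟨e1, e2⟩ | ⟨e1, e2⟩ <;> rcases hcd with ⟨e3, e4⟩ | ⟨e3, e4⟩ <;>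
    simp only [e1, e2, e3, e4]
  · exact ⟨k, hk, hk'⟩
  · exact ⟨-k, hk.neg, by rw [rectIndex_symm_snd, hk']; push_cast; ring⟩
  · exact ⟨-k, hk.neg, by rw [rectIndex_symm_fst, hk']; push_cast; ring⟩
  · exact ⟨k, hk, by rw [rectIndex_symm_fst, rectIndex_symm_snd, hk']; ring⟩

/-! ### Crossing parities of a drawing -/

/-- `f` parametrizes the simple curve `S` from the point of `a` to the point of `b`. -/
structure IsArcParam {V : Type*} (vert : V → ℂ) (S : Set ℂ) (f : ℝ → ℂ) (a b : V) : Prop where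
  continuous : Continuous f
  injOn : Set.InjOn f (Set.Icc 0 1)
  image : f '' Set.Icc 0 1 = S
  zero : f 0 = vert a
  one : f 1 = vert b

/-- The curve `f` from `a` to `b` makes `n` more turns around the point of `v` than the principal
logarithm tells. -/
def HasTurns {V : Type*} (vert : V → ℂ) (f : ℝ → ℂ) (a b v : V) (n : ℤ) : Prop :=
  logChange (fun s => f s - vert v) 0 1 =
    Complex.log (vert b - vert v) - Complex.log (vert a - vert v) + n * (2 * Real.pi * Complex.I)

/-- `t u v` records how the principal logarithms of the two directions between `u` and `v`
differ. -/
def IsFlip {V : Type*} (vert : V → ℂ) (t : V → V → ℤ) : Prop :=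
  ∀ u v, u ≠ v → Complex.log (vert v - vert u) - Complex.log (vert u - vert v)
    = (1 - 2 * t u v) * (Real.pi * Complex.I)

open Complex in
theorem exists_isFlip {V : Type*} {vert : V → ℂ} (h : Function.Injective vert) :
    ∃ t, IsFlip vert t := by
  have : ∀ u v, ∃ k : ℤ, u ≠ v → Complex.log (vert v - vert u) - Complex.log (vert u - vert v)
      = (1 - 2 * k) * (Real.pi * I) := by
    intro u v
    by_cases huv : u = v
    · exact ⟨0, fun h => absurd huv h⟩
    have h1 : vert v - vert u ≠ 0 := sub_ne_zero.2 fun e => huv (h e).symm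
    have h2 : vert u - vert v ≠ 0 := sub_ne_zero.2 fun e => huv (h e)
    have : exp (Complex.log (vert v - vert u) - Complex.log (vert u - vert v))
        = exp (Real.pi * I) := by
      rw [exp_sub, exp_log h1, exp_log h2, exp_pi_mul_I, ← neg_sub (vert u), neg_div, div_self h2]
    obtain ⟨n, hn⟩ := exp_eq_exp_iff_exists_int.1 this
    exact ⟨-n, fun _ => by rw [hn]; push_cast; ring⟩
  choose t ht using this
  exact ⟨t, ht⟩

theorem IsFlip.add_eq_one {V : Type*} {vert : V → ℂ} {t : V → V → ℤ} (h : IsFlip vert t)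
    {u v : V} (huv : u ≠ v) : t u v + t v u = 1 := by
  have h1 := h u v huv
  have h2 := h v u huv.symm
  have hpi : (Real.pi * Complex.I : ℂ) ≠ 0 := by simp [Real.pi_ne_zero]
  have h3 : (2 * ((t u v + t v u : ℤ) : ℂ) - 2) * (Real.pi * Complex.I : ℂ) = 0 := by
    push_cast; linear_combination h1 + h2
  have h4 := (mul_eq_zero.1 h3).resolve_right hpi
  have h5 : ((t u v + t v u : ℤ) : ℂ) = ((1 : ℤ) : ℂ) := by
    push_cast at h4 ⊢; linear_combination h4 / 2
  exact_mod_cast h5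

open Complex in
theorem exists_hasTurns {V : Type*} {vert : V → ℂ} {S : Set ℂ} {f : ℝ → ℂ} {a b v : V}
    (hf : IsArcParam vert S f a b) (hv : vert v ∉ S) : ∃ n, HasTurns vert f a b v n := by
  have hn : NonvanishingOn (fun s => f s - vert v) 0 1 := by
    refine ⟨(hf.continuous.sub continuous_const).continuousOn, fun x hx h0 => hv ?_⟩
    rw [Set.uIcc_of_le zero_le_one] at hx
    rw [← hf.image]
    exact ⟨x, hx, sub_eq_zero.1 h0⟩
  have h0 := hn.2 0 Set.left_mem_uIcc
  have h1 := hn.2 1 Set.right_mem_uIcc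
  have hexp := exp_logChange hn
  dsimp only at h0 h1 hexp
  rw [hf.zero] at h0 hexp
  rw [hf.one] at h1 hexp
  have : exp (logChange (fun s => f s - vert v) 0 1) =
      exp (Complex.log (vert b - vert v) - Complex.log (vert a - vert v)) := by
    rw [hexp, exp_sub, exp_log h0, exp_log h1]
  exact exp_eq_exp_iff_exists_int.1 this

theorem Drawing.exists_param {V : Type*} {G : SimpleGraph V} (D : Drawing G) (e : G.edgeSet) :
    ∃ (f : ℝ → ℂ) (a b : V), (e : Sym2 V) = s(a, b) ∧ IsArcParam D.vert (D.edge e) f a b := by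
  obtain ⟨γ, hγ, hr, hends⟩ := D.edge_arc e
  obtain ⟨⟨a, b⟩, hab⟩ := (e : Sym2 V).exists_rep
  have hab : (e : Sym2 V) = s(a, b) := hab.symm
  have main : ∀ a b, γ 0 = D.vert a → γ 1 = D.vert b →
      IsArcParam D.vert (D.edge e) (Set.IccExtend zero_le_one γ) a b := by
    intro a b h0 h1
    refine ⟨γ.continuous.Icc_extend', ?_, ?_, ?_, ?_⟩
    · intro x hx y hy h
      rw [Set.IccExtend_of_mem _ _ hx, Set.IccExtend_of_mem _ _ hy] at h
      exact congrArg Subtype.val (hγ h)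
    · rw [← hr]
      ext z
      constructor
      · rintro ⟨x, hx, rfl⟩
        rw [Set.IccExtend_of_mem _ _ hx]
        exact ⟨_, rfl⟩
      · rintro ⟨x, rfl⟩
        exact ⟨x, x.2, Set.IccExtend_of_mem _ _ x.2⟩
    · rw [Set.IccExtend_left]; exact h0
    · rw [Set.IccExtend_right]; exact h1
  rw [hab, Sym2.map_mk, Sym2.eq_iff] at hends
  rcases hends with ⟨h0, h1⟩ | ⟨h0, h1⟩
  · exact ⟨_, a, b, hab, main a b h0 h1⟩
  · exact ⟨_, b, a, by rw [hab, Sym2.eq_swap], main b a h0 h1⟩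

/-- The number of crossings of two independent edges, modulo two, as an index. -/
theorem Drawing.crossings_index {V : Type*} {G : SimpleGraph V} (D : Drawing G)
    {e e' : G.edgeSet} (hind : IndependentEdges (e : Sym2 V) (e' : Sym2 V)) {f g : ℝ → ℂ}
    {a b c d : V} (he : (e : Sym2 V) = s(a, b)) (he' : (e' : Sym2 V) = s(c, d))
    (hf : IsArcParam D.vert (D.edge e) f a b) (hg : IsArcParam D.vert (D.edge e') g c d) :
    ∃ k : ℤ, (k : ZMod 2) = (D.crossings e e').ncard ∧
      logChange (fun s => f s - D.vert c) 0 1 + logChange (fun s => g s - D.vert b) 0 1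
        - logChange (fun s => f s - D.vert d) 0 1 - logChange (fun s => g s - D.vert a) 0 1
        = k * (2 * Real.pi * Complex.I) := by
  have hne : e ≠ e' := by
    rintro rfl
    exact hind a ⟨by rw [he]; simp, by rw [he]; simp⟩
  have hnv : ∀ v, D.vert v ∈ D.edge e → D.vert v ∉ D.edge e' := fun v h h' =>
    hind v ⟨D.vert_mem_edge v e h, D.vert_mem_edge v e' h'⟩
  have hfm : ∀ s ∈ Set.Icc (0 : ℝ) 1, f s ∈ D.edge e := fun s hs => hf.image ▸ ⟨s, hs, rfl⟩
  have hgm : ∀ s ∈ Set.Icc (0 : ℝ) 1, g s ∈ D.edge e' := fun s hs => hg.image ▸ ⟨s, hs, rfl⟩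
  have m0 : (0 : ℝ) ∈ Set.Icc (0 : ℝ) 1 := ⟨le_rfl, zero_le_one⟩
  have m1 : (1 : ℝ) ∈ Set.Icc (0 : ℝ) 1 := ⟨zero_le_one, le_rfl⟩
  have hva : D.vert a ∉ D.edge e' := hnv a (hf.zero ▸ hfm 0 m0)
  have hvb : D.vert b ∉ D.edge e' := hnv b (hf.one ▸ hfm 1 m1)
  have hvc : D.vert c ∉ D.edge e := fun h => hnv c h (hg.zero ▸ hgm 0 m0)
  have hvd : D.vert d ∉ D.edge e := fun h => hnv d h (hg.one ▸ hgm 1 m1)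
  -- On the sides of the unit square `F` is one curve minus an endpoint of the other, up to sign.
  -- Inside, its zeros correspond bijectively to the crossings because both curves are simple.
  set F : ℝ → ℝ → ℂ := fun s t => f s - g t with hF
  have hFc : Continuous (Function.uncurry F) :=
    (hf.continuous.comp continuous_fst).sub (hg.continuous.comp continuous_snd)
  have hbt : ∀ s ∈ Set.Icc (0 : ℝ) 1, F s 0 ≠ 0 ∧ F s 1 ≠ 0 := by
    intro s hs
    simp only [hF, hg.zero, hg.one]
    exact ⟨fun h => hvc (sub_eq_zero.1 h ▸ hfm s hs), fun h => hvd (sub_eq_zero.1 h ▸ hfm s hs)⟩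
  have hlr : ∀ s ∈ Set.Icc (0 : ℝ) 1, F 0 s ≠ 0 ∧ F 1 s ≠ 0 := by
    intro s hs
    simp only [hF, hf.zero, hf.one]
    exact ⟨fun h => hva (sub_eq_zero.1 h ▸ hgm s hs), fun h => hvb (sub_eq_zero.1 h ▸ hgm s hs)⟩
  have himg : (fun p : ℝ × ℝ => f p.1) '' rectZeros F 0 1 0 1 = D.crossings e e' := by
    ext z
    constructor
    · rintro ⟨⟨s, t⟩, ⟨⟨hs, ht⟩, h0⟩, rfl⟩
      have hst : f s = g t := sub_eq_zero.1 h0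
      refine ⟨⟨hfm s hs, ?_⟩, ?_⟩
      · dsimp only; rw [hst]; exact hgm t ht
      · rintro ⟨v, hv⟩
        dsimp only at hv
        exact hnv v (hv ▸ hfm s hs) (by rw [hv, hst]; exact hgm t ht)
    · rintro ⟨⟨h1, h2⟩, -⟩
      rw [← hf.image] at h1
      rw [← hg.image] at h2
      obtain ⟨s, hs, rfl⟩ := h1
      obtain ⟨t, ht, hst⟩ := h2
      exact ⟨(s, t), ⟨⟨hs, ht⟩, sub_eq_zero.2 hst.symm⟩, rfl⟩
  have hinjZ : Set.InjOn (fun p : ℝ × ℝ => f p.1) (rectZeros F 0 1 0 1) := by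
    rintro ⟨s, t⟩ ⟨⟨hs, ht⟩, h0⟩ ⟨s', t'⟩ ⟨⟨hs', ht'⟩, h0'⟩ h
    dsimp only at h hs ht hs' ht' h0 h0'
    have h1 := hf.injOn hs hs' h
    have h2 := hg.injOn ht ht' ((sub_eq_zero.1 h0).symm.trans (h.trans (sub_eq_zero.1 h0')))
    rw [h1, h2]
  have hfin : (rectZeros F 0 1 0 1).Finite := by
    refine Set.Finite.of_finite_image ?_ hinjZ
    rw [himg]
    exact (D.inter_finite e e' hne).sdiff
  obtain ⟨k, hk, hk'⟩ := rectIndex_parity (F := F) (A := 0) (B := 1) (c := 0) (d := 1) zero_le_one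
    hFc.continuousOn hfin
    (fun s t t' h h' ht ht' => hg.injOn ht ht' ((sub_eq_zero.1 h).symm.trans (sub_eq_zero.1 h')))
    hbt
    (fun ⟨s, t⟩ ⟨⟨hs, ht⟩, h0⟩ => by
      dsimp only at hs ht h0 ⊢
      have hst : f s = g t := sub_eq_zero.1 h0
      refine hasOddLocalIndex_of_isProperCrossing hf.continuous hg.continuous hf.injOn hg.injOn
        hfm hgm ?_ ?_ hst ?_
      · exact ⟨lt_of_le_of_ne hs.1 fun h => (hlr t ht).1 (h ▸ h0),
          lt_of_le_of_ne hs.2 fun h => (hlr t ht).2 (h ▸ h0)⟩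
      · exact ⟨lt_of_le_of_ne ht.1 fun h => (hbt s hs).1 (h ▸ h0),
          lt_of_le_of_ne ht.2 fun h => (hbt s hs).2 (h ▸ h0)⟩
      · rcases D.inter_proper e e' hne (f s) ⟨hfm s hs, hst ▸ hgm t ht⟩ with ⟨v, h1, h2, -⟩ | h
        · exact absurd ⟨h1, h2⟩ (hind v)
        · exact h)
    _ 0 1 le_rfl zero_le_one le_rfl hlr rfl
  refine ⟨k, ?_, ?_⟩
  · rw [hk, ← himg, hinjZ.ncard_image]
  · rw [← hk']
    have neg : ∀ v, D.vert v ∉ D.edge e' →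
        logChange (fun t => D.vert v - g t) 0 1 = logChange (fun t => g t - D.vert v) 0 1 := by
      intro v hv
      rw [← logChange_neg (F := fun t => g t - D.vert v)]
      · simp only [neg_sub]
      · refine ⟨(hg.continuous.sub continuous_const).continuousOn, fun x hx h0 => hv ?_⟩
        rw [Set.uIcc_of_le zero_le_one] at hx
        rw [← sub_eq_zero.1 h0]
        exact hgm x hx
    simp only [rectIndex, hF, hf.zero, hf.one, hg.zero, hg.one]
    rw [neg a hva, neg b hvb]

/-- The crossing parity of two independent edges in terms of turns around vertices. -/
theorem Drawing.crossings_parity {V : Type*} {G : SimpleGraph V} (D : Drawing G)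
    {e e' : G.edgeSet} (hind : IndependentEdges (e : Sym2 V) (e' : Sym2 V)) {f g : ℝ → ℂ}
    {a b c d : V} (he : (e : Sym2 V) = s(a, b)) (he' : (e' : Sym2 V) = s(c, d))
    (hf : IsArcParam D.vert (D.edge e) f a b) (hg : IsArcParam D.vert (D.edge e') g c d)
    {t : V → V → ℤ} (ht : IsFlip D.vert t) {nc nd ma mb : ℤ}
    (hnc : HasTurns D.vert f a b c nc) (hnd : HasTurns D.vert f a b d nd)
    (hma : HasTurns D.vert g c d a ma) (hmb : HasTurns D.vert g c d b mb) :
    ((D.crossings e e').ncard : ZMod 2) =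
      ((t c a + t c b + t d a + t d b + nc + nd + ma + mb : ℤ) : ZMod 2) := by
  obtain ⟨k, hk, hk'⟩ := D.crossings_index hind he he' hf hg
  rw [← hk]
  have hac : a ≠ c := fun h => hind a ⟨by rw [he]; simp, by rw [he', h]; simp⟩
  have had : a ≠ d := fun h => hind a ⟨by rw [he]; simp, by rw [he', h]; simp⟩
  have hbc : b ≠ c := fun h => hind b ⟨by rw [he]; simp, by rw [he', h]; simp⟩
  have hbd : b ≠ d := fun h => hind b ⟨by rw [he]; simp, by rw [he', h]; simp⟩
  rw [hnc, hnd, hma, hmb] at hk'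
  have t1 := ht c a hac.symm
  have t2 := ht c b hbc.symm
  have t3 := ht d a had.symm
  have t4 := ht d b hbd.symm
  -- Around the square the principal logarithms cancel up to the differences between `log w` and
  -- `log (-w)` for the four vertex pairs; these are the terms `t`.
  have key : ((k : ℤ) : ℂ) * (2 * Real.pi * Complex.I) =
      ((t c a - t c b - t d a + t d b + nc - nd + mb - ma : ℤ) : ℂ) * (2 * Real.pi * Complex.I) := by
    rw [← hk']
    push_cast
    linear_combination t2 - t1 - t4 + t3
  have hk2 := mul_right_cancel₀ Complex.two_pi_I_ne_zero key
  have hk3 : k = t c a - t c b - t d a + t d b + nc - nd + mb - ma := by exact_mod_cast hk2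
  rw [hk3, ZMod.intCast_eq_intCast_iff_dvd_sub]
  exact ⟨t c b + t d a + nd + ma, by push_cast; ring⟩

/-- The right-hand side is symmetric in `a`, `b` and in `c`, `d`, so the orientations chosen by the
parametrizations do not matter, and the turns are needed only modulo two. -/
theorem Drawing.parity_of_turns {V : Type*} {G : SimpleGraph V} (D : Drawing G) {t : V → V → ℤ}
    (ht : IsFlip D.vert t) {f : G.edgeSet → ℝ → ℂ} {src tgt : G.edgeSet → V}
    (hends : ∀ e : G.edgeSet, (e : Sym2 V) = s(src e, tgt e))
    (hparam : ∀ e, IsArcParam D.vert (D.edge e) (f e) (src e) (tgt e)) {y : Sym2 V → V → ZMod 2}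
    (hy : ∀ (e : G.edgeSet) (v : V), v ∉ (e : Sym2 V) →
      ∃ n : ℤ, HasTurns D.vert (f e) (src e) (tgt e) v n ∧ (n : ZMod 2) = y e v)
    (e e' : G.edgeSet) {a b c d : V} (hab : (e : Sym2 V) = s(a, b)) (hcd : (e' : Sym2 V) = s(c, d))
    (hind : IndependentEdges (e : Sym2 V) (e' : Sym2 V)) :
    ((D.crossings e e').ncard : ZMod 2) = t c a + t c b + t d a + t d b +
      (y s(a, b) c + y s(a, b) d + y s(c, d) a + y s(c, d) b) := by
  have hs := hends e
  have hs' := hends e'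
  have left : ∀ {z : Sym2 V} {p q : V}, z = s(p, q) → p ∈ z := by rintro z p q rfl; simp
  have right : ∀ {z : Sym2 V} {p q : V}, z = s(p, q) → q ∈ z := by rintro z p q rfl; simp
  obtain ⟨nc, hnc, hc⟩ := hy e (src e') fun h => hind _ ⟨h, left hs'⟩
  obtain ⟨nd, hnd, hd⟩ := hy e (tgt e') fun h => hind _ ⟨h, right hs'⟩
  obtain ⟨ma, hma, ha⟩ := hy e' (src e) fun h => hind _ ⟨left hs, h⟩
  obtain ⟨mb, hmb, hb⟩ := hy e' (tgt e) fun h => hind _ ⟨right hs, h⟩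
  rw [D.crossings_parity hind hs hs' (hparam e) (hparam e') ht hnc hnd hma hmb]
  push_cast
  rw [hc, hd, ha, hb, ← hab, ← hcd]
  rcases Sym2.eq_iff.1 (hab.symm.trans hs) with ⟨h1, h2⟩ | ⟨h1, h2⟩ <;>
    rcases Sym2.eq_iff.1 (hcd.symm.trans hs') with ⟨h3, h4⟩ | ⟨h3, h4⟩ <;>
    rw [← h1, ← h2, ← h3, ← h4] <;> ring

/-- The pairs of edges of a drawing that cross an odd number of times form the convex drawing up
to edge-vertex switches. -/
theorem Drawing.exists_parity {V : Type*} {G : SimpleGraph V} (D : Drawing G) :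
    ∃ (t : V → V → ZMod 2) (y : Sym2 V → V → ZMod 2), (∀ u v, u ≠ v → t u v + t v u = 1) ∧
      ∀ (e e' : G.edgeSet) (a b c d : V), (e : Sym2 V) = s(a, b) → (e' : Sym2 V) = s(c, d) →
        IndependentEdges (e : Sym2 V) (e' : Sym2 V) →
        ((D.crossings e e').ncard : ZMod 2) = t c a + t c b + t d a + t d b +
          (y s(a, b) c + y s(a, b) d + y s(c, d) a + y s(c, d) b) := by
  obtain ⟨t, ht⟩ := exists_isFlip D.vert_injective
  choose f src tgt hends hparam using D.exists_param
  have : ∀ (e : Sym2 V) (v : V), ∃ n : ℤ, ∀ h : e ∈ G.edgeSet, v ∉ e →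
      HasTurns D.vert (f ⟨e, h⟩) (src ⟨e, h⟩) (tgt ⟨e, h⟩) v n := by
    intro e v
    by_cases h : e ∈ G.edgeSet ∧ v ∉ e
    · obtain ⟨n, hn⟩ := exists_hasTurns (hparam ⟨e, h.1⟩)
        (v := v) (fun hv => h.2 (D.vert_mem_edge v _ hv))
      exact ⟨n, fun _ _ => hn⟩
    · exact ⟨0, fun h1 h2 => absurd ⟨h1, h2⟩ h⟩
  choose n hn using this
  refine ⟨fun u v => t u v, fun e v => n e v, fun u v huv => ?_, ?_⟩
  · have := ht.add_eq_one huv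
    dsimp only
    exact_mod_cast congrArg (Int.cast : ℤ → ZMod 2) this
  · intro e e' a b c d hab hcd hind
    exact D.parity_of_turns ht hends hparam (y := fun e v => (n e v : ZMod 2))
      (fun e v hv => ⟨n e v, hn e v e.2 hv, rfl⟩) e e' hab hcd hind

/-! ### The linear algebra of edge-vertex switches -/

/-- The sum of `X` over the fifteen pairs of independent edges of a complete graph on five
vertices. -/
def sumK5 {V : Type*} (X : V → V → V → V → ZMod 2) (a b c d e : V) : ZMod 2 :=
  X a b c d + X a c b d + X a d b c + X a b c e + X a c b e + X a e b c +
  X a b d e + X a d b e + X a e b d + X a c d e + X a d c e + X a e c d +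
  X b c d e + X b d c e + X b e c d

/-- The sum of `X` over the nine pairs of independent edges of two disjoint triangles. -/
def sum2K3 {V : Type*} (X : V → V → V → V → ZMod 2) (a b c d e f : V) : ZMod 2 :=
  X a b d e + X a b d f + X a b e f + X a c d e + X a c d f + X a c e f +
  X b c d e + X b c d f + X b c e f

/-- The coboundary of `Y`, a combination of edge-vertex switches. -/
def switchSum {V : Type*} (Y : Sym2 V → V → ZMod 2) (a b c d : V) : ZMod 2 :=
  Y s(a, b) c + Y s(a, b) d + Y s(c, d) a + Y s(c, d) b

/-- The convex drawing: edges cross if and only if their endpoints interleave. -/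
def flipSum {V : Type*} (t : V → V → ZMod 2) (a b c d : V) : ZMod 2 :=
  t c a + t c b + t d a + t d b

theorem sumK5_add {V : Type*} (X Y : V → V → V → V → ZMod 2) (a b c d e : V) :
    sumK5 (fun p q r s => X p q r s + Y p q r s) a b c d e = sumK5 X a b c d e + sumK5 Y a b c d e := by
  simp only [sumK5]; ring

theorem sum2K3_add {V : Type*} (X Y : V → V → V → V → ZMod 2) (a b c d e f : V) :
    sum2K3 (fun p q r s => X p q r s + Y p q r s) a b c d e f =
      sum2K3 X a b c d e f + sum2K3 Y a b c d e f := by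
  simp only [sum2K3]; ring

/-- For an edge `e` and a vertex `v` off `e`, exactly two edges at `v` are independent of `e` inside
K₅, so each `Y e v` occurs twice. In two triangles the same holds for `v` in the triangle opposite
to `e`. -/
theorem sumK5_switchSum {V : Type*} (Y : Sym2 V → V → ZMod 2) (a b c d e : V) :
    sumK5 (switchSum Y) a b c d e = 0 := by
  simp only [sumK5, switchSum]
  ring_nf
  reduce_mod_char

theorem sum2K3_switchSum {V : Type*} (Y : Sym2 V → V → ZMod 2) (a b c d e f : V) :
    sum2K3 (switchSum Y) a b c d e f = 0 := by
  simp only [sum2K3, switchSum]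
  ring_nf
  reduce_mod_char

/-- Each vertex lies on two edges of its triangle, so every term of `t` occurs four times. -/
theorem sum2K3_flipSum {V : Type*} (t : V → V → ZMod 2) (a b c d e f : V) :
    sum2K3 (flipSum t) a b c d e f = 0 := by
  simp only [sum2K3, flipSum]
  ring_nf
  reduce_mod_char

/-- Two vertices lie on different edges of six independent pairs, so reversing one arc of the
tournament changes the sum by an even number. The value is therefore that of a linear order, where
`flipSum` describes the convex drawing of K₅ with its five crossings. -/
theorem sumK5_flipSum {V : Type*} {t : V → V → ZMod 2} (ht : ∀ u v, u ≠ v → t u v + t v u = 1)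
    {a b c d e : V} (hab : a ≠ b) (hac : a ≠ c) (had : a ≠ d) (hae : a ≠ e) (hbc : b ≠ c)
    (hbd : b ≠ d) (hbe : b ≠ e) (hcd : c ≠ d) (hce : c ≠ e) (hde : d ≠ e) :
    sumK5 (flipSum t) a b c d e = 1 := by
  have key : ∀ {u v}, u ≠ v → t v u = 1 - t u v := fun h => by rw [← ht _ _ h]; ring
  simp only [sumK5, flipSum]
  rw [key hab, key hac, key had, key hae, key hbc, key hbd, key hbe, key hcd, key hce, key hde]
  ring_nf
  reduce_mod_char

/-! ### Solving for the switches from the K₅ and 2K₃ conditions -/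

section Coboundary

variable {V : Type*} {X : V → V → V → V → ZMod 2}

/-- A base vertex `o` is cleared first: switches read off from the edges at `o` reduce `X` to a
vector `Z` supported off `o`. The 2K₃ condition makes each `Z a b · ·` a coboundary, and the K₅
condition makes its potentials symmetric, so that `Z` is a sum of values `S` on vertex pairs. Such a
sum is again a combination of switches. -/
theorem exists_switchSum_eq_of_sums (hV : Finite V)
    (hs1 : ∀ a b c d, X a b c d = X b a c d)
    (hs2 : ∀ a b c d, X a b c d = X c d a b) (hs3 : ∀ a b c d, X a b c d = X a b d c)
    (hd1 : ∀ a b c, X a b c c = 0) (hd2 : ∀ a b c, X a b a c = 0)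
    (hK5 : ∀ a b c d e, a ≠ b → a ≠ c → a ≠ d → a ≠ e → b ≠ c → b ≠ d → b ≠ e → c ≠ d → c ≠ e →
      d ≠ e → sumK5 X a b c d e = 0)
    (h2K3 : ∀ a b c d e f, a ≠ b → a ≠ c → b ≠ c → d ≠ e → d ≠ f → e ≠ f → a ≠ d → a ≠ e → a ≠ f →
      b ≠ d → b ≠ e → b ≠ f → c ≠ d → c ≠ e → c ≠ f → sum2K3 X a b c d e f = 0) :
    ∃ Y : Sym2 V → V → ZMod 2, ∀ a b c d, a ≠ b → a ≠ c → a ≠ d → b ≠ c → b ≠ d → c ≠ d →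
      X a b c d = switchSum Y a b c d := by
  classical
  -- With fewer than four vertices there are no independent pairs.
  by_cases hfour : ∃ o p q r : V, o ≠ p ∧ o ≠ q ∧ o ≠ r ∧ p ≠ q ∧ p ≠ r ∧ q ≠ r
  swap
  · exact ⟨0, fun a b c d h1 h2 h3 h4 h5 h6 => (hfour ⟨a, b, c, d, h1, h2, h3, h4, h5, h6⟩).elim⟩
  obtain ⟨o, p, q, r, hop, hoq, hor, hpq, hpr, hqr⟩ := hfour
  -- This is `X` plus the switches with coefficients `X o v b c` for the edge `bc` and the vertex
  -- `v` (`Y₁` below); it vanishes on pairs with an edge at `o`.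
  set Z : V → V → V → V → ZMod 2 := fun a b c d =>
    X a b c d + X o c a b + X o d a b + X o a c d + X o b c d with hZ
  have z1 : ∀ a b c d, Z a b c d = Z b a c d := fun a b c d => by
    simp only [hZ]; rw [hs1 a b, hs3 o c a b, hs3 o d a b]; ring
  have z2 : ∀ a b c d, Z a b c d = Z c d a b := fun a b c d => by
    simp only [hZ]; rw [hs2 a b c d]; ring
  have z3 : ∀ a b c d, Z a b c d = Z a b d c := fun a b c d => by
    rw [z2, z1, z2]
  have zd : ∀ a b c, Z a b c c = 0 := fun a b c => by
    simp only [hZ]; rw [hd1, hd1, hd1]; ring_nf; reduce_mod_char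
  -- On `o, a, b, c, d` the K₅ condition shrinks to the three perfect matchings of `a, b, c, d`. The
  -- condition on the triangles `oab` and `cde` becomes the cocycle relation for `Z a b · ·`.
  have zK5 : ∀ a b c d, o ≠ a → o ≠ b → o ≠ c → o ≠ d → a ≠ b → a ≠ c → a ≠ d → b ≠ c → b ≠ d →
      c ≠ d → Z a b c d + Z a c b d + Z a d b c = 0 := by
    intro a b c d h1 h2 h3 h4 h5 h6 h7 h8 h9 h10
    have := hK5 o a b c d h1 h2 h3 h4 h5 h6 h7 h8 h9 h10
    rw [← this]
    simp only [hZ, sumK5]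
    rw [hs2 a b c d, hs2 a c b d, hs2 a d b c, hs2 c d a b, hs2 b d a c, hs2 b c a d]
    ring
  have zK3 : ∀ a b c d e, o ≠ a → o ≠ b → o ≠ c → o ≠ d → o ≠ e → a ≠ b → a ≠ c → a ≠ d → a ≠ e →
      b ≠ c → b ≠ d → b ≠ e → c ≠ d → c ≠ e → d ≠ e → Z a b c d + Z a b c e = Z a b d e := by
    intro a b c d e h1 h2 h3 h4 h5 h6 h7 h8 h9 h10 h11 h12 h13 h14 h15
    have := h2K3 o a b c d e h1 h2 h6 h13 h14 h15 h3 h4 h5 h7 h8 h9 h10 h11 h12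
    simp only [sum2K3] at this
    simp only [hZ]
    grind
  have zK3' : ∀ a b c d e, o ≠ a → o ≠ b → o ≠ c → o ≠ d → o ≠ e → a ≠ b → a ≠ c → a ≠ d → a ≠ e →
      b ≠ c → b ≠ d → b ≠ e → d ≠ e → Z a b c d + Z a b c e = Z a b d e := by
    intro a b c d e h1 h2 h3 h4 h5 h6 h7 h8 h9 h10 h11 h12 h13
    by_cases hcd : c = d
    · subst hcd; rw [zd, zero_add]
    by_cases hce : c = e
    · subst hce; rw [zd, add_zero, z3]
    exact zK3 a b c d e h1 h2 h3 h4 h5 h6 h7 h8 h9 h10 h11 h12 hcd hce h13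
  -- The goal is `Z a b c d = S a c + S a d + S b c + S b d`. Normalizing `S p · = 0` forces `S b ·`
  -- to be a potential of `Z p b · ·`. Its free constant is fixed by `S q r = 0` for `b = q` and by
  -- the symmetry `S b q = S q b` otherwise.
  set S : V → V → ZMod 2 := fun b c =>
    if b = p ∨ c = p then 0 else if b = q then Z p q r c else if c = q then Z p q r b
      else Z p q r b + Z p b q c with hS
  have Ssymm : ∀ b c, o ≠ b → o ≠ c → b ≠ c → S b c = S c b := by
    intro b c hb hc hbc
    simp only [hS]
    by_cases h1 : b = p
    · simp [h1]
    by_cases h2 : c = p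
    · simp [h2]
    by_cases h3 : b = q
    · have : c ≠ q := fun h => hbc (h3.trans h.symm)
      simp [h2, h3, this]
    by_cases h4 : c = q
    · simp [h1, h3, h4]
    simp only [h1, h2, h3, h4, or_self, if_false]
    have e1 := zK3' p q r b c hop hoq hor hb hc hpq hpr (Ne.symm h1) (Ne.symm h2) hqr (Ne.symm h3)
      (Ne.symm h4) hbc
    have e2 := zK5 p q b c hop hoq hb hc hpq (Ne.symm h1) (Ne.symm h2) (Ne.symm h3) (Ne.symm h4) hbc
    grind
  have Sp : ∀ b, S p b = 0 := fun b => by simp [hS]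
  have caseP : ∀ b c d, o ≠ b → o ≠ c → o ≠ d → p ≠ b → p ≠ c → p ≠ d → b ≠ c → b ≠ d → c ≠ d →
      Z p b c d = S b c + S b d := by
    intro b c d hb hc hd pb pc pd bc bd cd
    simp only [hS]
    by_cases h3 : b = q
    · subst h3
      simp only [pb.symm, pc.symm, pd.symm, or_self, if_false, if_true]
      exact (zK3' p b r c d hop hb hor hc hd pb hpr pc pd hqr bc bd cd).symm
    by_cases h4 : c = q
    · subst h4
      simp only [pb.symm, pc.symm, pd.symm, h3, cd.symm, or_self, if_false, if_true]
      grind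
    by_cases h5 : d = q
    · subst h5
      simp only [pb.symm, pc.symm, pd.symm, h3, cd, or_self, if_false, if_true]
      grind
    simp only [pb.symm, pc.symm, pd.symm, h3, h4, h5, or_self, if_false]
    have := zK3 p b q c d hop hb hoq hc hd pb hpq pc pd h3 bc bd (Ne.symm h4) (Ne.symm h5) cd
    grind
  have caseGen : ∀ a b c d, o ≠ a → o ≠ b → o ≠ c → o ≠ d → a ≠ b → a ≠ c → a ≠ d → b ≠ c → b ≠ d →
      c ≠ d → Z a b c d = S a c + S a d + S b c + S b d := by
    intro a b c d ha hb hc hd ab ac ad bc bd cd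
    by_cases h1 : p = a
    · subst h1; rw [caseP b c d hb hc hd ab ac ad bc bd cd, Sp, Sp]; ring
    by_cases h2 : p = b
    · subst h2
      rw [z1, caseP a c d ha hc hd h1 bc bd ac ad cd, Sp, Sp]; ring
    by_cases h3 : p = c
    · subst h3
      rw [z2, caseP d a b hd ha hb cd h1 h2 ad.symm bd.symm ab, Ssymm a p ha hc ac,
        Ssymm b p hb hc bc, Sp, Sp, Ssymm d a hd ha ad.symm, Ssymm d b hd hb bd.symm]; ring
    by_cases h4 : p = d
    · subst h4
      rw [z2, z1, caseP c a b hc ha hb h3 h1 h2 ac.symm bc.symm ab, Ssymm a p ha hd ad,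
        Ssymm b p hb hd bd, Sp, Sp, Ssymm c a hc ha ac.symm, Ssymm c b hc hb bc.symm]; ring
    -- The cocycle relation routes `c, d` through `p`, which reduces a general pair to two pairs
    -- with an edge at `p`.
    rw [← zK3 a b p c d ha hb hop hc hd ab (Ne.symm h1) ac ad (Ne.symm h2) bc bd h3 h4 cd,
      z2, z2 a b p d, caseP c a b hc ha hb h3 h1 h2 ac.symm bc.symm ab,
      caseP d a b hd ha hb h4 h1 h2 ad.symm bd.symm ab, Ssymm c a hc ha ac.symm,
      Ssymm c b hc hb bc.symm, Ssymm d a hd ha ad.symm, Ssymm d b hd hb bd.symm]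
    ring
  obtain ⟨n, ⟨rank⟩⟩ := Finite.exists_equiv_fin V
  -- Splitting the symmetric `S a b` as `z a b + z b a` uses an arbitrary linear order, since
  -- halving is impossible modulo two.
  set z : V → V → ZMod 2 := fun a b => if rank a < rank b then S a b else 0 with hz
  have zS : ∀ a b, o ≠ a → o ≠ b → a ≠ b → z a b + z b a = S a b := by
    intro a b ha hb hab
    simp only [hz]
    rcases lt_trichotomy (rank a) (rank b) with h | h | h
    · simp [h, h.not_gt]
    · exact absurd (rank.injective h) hab
    · simp [h, h.not_gt, Ssymm a b ha hb hab]
  set Y₁ : Sym2 V → V → ZMod 2 := fun e v =>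
    Sym2.lift ⟨fun b c => X o v b c, fun b c => hs3 o v b c⟩ e with hY₁
  -- On pairs avoiding `o` these switches produce the four terms of `S`. The values at edges through
  -- `o` are chosen so that the total on pairs with an edge at `o` is zero and the effect of `Y₁`
  -- there is not disturbed.
  set Y₂ : Sym2 V → V → ZMod 2 := fun e v =>
    Sym2.lift ⟨fun b c => if v = o then 0 else if b = o then z c v else if c = o then z b v
      else z v b + z v c, fun b c => by
        by_cases hv : v = o
        · simp [hv]
        by_cases hb : b = o <;> by_cases hc : c = o <;> simp [hv, hb, hc, add_comm]⟩ e with hY₂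
  have caseO : ∀ a b c, o ≠ a → o ≠ b → o ≠ c → a ≠ b → a ≠ c → b ≠ c →
      X o a b c = switchSum (Y₁ + Y₂) o a b c := by
    intro a b c ha hb hc hab hac hbc
    simp only [switchSum, hY₁, hY₂, Pi.add_apply, Sym2.lift_mk, ha.symm, hb.symm, hc.symm, if_true,
      if_false]
    rw [hd2, hd2, hs2 o o, hd1]
    grind
  have caseN : ∀ a b c d, o ≠ a → o ≠ b → o ≠ c → o ≠ d → a ≠ b → a ≠ c → a ≠ d → b ≠ c → b ≠ d →
      c ≠ d → X a b c d = switchSum (Y₁ + Y₂) a b c d := by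
    intro a b c d ha hb hc hd ab ac ad bc bd cd
    have e := caseGen a b c d ha hb hc hd ab ac ad bc bd cd
    simp only [switchSum, hY₁, hY₂, Pi.add_apply, Sym2.lift_mk, ha.symm, hb.symm, hc.symm, hd.symm,
      if_false]
    rw [← zS a c ha hc ac, ← zS a d ha hd ad, ← zS b c hb hc bc, ← zS b d hb hd bd] at e
    simp only [hZ] at e
    grind
  have w1 : ∀ a b c d, switchSum (Y₁ + Y₂) a b c d = switchSum (Y₁ + Y₂) b a c d := by
    intro a b c d
    simp only [switchSum]
    rw [Sym2.eq_swap (a := a) (b := b)]; ring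
  have w2 : ∀ a b c d, switchSum (Y₁ + Y₂) a b c d = switchSum (Y₁ + Y₂) c d a b := by
    intro a b c d
    simp only [switchSum]; ring
  refine ⟨Y₁ + Y₂, fun a b c d ab ac ad bc bd cd => ?_⟩
  by_cases h1 : o = a
  · subst h1; exact caseO b c d ab ac ad bc bd cd
  by_cases h2 : o = b
  · subst h2; rw [hs1, w1]; exact caseO a c d h1 bc bd ac ad cd
  by_cases h3 : o = c
  · subst h3; rw [hs2, w2]; exact caseO d a b cd h1 h2 ad.symm bd.symm ab
  by_cases h4 : o = d
  · subst h4; rw [hs2, hs1, w2, w1]; exact caseO c a b h3 h1 h2 ac.symm bc.symm ab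
  exact caseN a b c d h1 h2 h3 h4 ab ac ad bc bd cd

end Coboundary

/-! ### Copies of a graph in an AT-graph -/

theorem mem_indepPairs_iff {V : Type*} {G : SimpleGraph V} {a b c d : V} :
    s(s(a, b), s(c, d)) ∈ indepPairs G ↔
      G.Adj a b ∧ G.Adj c d ∧ a ≠ c ∧ a ≠ d ∧ b ≠ c ∧ b ≠ d := by
  have ind : ∀ {a b c d : V}, IndependentEdges s(a, b) s(c, d) ↔ a ≠ c ∧ a ≠ d ∧ b ≠ c ∧ b ≠ d := by
    intro a b c d
    simp only [IndependentEdges, Sym2.mem_iff]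
    constructor
    · intro h
      exact ⟨fun e => h a (by simp [e]), fun e => h a (by simp [e]), fun e => h b (by simp [e]),
        fun e => h b (by simp [e])⟩
    · rintro ⟨h1, h2, h3, h4⟩ v ⟨rfl | rfl, rfl | rfl⟩ <;> contradiction
  constructor
  · rintro ⟨e, f, he, hf, h, heq⟩
    rcases Sym2.eq_iff.1 heq with ⟨rfl, rfl⟩ | ⟨rfl, rfl⟩
    · exact ⟨he, hf, ind.1 h⟩
    · exact ⟨hf, he, by obtain ⟨h1, h2, h3, h4⟩ := ind.1 h; exact ⟨h1.symm, h3.symm, h2.symm, h4.symm⟩⟩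
  · rintro ⟨h1, h2, h3⟩
    exact ⟨s(a, b), s(c, d), h1, h2, ind.2 h3, rfl⟩

namespace ATGraph

variable {V W : Type*}

/-- The pairs of independent edges of `K` that a copy of `K` in `A` sends to pairs of `A`. -/
def copyPairs {K : SimpleGraph W} (A : ATGraph V) (j : W → V) : Set (Sym2 (Sym2 W)) :=
  {p | p ∈ indepPairs K ∧ p.map (Sym2.map j) ∈ A.pairs}

theorem map_mem_indepPairs {K : SimpleGraph W} {G : SimpleGraph V} (j : SimpleGraph.Copy K G)
    {p : Sym2 (Sym2 W)} (hp : p ∈ indepPairs K) : p.map (Sym2.map j) ∈ indepPairs G := by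
  induction p with | _ e f =>
  induction e with | _ a b =>
  induction f with | _ c d =>
  simp only [Sym2.map_mk]
  rw [mem_indepPairs_iff] at hp ⊢
  obtain ⟨h1, h2, h3, h4, h5, h6⟩ := hp
  exact ⟨j.toHom.map_adj h1, j.toHom.map_adj h2, j.injective.ne h3, j.injective.ne h4,
    j.injective.ne h5, j.injective.ne h6⟩

theorem ncard_pairs_of_iso {K : SimpleGraph W} (B : ATGraph V) (ι : B.graph ≃g K) :
    B.pairs.ncard = (B.copyPairs (K := K) ι.symm).ncard := by
  have hinj : Function.Injective (Sym2.map (Sym2.map ι.symm)) :=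
    Sym2.map.injective (Sym2.map.injective ι.symm.injective)
  rw [← Set.ncard_image_of_injective _ hinj]
  congr 1
  ext p
  constructor
  · intro hp
    have e : (p.map (Sym2.map ι)).map (Sym2.map ι.symm) = p := by
      induction p with | _ e f =>
      induction e with | _ a b =>
      induction f with | _ c d =>
      simp
    exact ⟨p.map (Sym2.map ι), ⟨map_mem_indepPairs ι.toCopy (B.pairs_subset hp), e.symm ▸ hp⟩, e⟩
  · rintro ⟨q, ⟨-, hq⟩, rfl⟩
    exact hq

theorem ncard_sub_pairs {K : SimpleGraph W} (A : ATGraph V) (H : A.graph.Subgraph)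
    (ι : H.coe ≃g K) :
    (A.sub H).pairs.ncard = (A.copyPairs (K := K) fun w => (ι.symm w : V)).ncard := by
  rw [ncard_pairs_of_iso (A.sub H) ι]
  congr 1
  ext p
  refine and_congr_right fun hp => ?_
  have e : (p.map (Sym2.map ι.symm)).map (Sym2.map Subtype.val) =
      p.map (Sym2.map fun w => (ι.symm w : V)) := by
    induction p with | _ e f =>
    induction e with | _ a b =>
    induction f with | _ c d =>
    rfl
  rw [← e]
  exact ⟨fun h => h.2, fun h => ⟨map_mem_indepPairs ι.symm.toCopy hp, h⟩⟩

/-- Subgraphs isomorphic to `K` are the images of the copies of `K`, so parities can be computed on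
explicit vertex tuples. -/
theorem exists_sub_iff {K : SimpleGraph W} (A : ATGraph V) (P : ℕ → Prop) :
    (∃ H : A.graph.Subgraph, Nonempty (H.coe ≃g K) ∧ P (A.sub H).pairs.ncard) ↔
      ∃ j : SimpleGraph.Copy K A.graph, P (A.copyPairs (K := K) j).ncard := by
  constructor
  · rintro ⟨H, ⟨ι⟩, h⟩
    rw [ncard_sub_pairs A H ι] at h
    exact ⟨H.coeCopy.comp ι.symm.toCopy, h⟩
  · rintro ⟨j, h⟩
    refine ⟨j.toSubgraph, ⟨j.isoToSubgraph.symm⟩, ?_⟩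
    rw [ncard_sub_pairs A j.toSubgraph j.isoToSubgraph.symm]
    exact h

theorem not_containsOdd_iff {K : SimpleGraph W} (A : ATGraph V) :
    ¬ A.ContainsOdd K ↔ ∀ j : SimpleGraph.Copy K A.graph,
      ((A.copyPairs (K := K) j).ncard : ZMod 2) = 0 := by
  rw [ContainsOdd, A.exists_sub_iff Odd, not_exists]
  simp only [ZMod.natCast_eq_zero_iff_even, Nat.not_odd_iff_even]

theorem not_containsEven_iff {K : SimpleGraph W} (A : ATGraph V) :
    ¬ A.ContainsEven K ↔ ∀ j : SimpleGraph.Copy K A.graph,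
      ((A.copyPairs (K := K) j).ncard : ZMod 2) = 1 := by
  rw [ContainsEven, A.exists_sub_iff Even, not_exists]
  simp only [ZMod.natCast_eq_one_iff_odd, Nat.not_even_iff_odd]

open Classical in
/-- The characteristic function of the pairs of `A`. -/
noncomputable def pairVal (A : ATGraph V) (a b c d : V) : ZMod 2 :=
  if s(s(a, b), s(c, d)) ∈ A.pairs then 1 else 0

theorem pairVal_swap_left (A : ATGraph V) (a b c d : V) : A.pairVal a b c d = A.pairVal b a c d := by
  rw [pairVal, pairVal, Sym2.eq_swap (a := a) (b := b)]

theorem pairVal_swap (A : ATGraph V) (a b c d : V) : A.pairVal a b c d = A.pairVal c d a b := by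
  rw [pairVal, pairVal, Sym2.eq_swap (a := s(a, b))]

theorem pairVal_swap_right (A : ATGraph V) (a b c d : V) :
    A.pairVal a b c d = A.pairVal a b d c := by
  rw [pairVal_swap, pairVal_swap_left, pairVal_swap]

theorem pairVal_diag (A : ATGraph V) (a b c : V) : A.pairVal a b c c = 0 := by
  rw [pairVal, if_neg]
  intro h
  exact A.graph.irrefl (mem_indepPairs_iff.1 (A.pairs_subset h)).2.1

theorem pairVal_adjacent (A : ATGraph V) (a b c : V) : A.pairVal a b a c = 0 := by
  rw [pairVal, if_neg]
  intro h
  exact (mem_indepPairs_iff.1 (A.pairs_subset h)).2.2.1 rfl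

/-- The hypotheses say that `L` lists every independent pair of `K` exactly once; for the two fixed
small graphs this is a finite check. -/
theorem ncard_copyPairs {K : SimpleGraph W} (A : ATGraph V) (j : W → V)
    (L : List (W × W × W × W)) (hnd : (L.map fun q => s(s(q.1, q.2.1), s(q.2.2.1, q.2.2.2))).Nodup)
    (hL : ∀ a b c d, s(s(a, b), s(c, d)) ∈ L.map (fun q => s(s(q.1, q.2.1), s(q.2.2.1, q.2.2.2))) ↔
      K.Adj a b ∧ K.Adj c d ∧ a ≠ c ∧ a ≠ d ∧ b ≠ c ∧ b ≠ d) :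
    ((A.copyPairs (K := K) j).ncard : ZMod 2) =
      (L.map fun q => A.pairVal (j q.1) (j q.2.1) (j q.2.2.1) (j q.2.2.2)).sum := by
  classical
  set M := L.map fun q => s(s(q.1, q.2.1), s(q.2.2.1, q.2.2.2)) with hM
  have hset : A.copyPairs (K := K) j =
      ↑(M.toFinset.filter fun p => p.map (Sym2.map j) ∈ A.pairs) := by
    ext p
    induction p with | _ e f =>
    induction e with | _ a b =>
    induction f with | _ c d =>
    simp only [copyPairs, Set.mem_ofPred_eq, mem_indepPairs_iff, Finset.coe_filter, List.mem_toFinset,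
      hL]
  rw [hset, Set.ncard_coe_finset, Finset.card_filter]
  push_cast
  rw [List.sum_toFinset _ hnd, hM, List.map_map]
  rfl

end ATGraph

theorem ncard_copyPairs_K5 {V : Type*} (A : ATGraph V) (j : Fin 5 → V) :
    ((A.copyPairs (K := graphK5) j).ncard : ZMod 2) =
      sumK5 A.pairVal (j 0) (j 1) (j 2) (j 3) (j 4) := by
  rw [A.ncard_copyPairs j
    [(0, 1, 2, 3), (0, 2, 1, 3), (0, 3, 1, 2), (0, 1, 2, 4), (0, 2, 1, 4), (0, 4, 1, 2),
      (0, 1, 3, 4), (0, 3, 1, 4), (0, 4, 1, 3), (0, 2, 3, 4), (0, 3, 2, 4), (0, 4, 2, 3),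
      (1, 2, 3, 4), (1, 3, 2, 4), (1, 4, 2, 3)] (by decide) (by decide)]
  simp only [List.map_cons, List.map_nil, List.sum_cons, List.sum_nil, sumK5]
  ring

theorem ncard_copyPairs_2K3 {V : Type*} (A : ATGraph V) (j : Fin 3 ⊕ Fin 3 → V) :
    ((A.copyPairs (K := graph2K3) j).ncard : ZMod 2) =
      sum2K3 A.pairVal (j (.inl 0)) (j (.inl 1)) (j (.inl 2)) (j (.inr 0)) (j (.inr 1))
        (j (.inr 2)) := by
  rw [A.ncard_copyPairs j
    [(.inl 0, .inl 1, .inr 0, .inr 1), (.inl 0, .inl 1, .inr 0, .inr 2),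
      (.inl 0, .inl 1, .inr 1, .inr 2), (.inl 0, .inl 2, .inr 0, .inr 1),
      (.inl 0, .inl 2, .inr 0, .inr 2), (.inl 0, .inl 2, .inr 1, .inr 2),
      (.inl 1, .inl 2, .inr 0, .inr 1), (.inl 1, .inl 2, .inr 0, .inr 2),
      (.inl 1, .inl 2, .inr 1, .inr 2)] (by decide) (by
        let _ : DecidableRel graph2K3.Adj := fun a b => match a, b with
          | .inl a, .inl b => inferInstanceAs (Decidable (a ≠ b))
          | .inr a, .inr b => inferInstanceAs (Decidable (a ≠ b))
          | .inl _, .inr _ => .isFalse (by simp)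
          | .inr _, .inl _ => .isFalse (by simp)
        decide)]
  simp only [List.map_cons, List.map_nil, List.sum_cons, List.sum_nil, sum2K3]
  ring

/-! ### Parity conditions of realizable AT-graphs -/

namespace ATGraph

variable {V : Type*}

/-- Completeness is not required, so this applies to AT-subgraphs such as 2K₃, as part (b) needs. -/
theorem IndepZ2Realizable.exists_pairVal_eq {A : ATGraph V} (h : A.IndepZ2Realizable) :
    ∃ (t : V → V → ZMod 2) (y : Sym2 V → V → ZMod 2), (∀ u v, u ≠ v → t u v + t v u = 1) ∧
      ∀ a b c d, s(s(a, b), s(c, d)) ∈ indepPairs A.graph →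
        A.pairVal a b c d = flipSum t a b c d + switchSum y a b c d := by
  obtain ⟨D, hD⟩ := h
  obtain ⟨t, y, ht, h⟩ := D.exists_parity
  refine ⟨t, y, ht, fun a b c d hp => ?_⟩
  have hp' := mem_indepPairs_iff.1 hp
  have hind : IndependentEdges s(a, b) s(c, d) := by
    rintro v ⟨h1, h2⟩
    obtain ⟨-, -, h3, h4, h5, h6⟩ := hp'
    rcases Sym2.mem_iff.1 h1 with rfl | rfl <;> rcases Sym2.mem_iff.1 h2 with rfl | rfl <;>
      contradiction
  have h1 := h ⟨s(a, b), hp'.1⟩ ⟨s(c, d), hp'.2.1⟩ a b c d rfl rfl hind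
  have h2 := hD ⟨s(a, b), hp'.1⟩ ⟨s(c, d), hp'.2.1⟩ hind
  have h3 : flipSum t a b c d + switchSum y a b c d =
      ((D.crossings ⟨s(a, b), hp'.1⟩ ⟨s(c, d), hp'.2.1⟩).ncard : ZMod 2) := h1.symm
  rw [h3, pairVal]
  split_ifs with hm
  · exact (ZMod.natCast_eq_one_iff_odd.2 (h2.1 hm)).symm
  · exact (ZMod.natCast_eq_zero_iff_even.2 (Nat.not_odd_iff_even.1 fun ho => hm (h2.2 ho))).symm

theorem sumK5_pairVal_congr {A : ATGraph V} {g : V → V → V → V → ZMod 2}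
    (h : ∀ a b c d, s(s(a, b), s(c, d)) ∈ indepPairs A.graph → A.pairVal a b c d = g a b c d)
    (j : SimpleGraph.Copy graphK5 A.graph) :
    ((A.copyPairs (K := graphK5) j).ncard : ZMod 2) = sumK5 g (j 0) (j 1) (j 2) (j 3) (j 4) := by
  have hj : ∀ a b c d : Fin 5, a ≠ b ∧ c ≠ d ∧ a ≠ c ∧ a ≠ d ∧ b ≠ c ∧ b ≠ d →
      A.pairVal (j a) (j b) (j c) (j d) = g (j a) (j b) (j c) (j d) :=
    fun a b c d hd => h _ _ _ _ (map_mem_indepPairs j (mem_indepPairs_iff.2 hd))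
  rw [ncard_copyPairs_K5]
  unfold sumK5
  rw [hj 0 1 2 3 (by decide), hj 0 2 1 3 (by decide), hj 0 3 1 2 (by decide),
    hj 0 1 2 4 (by decide), hj 0 2 1 4 (by decide), hj 0 4 1 2 (by decide),
    hj 0 1 3 4 (by decide), hj 0 3 1 4 (by decide), hj 0 4 1 3 (by decide),
    hj 0 2 3 4 (by decide), hj 0 3 2 4 (by decide), hj 0 4 2 3 (by decide),
    hj 1 2 3 4 (by decide), hj 1 3 2 4 (by decide), hj 1 4 2 3 (by decide)]

theorem sum2K3_pairVal_congr {A : ATGraph V} {g : V → V → V → V → ZMod 2}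
    (h : ∀ a b c d, s(s(a, b), s(c, d)) ∈ indepPairs A.graph → A.pairVal a b c d = g a b c d)
    (j : SimpleGraph.Copy graph2K3 A.graph) :
    ((A.copyPairs (K := graph2K3) j).ncard : ZMod 2) =
      sum2K3 g (j (.inl 0)) (j (.inl 1)) (j (.inl 2)) (j (.inr 0)) (j (.inr 1)) (j (.inr 2)) := by
  have hj : ∀ a b c d : Fin 3, a ≠ b ∧ c ≠ d →
      A.pairVal (j (.inl a)) (j (.inl b)) (j (.inr c)) (j (.inr d)) =
        g (j (.inl a)) (j (.inl b)) (j (.inr c)) (j (.inr d)) :=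
    fun a b c d hd => h _ _ _ _ (map_mem_indepPairs j (mem_indepPairs_iff.2 (by simpa using hd)))
  rw [ncard_copyPairs_2K3]
  unfold sum2K3
  rw [hj 0 1 0 1 (by decide), hj 0 1 0 2 (by decide), hj 0 1 1 2 (by decide),
    hj 0 2 0 1 (by decide), hj 0 2 0 2 (by decide), hj 0 2 1 2 (by decide),
    hj 1 2 0 1 (by decide), hj 1 2 0 2 (by decide), hj 1 2 1 2 (by decide)]

theorem IndepZ2Realizable.odd_copyPairs_K5 {A : ATGraph V} (h : A.IndepZ2Realizable)
    (j : SimpleGraph.Copy graphK5 A.graph) : Odd (A.copyPairs (K := graphK5) j).ncard := by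
  obtain ⟨t, y, ht, h⟩ := h.exists_pairVal_eq
  have hne : ∀ a b : Fin 5, a ≠ b → j a ≠ j b := fun a b hab => j.injective.ne hab
  rw [← ZMod.natCast_eq_one_iff_odd, sumK5_pairVal_congr h, sumK5_add, sumK5_switchSum, add_zero]
  exact sumK5_flipSum ht (hne _ _ (by decide)) (hne _ _ (by decide)) (hne _ _ (by decide))
    (hne _ _ (by decide)) (hne _ _ (by decide)) (hne _ _ (by decide)) (hne _ _ (by decide))
    (hne _ _ (by decide)) (hne _ _ (by decide)) (hne _ _ (by decide))

theorem IndepZ2Realizable.even_copyPairs_2K3 {A : ATGraph V} (h : A.IndepZ2Realizable)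
    (j : SimpleGraph.Copy graph2K3 A.graph) : Even (A.copyPairs (K := graph2K3) j).ncard := by
  obtain ⟨t, y, -, h⟩ := h.exists_pairVal_eq
  rw [← ZMod.natCast_eq_zero_iff_even, sum2K3_pairVal_congr h, sum2K3_add, sum2K3_switchSum,
    sum2K3_flipSum, add_zero]

theorem not_realizable_sub_of_iso_K5 (A : ATGraph V) {H : A.graph.Subgraph} (ι : H.coe ≃g graphK5)
    (h : Even (A.sub H).pairs.ncard) : ¬ (A.sub H).IndepZ2Realizable := fun hr => by
  rw [ncard_pairs_of_iso (A.sub H) ι] at h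
  exact Nat.not_odd_iff_even.2 h (hr.odd_copyPairs_K5 ι.symm.toCopy)

theorem not_realizable_sub_of_iso_2K3 (A : ATGraph V) {H : A.graph.Subgraph}
    (ι : H.coe ≃g graph2K3) (h : Odd (A.sub H).pairs.ncard) :
    ¬ (A.sub H).IndepZ2Realizable := fun hr => by
  rw [ncard_pairs_of_iso (A.sub H) ι] at h
  exact Nat.not_odd_iff_even.2 (hr.even_copyPairs_2K3 ι.symm.toCopy) h

/-- Completeness enters here: any five distinct vertices carry a copy of K₅. -/
theorem sumK5_pairVal_of_copies {A : ATGraph V} (hA : A.graph = ⊤) {a b c d e : V} {s : ZMod 2}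
    (h : ∀ j : SimpleGraph.Copy graphK5 A.graph,
      ((A.copyPairs (K := graphK5) j).ncard : ZMod 2) = s)
    (hab : a ≠ b) (hac : a ≠ c) (had : a ≠ d) (hae : a ≠ e) (hbc : b ≠ c) (hbd : b ≠ d)
    (hbe : b ≠ e) (hcd : c ≠ d) (hce : c ≠ e) (hde : d ≠ e) : sumK5 A.pairVal a b c d e = s := by
  have hinj : Function.Injective ![a, b, c, d, e] := by
    intro i k
    fin_cases i <;> fin_cases k <;> simp [*, Ne.symm, eq_comm]
  have := h ⟨⟨![a, b, c, d, e], fun {u v} huv => by rw [hA]; exact hinj.ne huv⟩, hinj⟩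
  rw [ncard_copyPairs_K5] at this
  exact this

theorem sum2K3_pairVal_of_copies {A : ATGraph V} (hA : A.graph = ⊤) {a b c d e f : V}
    (h : ∀ j : SimpleGraph.Copy graph2K3 A.graph,
      ((A.copyPairs (K := graph2K3) j).ncard : ZMod 2) = 0)
    (hab : a ≠ b) (hac : a ≠ c) (hbc : b ≠ c) (hde : d ≠ e) (hdf : d ≠ f) (hef : e ≠ f)
    (had : a ≠ d) (hae : a ≠ e) (haf : a ≠ f) (hbd : b ≠ d) (hbe : b ≠ e) (hbf : b ≠ f)
    (hcd : c ≠ d) (hce : c ≠ e) (hcf : c ≠ f) : sum2K3 A.pairVal a b c d e f = 0 := by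
  have hinj : Function.Injective (Sum.elim ![a, b, c] ![d, e, f]) := by
    rintro (i | i) (k | k) <;> fin_cases i <;> fin_cases k <;> simp [*, Ne.symm, eq_comm]
  have := h ⟨⟨Sum.elim ![a, b, c] ![d, e, f], fun {u v} huv => by
    rw [hA]; exact hinj.ne huv.ne⟩, hinj⟩
  rw [ncard_copyPairs_2K3] at this
  exact this

end ATGraph

/-! ### The space of edge-vertex switches -/

theorem pairVal_ofVector {V : Type*} {G : SimpleGraph V} (x : indepPairs G → ZMod 2) {a b c d : V}
    (h : s(s(a, b), s(c, d)) ∈ indepPairs G) :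
    (ATGraph.ofVector x).pairVal a b c d = x ⟨_, h⟩ := by
  have hm : s(s(a, b), s(c, d)) ∈ (ATGraph.ofVector x).pairs ↔ x ⟨_, h⟩ = 1 :=
    ⟨fun ⟨_, h'⟩ => h', fun h' => ⟨h, h'⟩⟩
  rw [ATGraph.pairVal]
  split_ifs with h1
  · exact (hm.1 h1).symm
  · have key : ∀ z : ZMod 2, z ≠ 1 → 0 = z := by decide
    exact key _ fun h2 => h1 (hm.2 h2)

theorem exists_mem_pair_eq_iff {V : Type*} {e : Sym2 V} {v a b c d : V} :
    (∃ f : Sym2 V, v ∈ f ∧ s(s(a, b), s(c, d)) = s(e, f)) ↔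
      (e = s(a, b) ∧ v = c ∨ e = s(a, b) ∧ v = d ∨ e = s(c, d) ∧ v = a ∨ e = s(c, d) ∧ v = b) := by
  constructor
  · rintro ⟨f, hf, heq⟩
    rcases Sym2.eq_iff.1 heq with ⟨rfl, rfl⟩ | ⟨rfl, rfl⟩
    · rcases Sym2.mem_iff.1 hf with rfl | rfl <;> simp
    · rcases Sym2.mem_iff.1 hf with rfl | rfl <;> simp
  · rintro (⟨rfl, rfl⟩ | ⟨rfl, rfl⟩ | ⟨rfl, rfl⟩ | ⟨rfl, rfl⟩)
    · exact ⟨s(v, d), by simp, rfl⟩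
    · exact ⟨s(c, v), by simp, rfl⟩
    · exact ⟨s(v, b), by simp, Sym2.eq_swap⟩
    · exact ⟨s(a, v), by simp, Sym2.eq_swap⟩

/-- `Y e v` is the coefficient of the switch `(e, v)`. Only four switches have a nonzero component
at the pair `ab`, `cd`, and these give the four terms of `switchSum`. -/
theorem mem_switchSpace_iff {V : Type*} [Finite V] {G : SimpleGraph V}
    {x : indepPairs G → ZMod 2} :
    x ∈ switchSpace G ↔ ∃ Y : Sym2 V → V → ZMod 2,
      ∀ (a b c d : V) (h : s(s(a, b), s(c, d)) ∈ indepPairs G),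
        x ⟨_, h⟩ = switchSum Y a b c d := by
  classical
  have := Fintype.ofFinite V
  constructor
  · intro hx
    induction hx using Submodule.span_induction with
    | mem w hw =>
      obtain ⟨e, he, v, hv, rfl⟩ := hw
      refine ⟨fun e' u => if e = e' ∧ v = u then 1 else 0, fun a b c d h => ?_⟩
      simp only [switchVector, exists_mem_pair_eq_iff, switchSum]
      obtain ⟨hab, hcd, hac, had, hbc, hbd⟩ := mem_indepPairs_iff.1 h
      by_cases h1 : e = s(a, b)
      · subst h1
        have h2 : s(a, b) ≠ s(c, d) := fun h => by
          rcases Sym2.eq_iff.1 h with ⟨h1, _⟩ | ⟨h1, _⟩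
          exacts [hac h1, had h1]
        by_cases h3 : v = c
        · subst h3; simp [h2, hcd.ne]
        · simp [h2, h3]
      · by_cases h2 : e = s(c, d)
        · subst h2
          by_cases h3 : v = a
          · subst h3; simp [h1, hab.ne]
          · simp [h1, h3]
        · simp [h1, h2]
    | zero => exact ⟨0, fun a b c d h => by simp [switchSum]⟩
    | add x y _ _ hx hy =>
      obtain ⟨Y, hY⟩ := hx
      obtain ⟨Z, hZ⟩ := hy
      refine ⟨Y + Z, fun a b c d h => ?_⟩
      simp only [Pi.add_apply, hY, hZ, switchSum]
      ring
    | smul r x _ hx =>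
      obtain ⟨Y, hY⟩ := hx
      refine ⟨r • Y, fun a b c d h => ?_⟩
      simp only [Pi.smul_apply, hY, switchSum, smul_eq_mul]
      ring
  · rintro ⟨Y, hY⟩
    have hx : x = ∑ z : Sym2 V × V, if z.1 ∈ G.edgeSet ∧ z.2 ∉ z.1 then
        Y z.1 z.2 • switchVector G z.1 z.2 else 0 := by
      funext p
      obtain ⟨p, hp⟩ := p
      induction p with | _ e f =>
      induction e with | _ a b =>
      induction f with | _ c d =>
      obtain ⟨hab, hcd, hac, had, hbc, hbd⟩ := mem_indepPairs_iff.1 hp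
      rw [hY, Finset.sum_apply, ← Finset.sum_subset (Finset.subset_univ
        {(s(a, b), c), (s(a, b), d), (s(c, d), a), (s(c, d), b)})]
      · have h2 : s(a, b) ≠ s(c, d) := fun h => by
          rcases Sym2.eq_iff.1 h with ⟨h1, _⟩ | ⟨h1, _⟩
          exacts [hac h1, had h1]
        rw [Finset.sum_insert (by simp [h2, hcd.ne]), Finset.sum_insert (by simp [h2]),
          Finset.sum_insert (by simp [hab.ne]), Finset.sum_singleton]
        have e1 : c ∉ s(a, b) := by simp [hac.symm, hbc.symm]
        have e2 : d ∉ s(a, b) := by simp [had.symm, hbd.symm]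
        have e3 : a ∉ s(c, d) := by simp [hac, had]
        have e4 : b ∉ s(c, d) := by simp [hbc, hbd]
        have m1 : s(a, b) ∈ G.edgeSet := hab
        have m2 : s(c, d) ∈ G.edgeSet := hcd
        simp only [e1, e2, e3, e4, m1, m2, not_false_iff, and_self, if_true, Pi.smul_apply,
          switchVector, exists_mem_pair_eq_iff, switchSum]
        simp only [true_or, or_true, if_true, smul_eq_mul, mul_one]
        ring
      · rintro ⟨e, v⟩ - hne
        split_ifs with hc
        · simp only [Pi.smul_apply, switchVector, exists_mem_pair_eq_iff]
          rw [if_neg, smul_zero]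
          simpa [Prod.ext_iff] using hne
        · rfl
    rw [hx]
    refine Submodule.sum_mem _ fun z _ => ?_
    split_ifs with hz
    · exact Submodule.smul_mem _ _ (Submodule.subset_span ⟨z.1, hz.1, z.2, hz.2, rfl⟩)
    · exact Submodule.zero_mem _

theorem ATGraph.exists_pairVal_eq_switchSum {V : Type*} [Finite V]
    {A : ATGraph V} (hA : A.graph = ⊤)
    (hK5 : ∀ j : SimpleGraph.Copy graphK5 A.graph,
      ((A.copyPairs (K := graphK5) j).ncard : ZMod 2) = 0)
    (h2K3 : ∀ j : SimpleGraph.Copy graph2K3 A.graph,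
      ((A.copyPairs (K := graph2K3) j).ncard : ZMod 2) = 0) :
    ∃ Y : Sym2 V → V → ZMod 2, ∀ a b c d, a ≠ b → a ≠ c → a ≠ d → b ≠ c → b ≠ d → c ≠ d →
      A.pairVal a b c d = switchSum Y a b c d :=
  exists_switchSum_eq_of_sums ‹_› A.pairVal_swap_left A.pairVal_swap A.pairVal_swap_right
    A.pairVal_diag A.pairVal_adjacent
    (fun _ _ _ _ _ => sumK5_pairVal_of_copies hA hK5)
    (fun _ _ _ _ _ _ => sum2K3_pairVal_of_copies hA h2K3)

theorem switchSpace_eq_propertyVectors {V : Type*} [Finite V] :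
    (switchSpace (⊤ : SimpleGraph V) : Set (indepPairs (⊤ : SimpleGraph V) → ZMod 2)) =
      propertyVectors (⊤ : SimpleGraph V) := by
  ext x
  have hprop : x ∈ propertyVectors (⊤ : SimpleGraph V) ↔
      (∀ j : SimpleGraph.Copy graphK5 (ATGraph.ofVector x).graph,
        (((ATGraph.ofVector x).copyPairs (K := graphK5) j).ncard : ZMod 2) = 0) ∧
      ∀ j : SimpleGraph.Copy graph2K3 (ATGraph.ofVector x).graph,
        (((ATGraph.ofVector x).copyPairs (K := graph2K3) j).ncard : ZMod 2) = 0 := by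
    rw [← ATGraph.not_containsOdd_iff, ← ATGraph.not_containsOdd_iff]
    rfl
  rw [hprop, SetLike.mem_coe, mem_switchSpace_iff]
  constructor
  · rintro ⟨Y, hY⟩
    have hv : ∀ a b c d, s(s(a, b), s(c, d)) ∈ indepPairs (ATGraph.ofVector x).graph →
        (ATGraph.ofVector x).pairVal a b c d = switchSum Y a b c d := fun a b c d h =>
      (pairVal_ofVector x h).trans (hY a b c d h)
    exact ⟨fun j => by rw [ATGraph.sumK5_pairVal_congr hv, sumK5_switchSum],
      fun j => by rw [ATGraph.sum2K3_pairVal_congr hv, sum2K3_switchSum]⟩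
  · rintro ⟨h1, h2⟩
    obtain ⟨Y, hY⟩ := ATGraph.exists_pairVal_eq_switchSum rfl h1 h2
    refine ⟨Y, fun a b c d h => ?_⟩
    obtain ⟨hab, hcd, hac, had, hbc, hbd⟩ := mem_indepPairs_iff.1 h
    rw [← pairVal_ofVector x h, hY a b c d hab.ne hac had hbc hbd hcd.ne]

section PolynomialCurves

open Polynomial

/-! ### Polynomial curves -/

/-- Interchanging the two real coordinates of the chart interchanges the axes. -/
theorem IsProperCrossing.symm {a b : Set ℂ} {p : ℂ} (h : IsProperCrossing a b p) :
    IsProperCrossing b a p := by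
  obtain ⟨φ, hp, h0, hφ⟩ := h
  let sw : ℂ ≃ₜ ℂ := Complex.equivRealProdCLM.toHomeomorph.trans
    ((Homeomorph.prodComm ℝ ℝ).trans Complex.equivRealProdCLM.symm.toHomeomorph)
  have hsw : ∀ z : ℂ, sw z = ⟨z.im, z.re⟩ := fun z => by
    apply Complex.ext <;> simp [sw, Complex.equivRealProdCLM_symm_apply]
  refine ⟨φ.transHomeomorph sw, hp, ?_, fun z hz => ?_⟩
  · simp [hsw, h0]; rfl
  · have := hφ z hz
    simp only [OpenPartialHomeomorph.transHomeomorph_apply, Function.comp_apply, hsw]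
    exact ⟨this.2, this.1⟩

/-- The curve `x = X h`, `y = h + q x`, parametrized by its height `h` over the graph of `q`. -/
noncomputable def polyCurve (q X : ℝ[X]) (h : ℝ) : ℂ := ⟨X.eval h, h + q.eval (X.eval h)⟩

/-- The height of a point over the graph of `q`. -/
noncomputable def polyHeight (q : ℝ[X]) (z : ℂ) : ℝ := z.im - q.eval z.re

/-- The horizontal distance of a point from the curve `polyCurve q X`. -/
noncomputable def polyDefect (q X : ℝ[X]) (z : ℂ) : ℝ := z.re - X.eval (polyHeight q z)

/-- The part of `polyCurve q X` between the heights `0` and `1`. -/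
def polyArc (q X : ℝ[X]) : Set ℂ := polyCurve q X '' Set.Icc 0 1

theorem polyHeight_polyCurve (q X : ℝ[X]) (h : ℝ) : polyHeight q (polyCurve q X h) = h := by
  simp [polyHeight, polyCurve]

theorem polyDefect_polyCurve (q X : ℝ[X]) (h : ℝ) : polyDefect q X (polyCurve q X h) = 0 := by
  rw [polyDefect, polyHeight_polyCurve]; simp [polyCurve]

theorem polyCurve_polyHeight {q X : ℝ[X]} {z : ℂ} (hz : polyDefect q X z = 0) :
    polyCurve q X (polyHeight q z) = z := by
  have h1 : X.eval (polyHeight q z) = z.re := by rw [polyDefect] at hz; linarith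
  apply Complex.ext
  · exact h1
  · simp only [polyCurve, h1]; simp [polyHeight]

theorem mem_polyArc {q X : ℝ[X]} {z : ℂ} :
    z ∈ polyArc q X ↔ polyHeight q z ∈ Set.Icc 0 1 ∧ polyDefect q X z = 0 := by
  constructor
  · rintro ⟨h, hh, rfl⟩
    exact ⟨by rwa [polyHeight_polyCurve], polyDefect_polyCurve q X h⟩
  · rintro ⟨h1, h2⟩
    exact ⟨_, h1, polyCurve_polyHeight h2⟩

theorem polyCurve_injective (q X : ℝ[X]) : Function.Injective (polyCurve q X) :=
  Function.LeftInverse.injective (polyHeight_polyCurve q X)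

theorem polyCurve_eq (q X : ℝ[X]) : polyCurve q X = fun h =>
    Complex.equivRealProdCLM.symm (X.eval h, h + q.eval (X.eval h)) := by
  funext h
  apply Complex.ext <;> simp [polyCurve, Complex.equivRealProdCLM_symm_apply]

theorem continuous_polyCurve (q X : ℝ[X]) : Continuous (polyCurve q X) := by
  rw [polyCurve_eq]
  fun_prop

theorem continuous_polyHeight (q : ℝ[X]) : Continuous (polyHeight q) := by
  unfold polyHeight
  fun_prop

/-- Coordinates of the plane in which `polyCurve q X` is the first axis. -/
noncomputable def polyCoord (q X : ℝ[X]) : ℂ ≃ₜ ℝ × ℝ where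
  toFun z := (polyHeight q z, polyDefect q X z)
  invFun p := Complex.equivRealProdCLM.symm
    (p.2 + X.eval p.1, p.1 + q.eval (p.2 + X.eval p.1))
  left_inv z := by
    apply Complex.ext <;> simp [polyDefect, polyHeight, Complex.equivRealProdCLM_symm_apply]
  right_inv p := by
    apply Prod.ext <;> simp [polyDefect, polyHeight, Complex.equivRealProdCLM_symm_apply]
  continuous_toFun := by unfold polyDefect polyHeight; fun_prop
  continuous_invFun := by fun_prop

/-- Curves that meet transversally cross properly. -/
theorem isProperCrossing_polyArc {q X q' X' : ℝ[X]} {z : ℂ} {α : ℝ}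
    (h1 : polyHeight q z ∈ Set.Ioo 0 1) (h2 : polyDefect q X z = 0)
    (h3 : polyHeight q' z ∈ Set.Ioo 0 1) (h4 : polyDefect q' X' z = 0)
    (hd : HasDerivAt (fun h => polyDefect q' X' (polyCurve q X h)) α (polyHeight q z))
    (hα : α ≠ 0) : IsProperCrossing (polyArc q X) (polyArc q' X') z := by
  set κ := polyCoord q X with hκ
  have hκz : κ z = (polyHeight q z, 0) := by rw [← h2]; rfl
  set M : ℝ × ℝ → ℝ := fun p => polyDefect q' X' (κ.symm p) with hM
  have hMc : ContDiff ℝ 1 M := by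
    have e : M = fun p : ℝ × ℝ => (p.2 + X.eval p.1) - X'.eval
        ((p.1 + q.eval (p.2 + X.eval p.1)) - q'.eval (p.2 + X.eval p.1)) := by
      funext p
      simp [hM, hκ, polyCoord, polyDefect, polyHeight, Complex.equivRealProdCLM_symm_apply]
    rw [e]
    have ev : ∀ (r : ℝ[X]) {f : ℝ × ℝ → ℝ}, ContDiff ℝ 1 f → ContDiff ℝ 1 fun p => r.eval (f p) :=
      fun r f hf => by
        have hr : ContDiff ℝ 1 (fun x : ℝ => r.eval x) := by
          simpa using r.contDiff_aeval (𝕜 := ℝ) 1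
        exact hr.comp hf
    have hx : ContDiff ℝ 1 fun p : ℝ × ℝ => p.2 + X.eval p.1 :=
      contDiff_snd.add (ev X contDiff_fst)
    exact hx.sub (ev X' ((contDiff_fst.add (ev q hx)).sub (ev q' hx)))
  have hMs : HasStrictFDerivAt M (fderiv ℝ M (κ z)) (κ z) :=
    hMc.contDiffAt.hasStrictFDerivAt one_ne_zero
  have hα' : fderiv ℝ M (κ z) (1, 0) = α := by
    have hc : ∀ h, κ.symm (h, 0) = polyCurve q X h := fun h => by
      rw [Homeomorph.symm_apply_eq]
      exact Prod.ext (polyHeight_polyCurve q X h).symm (polyDefect_polyCurve q X h).symm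
    have hl : HasDerivAt (fun h : ℝ => ((h, 0) : ℝ × ℝ)) (1, 0) (polyHeight q z) :=
      (hasDerivAt_id _).prodMk (hasDerivAt_const _ _)
    have := (hκz ▸ hMs.hasFDerivAt).comp_hasDerivAt (polyHeight q z) hl
    rw [hκz]
    have e : (M ∘ fun h : ℝ => ((h, 0) : ℝ × ℝ)) =
        fun h => polyDefect q' X' (polyCurve q X h) := by
      funext h
      simp [hM, hc]
    rw [e] at this
    exact this.unique hd
  -- Keeping the second coordinate and replacing the first by the defect of the other curve is a
  -- local diffeomorphism, because the derivative of that defect along the first curve is `α ≠ 0`.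
  -- In the resulting chart both curves are axes.
  set Θ : ℝ × ℝ → ℝ × ℝ := fun p => (M p, p.2) with hΘ
  set Θ' : ℝ × ℝ →L[ℝ] ℝ × ℝ := (fderiv ℝ M (κ z)).prod (ContinuousLinearMap.snd ℝ ℝ ℝ) with hΘ'
  have hinj : Function.Injective (Θ' : ℝ × ℝ →ₗ[ℝ] ℝ × ℝ) := by
    rw [← LinearMap.ker_eq_bot, LinearMap.ker_eq_bot']
    rintro ⟨u, v⟩ huv
    have e1 : fderiv ℝ M (κ z) (u, v) = 0 := congrArg Prod.fst huv
    have e2 : v = 0 := congrArg Prod.snd huv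
    subst e2
    have e3 : ((u, 0) : ℝ × ℝ) = u • (1, 0) := by simp
    rw [e3, map_smul, hα', smul_eq_mul] at e1
    rw [(mul_eq_zero.1 e1).resolve_right hα]
    rfl
  set L : (ℝ × ℝ) ≃L[ℝ] ℝ × ℝ :=
    (LinearEquiv.ofInjectiveEndo (Θ' : ℝ × ℝ →ₗ[ℝ] ℝ × ℝ) hinj).toContinuousLinearEquiv with hL
  have hΘs : HasStrictFDerivAt Θ (L : ℝ × ℝ →L[ℝ] ℝ × ℝ) (κ z) := by
    have : (L : ℝ × ℝ →L[ℝ] ℝ × ℝ) = Θ' := by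
      ext <;> simp [hL]
    rw [this]
    exact hMs.prodMk hasStrictFDerivAt_snd
  -- Here both heights are inside `(0, 1)`, so each arc coincides with the zero set of its defect.
  let U : Set ℂ := polyHeight q ⁻¹' Set.Ioo 0 1 ∩ polyHeight q' ⁻¹' Set.Ioo 0 1
  have hU : IsOpen U := (isOpen_Ioo.preimage (continuous_polyHeight q)).inter
    (isOpen_Ioo.preimage (continuous_polyHeight q'))
  let ψ : OpenPartialHomeomorph ℂ ℂ := (κ.toOpenPartialHomeomorph.trans
    (hΘs.toOpenPartialHomeomorph Θ)).transHomeomorph Complex.equivRealProdCLM.symm.toHomeomorph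
  have hψ : ∀ w, ψ w = ⟨polyDefect q' X' w, polyDefect q X w⟩ := by
    intro w
    have : ψ w = Complex.equivRealProdCLM.symm (M (κ w), (κ w).2) := rfl
    rw [this, hM]
    simp only [Homeomorph.symm_apply_apply]
    apply Complex.ext <;> simp [Complex.equivRealProdCLM_symm_apply, hκ, polyCoord]
  have hzs : z ∈ ψ.source := by
    have : z ∈ (κ.toOpenPartialHomeomorph.trans (hΘs.toOpenPartialHomeomorph Θ)).source := by
      rw [OpenPartialHomeomorph.trans_source]
      exact ⟨trivial, hΘs.mem_toOpenPartialHomeomorph_source⟩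
    exact this
  refine ⟨ψ.restrOpen U hU, ?_, ?_, ?_⟩
  · rw [OpenPartialHomeomorph.restrOpen_source]
    exact ⟨hzs, h1, h3⟩
  · have : ψ.restrOpen U hU z = ψ z := rfl
    rw [this, hψ, h2, h4]; rfl
  · intro w hw
    rw [OpenPartialHomeomorph.restrOpen_source] at hw
    have : ψ.restrOpen U hU w = ψ w := rfl
    rw [this, hψ, mem_polyArc, mem_polyArc]
    exact ⟨⟨fun h => h.2, fun h => ⟨⟨hw.2.1.1.le, hw.2.1.2.le⟩, h⟩⟩,
      ⟨fun h => h.2, fun h => ⟨⟨hw.2.2.1.le, hw.2.2.2.le⟩, h⟩⟩⟩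

/-- The member with parameter `c` of a pencil of curves with common endpoints. -/
noncomputable def pencil (P : ℝ[X]) (c : ℝ) : ℝ[X] := P + C c * (X * (X - 1))

theorem eval_pencil (P : ℝ[X]) (c h : ℝ) : (pencil P c).eval h = P.eval h + c * (h * (h - 1)) := by
  simp [pencil]

theorem polyDefect_pencil (q P : ℝ[X]) (c : ℝ) (z : ℂ) : polyDefect q (pencil P c) z =
    polyDefect q P z - c * (polyHeight q z * (polyHeight q z - 1)) := by
  rw [polyDefect, polyDefect, eval_pencil]; ring

theorem polyCurve_pencil_zero (q P : ℝ[X]) (c : ℝ) :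
    polyCurve q (pencil P c) 0 = polyCurve q P 0 := by
  simp [polyCurve, eval_pencil]

theorem polyCurve_pencil_one (q P : ℝ[X]) (c : ℝ) :
    polyCurve q (pencil P c) 1 = polyCurve q P 1 := by
  simp [polyCurve, eval_pencil]

theorem polyHeight_mem_Ioo {q P : ℝ[X]} {z : ℂ} (hz : z ∈ polyArc q P) (h0 : z ≠ polyCurve q P 0)
    (h1 : z ≠ polyCurve q P 1) : polyHeight q z ∈ Set.Ioo 0 1 := by
  obtain ⟨h, hh, rfl⟩ := hz
  rw [polyHeight_polyCurve]
  exact ⟨lt_of_le_of_ne hh.1 fun e => h0 (by rw [e]), lt_of_le_of_ne hh.2 fun e => h1 (by rw [e])⟩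

open MeasureTheory in
/-- A given point lies on almost no curve of a pencil. -/
theorem ae_not_mem_pencil (q P : ℝ[X]) {z : ℂ} (h0 : z ≠ polyCurve q P 0) (h1 : z ≠ polyCurve q P 1) :
    ∀ᵐ c : ℝ, z ∉ polyArc q (pencil P c) := by
  set k := polyHeight q z with hk
  -- The defect is affine in `c` with slope nonzero away from the endpoints, so at most one
  -- parameter is bad.
  have : {c : ℝ | z ∈ polyArc q (pencil P c)} ⊆ {polyDefect q P z / (k * (k - 1))} := by
    intro c hc
    have hc : z ∈ polyArc q (pencil P c) := hc
    have hI := polyHeight_mem_Ioo hc (by rwa [polyCurve_pencil_zero])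
      (by rwa [polyCurve_pencil_one])
    have hd := (mem_polyArc.1 hc).2
    rw [polyDefect_pencil, ← hk] at hd
    have : k * (k - 1) ≠ 0 := mul_ne_zero hI.1.ne' (by linarith [hI.2])
    rw [Set.mem_singleton_iff, eq_div_iff this]
    linarith
  rw [ae_iff]
  simp only [not_not]
  exact measure_mono_null this (by simp)

open MeasureTheory in
/-- Almost all values of a differentiable real function are regular. -/
theorem ae_regular_value {f f' : ℝ → ℝ} {U : Set ℝ} (hf : ∀ x ∈ U, HasDerivAt f (f' x) x) :
    ∀ᵐ c : ℝ, ∀ x ∈ U, f x = c → f' x ≠ 0 := by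
  have hz : volume (f '' {x | x ∈ U ∧ f' x = 0}) = 0 := by
    refine addHaar_image_eq_zero_of_det_fderivWithin_eq_zero volume
      (f' := fun x => ContinuousLinearMap.toSpanSingleton ℝ (f' x))
      (fun x hx => (hf x hx.1).hasFDerivAt.hasFDerivWithinAt) (fun x hx => ?_)
    rw [hx.2]
    simp [ContinuousLinearMap.det]
  rw [ae_iff]
  refine measure_mono_null (fun c hc => ?_) hz
  simp only [Set.mem_ofPred_eq, not_forall, not_not] at hc
  obtain ⟨x, hx, rfl, h0⟩ := hc
  exact ⟨x, ⟨hx, h0⟩, rfl⟩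

open MeasureTheory in
/-- Almost all curves of a pencil meet a given curve in finitely many proper crossings. -/
theorem ae_pencil_crossing (q Q q' P : ℝ[X]) :
    ∀ᵐ c : ℝ, (polyArc q Q ∩ polyArc q' (pencil P c)).Finite ∧
      ∀ z ∈ polyArc q Q ∩ polyArc q' (pencil P c), z ≠ polyCurve q Q 0 → z ≠ polyCurve q Q 1 →
        z ≠ polyCurve q' P 0 → z ≠ polyCurve q' P 1 →
        IsProperCrossing (polyArc q Q) (polyArc q' (pencil P c)) z := by
  -- `K` is the height over `q'` along the first curve, and `A - c B` is the defect there of the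
  -- pencil member `c`. A regular value `c` of `A / B` is one for which all zeros of `A - c B` with
  -- `B ≠ 0` are simple.
  set K : ℝ[X] := X + q.comp Q - q'.comp Q with hK
  set A : ℝ[X] := Q - P.comp K with hA
  set B : ℝ[X] := K * (K - 1) with hB
  have hKe : ∀ h, polyHeight q' (polyCurve q Q h) = K.eval h := fun h => by
    simp [hK, polyHeight, polyCurve]
  have hdef : ∀ c h, polyDefect q' (pencil P c) (polyCurve q Q h) = (A - C c * B).eval h := by
    intro c h
    rw [polyDefect_pencil, polyDefect, hKe]
    simp [hA, hB, polyCurve]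
  have hreg := ae_regular_value (f := fun h => A.eval h / B.eval h) (U := {h | B.eval h ≠ 0})
    (fun h hh => (A.hasDerivAt h).div (B.hasDerivAt h) hh)
  filter_upwards [hreg] with c hc
  have hder : ∀ h, B.eval h ≠ 0 → (A - C c * B).eval h = 0 →
      (derivative (A - C c * B)).eval h ≠ 0 := by
    intro h hBh h0 h'
    simp only [eval_sub, eval_mul, eval_C] at h0
    refine hc h hBh (by rw [div_eq_iff hBh]; linarith) ?_
    simp only [derivative_sub, derivative_C_mul, eval_sub, eval_mul, eval_C] at h'
    rw [div_eq_zero_iff]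
    left
    have e1 : A.eval h = c * B.eval h := by linarith
    have e2 : (derivative A).eval h = c * (derivative B).eval h := by linarith
    rw [e1, e2]; ring
  -- If `A - c B` vanished identically, simplicity of zeros would force `B = 0`, hence `K` and then
  -- `Q` would be constant; but for constant `Q` the polynomial `K` is `X` plus a constant.
  have hne : A - C c * B ≠ 0 := by
    intro h0
    have hB0 : B = 0 := by
      refine Polynomial.funext fun h => ?_
      by_contra hBh
      rw [eval_zero] at hBh
      exact hder h hBh (by rw [h0, eval_zero]) (by rw [h0, derivative_zero, eval_zero])
    have hA0 : A = 0 := by rw [hB0, mul_zero, sub_zero] at h0; exact h0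
    obtain ⟨κ, hκ⟩ : ∃ κ, K = C κ := by
      rcases mul_eq_zero.1 (hB ▸ hB0) with h | h
      · exact ⟨0, by rw [h, C_0]⟩
      · exact ⟨1, by rw [C_1]; exact sub_eq_zero.1 h⟩
    have hQ : Q = C (P.eval κ) := by
      have := sub_eq_zero.1 (hA ▸ hA0)
      rw [this, hκ, comp_C]
    rw [hQ, comp_C, comp_C] at hK
    have e0 := congrArg (eval 0) (hK.symm.trans hκ)
    have e1 := congrArg (eval 1) (hK.symm.trans hκ)
    simp at e0 e1
    linarith
  constructor
  · refine ((A - C c * B).roots.toFinset.finite_toSet.image (polyCurve q Q)).subset ?_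
    rintro z ⟨⟨h, hh, rfl⟩, hz⟩
    refine ⟨h, ?_, rfl⟩
    have := (mem_polyArc.1 hz).2
    rw [hdef] at this
    simpa [hne] using this
  · rintro z ⟨hz, hz'⟩ n1 n2 n3 n4
    have i1 := polyHeight_mem_Ioo hz n1 n2
    have i2 := polyHeight_mem_Ioo hz' (by rwa [polyCurve_pencil_zero]) (by rwa [polyCurve_pencil_one])
    have d1 := (mem_polyArc.1 hz).2
    have d2 := (mem_polyArc.1 hz').2
    have hzc := polyCurve_polyHeight d1
    refine isProperCrossing_polyArc i1 d1 i2 d2 (α := (derivative (A - C c * B)).eval (polyHeight q z))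
      ?_ (hder _ ?_ ?_)
    · simp only [hdef]
      exact (A - C c * B).hasDerivAt _
    · have := hKe (polyHeight q z)
      rw [hzc] at this
      rw [this] at i2
      simp only [hB, eval_mul, eval_sub, eval_one]
      exact mul_ne_zero i2.1.ne' (by linarith [i2.2])
    · rw [← hdef, hzc, d2]

/-! ### Turns of polynomial curves around vertices -/

open Complex in
theorem log_neg_of_im_pos {w : ℂ} (h : 0 < w.im) : log (-w) = log w - Real.pi * I := by
  rw [log, log, norm_neg, arg_neg_eq_arg_sub_pi_of_im_pos h]; push_cast; ring

open Complex in
theorem log_neg_of_im_neg {w : ℂ} (h : w.im < 0) : log (-w) = log w + Real.pi * I := by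
  rw [log, log, norm_neg, arg_neg_eq_arg_add_pi_of_im_neg h]; push_cast; ring

open Complex in
/-- The change of the logarithm along a polynomial curve around a point of the real axis depends
only on the endpoints and on the side on which the curve passes the point. -/
theorem exists_logChange_polyCurve (q : ℝ[X]) (xa xb xc : ℝ) (hk : -q.eval xc ∈ Set.Ioo (0 : ℝ) 1) :
    ∃ R : ℂ, ∀ Q : ℝ[X], Q.eval 0 = xa → Q.eval 1 = xb →
      (xc < Q.eval (-q.eval xc) → logChange (fun s => polyCurve q Q s - xc) 0 1 = R) ∧
      (Q.eval (-q.eval xc) < xc →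
        logChange (fun s => polyCurve q Q s - xc) 0 1 = R - 2 * Real.pi * I) := by
  set k := -q.eval xc with hkdef
  -- The parameter `σ` undoes the shear by `q`: `σ = 1` gives the curve and `σ = 0` a graph over the
  -- height. Since the point has height `k` over `q`, no zero occurs unless the curve hits it. At `σ
  -- = 0` the path crosses the real axis only at height `k`, so either it or its negative avoids the
  -- cut of the logarithm.
  let E : ℝ → ℝ → ℝ → ℂ := fun x s σ => ⟨x - xc, s - k + σ * (q.eval x + k)⟩
  refine ⟨log (E xb 1 0) - log (E xa 0 0) + logChange (E xb 1) 0 1 - logChange (E xa 0) 0 1,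
    fun Q h0 h1 => ?_⟩
  set F : ℝ → ℝ → ℂ := fun s σ => E (Q.eval s) s σ with hF
  have hE : ∀ x s σ, E x s σ = ((x - xc : ℝ) : ℂ) + ((s - k + σ * (q.eval x + k) : ℝ) : ℂ) * I :=
    fun x s σ => by apply Complex.ext <;> simp [E]
  have hFc : Continuous (Function.uncurry F) := by
    have : Function.uncurry F = fun p : ℝ × ℝ => ((Q.eval p.1 - xc : ℝ) : ℂ) +
        ((p.1 - k + p.2 * (q.eval (Q.eval p.1) + k) : ℝ) : ℂ) * I := by
      funext p; exact hE _ _ _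
    rw [this]
    fun_prop
  have hzero : ∀ s σ, F s σ = 0 → s = k ∧ Q.eval k = xc := by
    intro s σ h
    have e1 : Q.eval s - xc = 0 := congrArg re h
    have e2 : s - k + σ * (q.eval (Q.eval s) + k) = 0 := congrArg im h
    have e3 : Q.eval s = xc := by linarith
    rw [e3] at e2
    have e4 : s = k := by rw [hkdef] at e2 ⊢; linarith
    exact ⟨e4, e4 ▸ e3⟩
  have hone : ∀ s, F s 1 = polyCurve q Q s - xc := by
    intro s
    apply Complex.ext
    · simp [hF, E, polyCurve]
    · simp [hF, E, polyCurve]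
  have key : Q.eval k ≠ xc → logChange (fun s => polyCurve q Q s - xc) 0 1 =
      logChange (fun s => F s 0) 0 1 + logChange (E xb 1) 0 1 - logChange (E xa 0) 0 1 := by
    intro hne
    have := rectIndex_eq_zero (F := F) (a := 0) (b := 1) (c := 0) (d := 1) hFc.continuousOn
      (fun s _ σ _ h => hne (hzero s σ h).2)
    have f1 : F 1 = E xb 1 := by simp only [hF, h1]
    have f0 : F 0 = E xa 0 := by simp only [hF, h0]
    simp only [rectIndex, f1, f0, hone] at this
    linear_combination -this
  have hF0 : Continuous fun s => F s 0 := hFc.comp (continuous_id.prodMk continuous_const)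
  have hre : ∀ s, (F s 0).re = Q.eval s - xc := fun s => rfl
  have him : ∀ s, (F s 0).im = s - k := fun s => by simp [hF, E]
  have e1 : F 1 0 = E xb 1 0 := by simp only [hF, h1]
  have e0 : F 0 0 = E xa 0 0 := by simp only [hF, h0]
  constructor
  · intro hlt
    rw [key hlt.ne', logChange_of_slitPlane hF0.continuousOn, e1, e0]
    intro s _
    rw [mem_slitPlane_iff, hre, him]
    by_cases hs : s = k
    · left; rw [hs]; linarith
    · right; exact sub_ne_zero.2 hs
  · intro hlt
    have hslit : ∀ s ∈ Set.uIcc (0 : ℝ) 1, -F s 0 ∈ slitPlane := by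
      intro s _
      rw [mem_slitPlane_iff, neg_re, neg_im, hre, him]
      by_cases hs : s = k
      · left; rw [hs]; linarith
      · right; exact neg_ne_zero.2 (sub_ne_zero.2 hs)
    have hneg : logChange (fun s => F s 0) 0 1 = logChange (fun s => -F s 0) 0 1 :=
      (logChange_neg ⟨hF0.continuousOn, fun s _ h => hlt.ne (hzero s 0 h).2⟩).symm
    rw [key hlt.ne, hneg, logChange_of_slitPlane (F := fun s => -F s 0) hF0.neg.continuousOn hslit,
      log_neg_of_im_pos (by rw [him]; linarith [hk.2]),
      log_neg_of_im_neg (by rw [him]; linarith [hk.1]), e1, e0]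
    ring

/-- A side on which to pass each vertex such that the numbers of turns have given parities. -/
theorem exists_side {V : Type*} (x : V → ℝ) (q : ℝ[X]) (a b v : V) (y : ZMod 2)
    (hk : -q.eval (x v) ∈ Set.Ioo (0 : ℝ) 1) (vert : V → ℂ) (hvert : ∀ u, vert u = x u) :
    ∃ σ : ℝ, |σ| = 1 ∧ ∀ Q : ℝ[X], Q.eval 0 = x a → Q.eval 1 = x b →
      0 < σ * (Q.eval (-q.eval (x v)) - x v) →
      ∀ n : ℤ, HasTurns vert (polyCurve q Q) a b v n → (n : ZMod 2) = y := by
  obtain ⟨R, hR⟩ := exists_logChange_polyCurve q (x a) (x b) (x v) hk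
  set T : ℂ := Complex.log (vert b - vert v) - Complex.log (vert a - vert v) with hT
  have huniq : ∀ n m : ℤ, T + n * (2 * Real.pi * Complex.I) = T + m * (2 * Real.pi * Complex.I) →
      n = m := by
    intro n m h
    have := mul_right_cancel₀ Complex.two_pi_I_ne_zero (add_left_cancel h)
    exact_mod_cast this
  -- If passing on the right gives the wrong parity, passing on the left, one turn less, gives the
  -- right one.
  by_cases h : ∃ m : ℤ, (m : ZMod 2) = y ∧ R = T + m * (2 * Real.pi * Complex.I)
  · obtain ⟨m, hm, hRm⟩ := h
    refine ⟨1, abs_one, fun Q h0 h1 hs n hn => ?_⟩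
    rw [HasTurns, hvert v, (hR Q h0 h1).1 (by linarith), ← hvert v, ← hT, hRm] at hn
    rw [← huniq m n hn, hm]
  · refine ⟨-1, by simp, fun Q h0 h1 hs n hn => ?_⟩
    rw [HasTurns, hvert v, (hR Q h0 h1).2 (by linarith), ← hvert v, ← hT] at hn
    have hne : ((n + 1 : ℤ) : ZMod 2) ≠ y := fun hy =>
      h ⟨n + 1, hy, by push_cast; linear_combination hn⟩
    push_cast at hne
    have key : ∀ u w : ZMod 2, u + 1 ≠ w → u = w := by decide
    exact key _ _ hne

theorem exists_interpolation {V : Type*} [Finite V] {x : V → ℝ} (hx : Function.Injective x)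
    (y : V → ℝ) : ∃ P : ℝ[X], ∀ v, P.eval (x v) = y v := by
  classical
  have := Fintype.ofFinite V
  exact ⟨Lagrange.interpolate Finset.univ x y,
    fun v => Lagrange.eval_interpolate_at_node y hx.injOn (Finset.mem_univ v)⟩

/-- Heights of the vertices with `a` lowest and `b` highest. -/
theorem exists_heights {V : Type*} [Finite V] {a b : V} (hab : a ≠ b) :
    ∃ h : V → ℝ, Function.Injective h ∧ h a = 0 ∧ h b = 1 ∧
      ∀ v, v ≠ a → v ≠ b → h v ∈ Set.Ioo (0 : ℝ) 1 := by
  classical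
  obtain ⟨n, ⟨rank⟩⟩ := Finite.exists_equiv_fin V
  let g : V → ℝ := fun v => ((rank v : ℕ) + 1 : ℝ) / (n + 1)
  have hn : (0 : ℝ) < n + 1 := by positivity
  have hg : ∀ v, g v ∈ Set.Ioo (0 : ℝ) 1 := fun v => by
    have : ((rank v : ℕ) : ℝ) < n := by exact_mod_cast (rank v).2
    exact ⟨by positivity, by rw [div_lt_one hn]; linarith⟩
  have hgi : Function.Injective g := fun u v h => by
    have h1 : ((rank u : ℕ) + 1 : ℝ) = (rank v : ℕ) + 1 := by
      simpa [g, div_left_inj' hn.ne'] using h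
    have h2 : (rank u : ℕ) = rank v := by exact_mod_cast add_right_cancel h1
    exact rank.injective (Fin.ext h2)
  refine ⟨fun v => if v = a then 0 else if v = b then 1 else g v, fun u v h => ?_, by simp,
    by simp [hab.symm], fun v h1 h2 => by simpa [h1, h2] using hg v⟩
  dsimp only at h
  have gu := hg u
  have gv := hg v
  split_ifs at h with h1 h2 h3 h4 h5 h6 h7 h8
  all_goals first
    | (subst_vars; rfl)
    | exact hgi h
    | (exfalso; linarith [gu.1, gu.2, gv.1, gv.2])

/-- The data of a pencil of curves for an edge. -/
theorem exists_edge_pencil {V : Type*} [Finite V] {x : V → ℝ} (hx : Function.Injective x)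
    {vert : V → ℂ} (hvert : ∀ u, vert u = x u) {a b : V} (hab : a ≠ b) (y : V → ZMod 2) :
    ∃ q P : ℝ[X], polyCurve q P 0 = vert a ∧ polyCurve q P 1 = vert b ∧
      ∀ c : ℝ, |c| < 1 → ∀ v, v ≠ a → v ≠ b → vert v ∉ polyArc q (pencil P c) ∧
        ∀ n : ℤ, HasTurns vert (polyCurve q (pencil P c)) a b v n → (n : ZMod 2) = y v := by
  obtain ⟨h, hinj, ha, hb, hh⟩ := exists_heights hab
  -- A vertex on the real axis at `x v` has height `-q (x v) = h v`, so all vertices lie at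
  -- different levels of the curve.
  obtain ⟨q, hq⟩ := exists_interpolation hx fun v => -h v
  have hside : ∀ v, ∃ σ : ℝ, |σ| = 1 ∧ (v ≠ a → v ≠ b → ∀ Q : ℝ[X], Q.eval 0 = x a →
      Q.eval 1 = x b → 0 < σ * (Q.eval (h v) - x v) →
      ∀ n : ℤ, HasTurns vert (polyCurve q Q) a b v n → (n : ZMod 2) = y v) := by
    intro v
    by_cases hv : v ≠ a ∧ v ≠ b
    · obtain ⟨σ, h1, h2⟩ := exists_side x q a b v (y v)
        (by rw [hq, neg_neg]; exact hh v hv.1 hv.2) vert hvert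
      rw [hq, neg_neg] at h2
      exact ⟨σ, h1, fun _ _ => h2⟩
    · exact ⟨1, abs_one, fun h1 h2 => absurd ⟨h1, h2⟩ hv⟩
  choose σ hσ hside using hside
  classical
  -- The curve passes `v` at horizontal distance 1 on the required side. With `|c| < 1` the pencil
  -- shifts it by less than 1 at that height, so the side is the same for all such `c`.
  obtain ⟨P, hP⟩ := exists_interpolation hinj fun v =>
    if v = a then x a else if v = b then x b else x v + σ v
  have hPa : P.eval 0 = x a := by have := hP a; rwa [ha, if_pos rfl] at this
  have hPb : P.eval 1 = x b := by
    have := hP b; rwa [hb, if_neg hab.symm, if_pos rfl] at this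
  refine ⟨q, P, ?_, ?_, fun c hc v hva hvb => ?_⟩
  · apply Complex.ext <;> simp [polyCurve, hPa, hvert, hq, ha]
  · apply Complex.ext <;> simp [polyCurve, hPb, hvert, hq, hb]
  · have hPv : P.eval (h v) = x v + σ v := by have := hP v; rwa [if_neg hva, if_neg hvb] at this
    obtain ⟨k0, k1⟩ := hh v hva hvb
    have hpos : 0 < σ v * ((pencil P c).eval (h v) - x v) := by
      rw [eval_pencil, hPv]
      have h1 : σ v * σ v = 1 := by
        have := abs_mul_abs_self (σ v); rw [hσ] at this; linarith
      have h2 : |σ v * c * (h v * (h v - 1))| < 1 := by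
        rw [abs_mul, abs_mul, hσ, one_mul]
        have h3 : |h v * (h v - 1)| ≤ 1 := by
          rw [abs_le]; constructor <;> nlinarith
        calc |c| * |h v * (h v - 1)| ≤ |c| * 1 := mul_le_mul_of_nonneg_left h3 (abs_nonneg c)
          _ < 1 := by linarith
      have := (abs_lt.1 h2).1
      nlinarith
    refine ⟨fun hmem => ?_, hside v hva hvb (pencil P c) (by rw [eval_pencil, hPa]; ring)
      (by rw [eval_pencil, hPb]; ring) hpos⟩
    have hd := (mem_polyArc.1 hmem).2
    rw [polyDefect, polyHeight, hvert] at hd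
    simp only [Complex.ofReal_re, Complex.ofReal_im, hq, zero_sub, neg_neg] at hd
    have : (pencil P c).eval (h v) - x v = 0 := by linarith
    rw [this, mul_zero] at hpos
    exact lt_irrefl _ hpos

/-! ### Drawings by curves in general position -/

-- Curves are added one at a time. Almost every parameter of the new curve makes it meet each
-- earlier curve in finitely many points, properly away from endpoints, and miss the finitely many
-- points where earlier curves meet, except its own endpoints. A set of full measure is dense, hence
-- meets `(-1, 1)`.
open MeasureTheory in
theorem exists_general_position {ι : Type*} (q P : ι → ℝ[X]) (s : Finset ι) :
    ∃ c : ι → ℝ, (∀ i, |c i| < 1) ∧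
      (∀ i ∈ s, ∀ j ∈ s, i ≠ j →
        (polyArc (q i) (pencil (P i) (c i)) ∩ polyArc (q j) (pencil (P j) (c j))).Finite ∧
        ∀ z ∈ polyArc (q i) (pencil (P i) (c i)) ∩ polyArc (q j) (pencil (P j) (c j)),
          z ≠ polyCurve (q i) (P i) 0 → z ≠ polyCurve (q i) (P i) 1 →
          z ≠ polyCurve (q j) (P j) 0 → z ≠ polyCurve (q j) (P j) 1 →
          IsProperCrossing (polyArc (q i) (pencil (P i) (c i)))
            (polyArc (q j) (pencil (P j) (c j))) z) ∧
      ∀ i ∈ s, ∀ j ∈ s, ∀ k ∈ s, i ≠ j → i ≠ k → j ≠ k → ∀ z,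
        z ∈ polyArc (q i) (pencil (P i) (c i)) → z ∈ polyArc (q j) (pencil (P j) (c j)) →
        z ∈ polyArc (q k) (pencil (P k) (c k)) →
        ∃ l ∈ s, z = polyCurve (q l) (P l) 0 ∨ z = polyCurve (q l) (P l) 1 := by
  classical
  induction s using Finset.induction_on with
  | empty => exact ⟨0, by simp, by simp, by simp⟩
  | insert f s hf ih =>
    obtain ⟨c, hc, hpair, htriple⟩ := ih
    have ev1 : ∀ᵐ t : ℝ, ∀ i ∈ s,
        (polyArc (q i) (pencil (P i) (c i)) ∩ polyArc (q f) (pencil (P f) t)).Finite ∧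
        ∀ z ∈ polyArc (q i) (pencil (P i) (c i)) ∩ polyArc (q f) (pencil (P f) t),
          z ≠ polyCurve (q i) (P i) 0 → z ≠ polyCurve (q i) (P i) 1 →
          z ≠ polyCurve (q f) (P f) 0 → z ≠ polyCurve (q f) (P f) 1 →
          IsProperCrossing (polyArc (q i) (pencil (P i) (c i)))
            (polyArc (q f) (pencil (P f) t)) z := by
      rw [Filter.eventually_all_finset]
      intro i _
      have := ae_pencil_crossing (q i) (pencil (P i) (c i)) (q f) (P f)
      simpa only [polyCurve_pencil_zero, polyCurve_pencil_one] using this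
    have ev2 : ∀ᵐ t : ℝ, ∀ i ∈ s, ∀ j ∈ s, i ≠ j →
        ∀ z ∈ polyArc (q i) (pencil (P i) (c i)) ∩ polyArc (q j) (pencil (P j) (c j)),
          z ≠ polyCurve (q f) (P f) 0 → z ≠ polyCurve (q f) (P f) 1 →
          z ∉ polyArc (q f) (pencil (P f) t) := by
      rw [Filter.eventually_all_finset]
      intro i hi
      rw [Filter.eventually_all_finset]
      intro j hj
      by_cases hij : i = j
      · exact Filter.Eventually.of_forall fun t h => absurd hij h
      have hfin := (hpair i hi j hj hij).1
      have := (Set.Finite.eventually_all hfin (l := ae (volume : Measure ℝ))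
        (p := fun z t => z ≠ polyCurve (q f) (P f) 0 → z ≠ polyCurve (q f) (P f) 1 →
          z ∉ polyArc (q f) (pencil (P f) t))).2 (by
            intro z _
            by_cases h : z ≠ polyCurve (q f) (P f) 0 ∧ z ≠ polyCurve (q f) (P f) 1
            · filter_upwards [ae_not_mem_pencil (q f) (P f) h.1 h.2] with t ht _ _ using ht
            · exact Filter.Eventually.of_forall fun t h1 h2 => absurd ⟨h1, h2⟩ h)
      filter_upwards [this] with t ht _ using ht
    obtain ⟨t, ⟨ht1, ht2⟩, ht⟩ := (Measure.dense_of_ae (ev1.and ev2)).exists_mem_open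
      (isOpen_Ioo (a := (-1 : ℝ)) (b := 1)) ⟨0, by norm_num⟩
    have hcf : Function.update c f t f = t := Function.update_self f t c
    have hcs : ∀ i ∈ s, Function.update c f t i = c i := fun i hi =>
      Function.update_of_ne (ne_of_mem_of_not_mem hi hf) t c
    refine ⟨Function.update c f t, fun i => ?_, ?_, ?_⟩
    · by_cases h : i = f
      · rw [h, hcf]; exact abs_lt.2 ht
      · rw [Function.update_of_ne h]; exact hc i
    · intro i hi j hj hij
      rcases Finset.mem_insert.1 hi with rfl | hi' <;> rcases Finset.mem_insert.1 hj with rfl | hj'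
      · exact absurd rfl hij
      · rw [hcf, hcs j hj']
        obtain ⟨h1, h2⟩ := ht1 j hj'
        exact ⟨by rwa [Set.inter_comm], fun z hz n1 n2 n3 n4 =>
          (h2 z hz.symm n3 n4 n1 n2).symm⟩
      · rw [hcf, hcs i hi']
        exact ht1 i hi'
      · rw [hcs i hi', hcs j hj']
        exact hpair i hi' j hj' hij
    · have one : ∀ i ∈ s, ∀ j ∈ s, i ≠ j → ∀ z, z ∈ polyArc (q i) (pencil (P i) (c i)) →
          z ∈ polyArc (q j) (pencil (P j) (c j)) → z ∈ polyArc (q f) (pencil (P f) t) →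
          ∃ l ∈ insert f s, z = polyCurve (q l) (P l) 0 ∨ z = polyCurve (q l) (P l) 1 := by
        intro i hi j hj hij z h1 h2 h3
        by_contra hcon
        push Not at hcon
        obtain ⟨n1, n2⟩ := hcon f (Finset.mem_insert_self f s)
        exact ht2 i hi j hj hij z ⟨h1, h2⟩ n1 n2 h3
      intro i hi j hj k hk hij hik hjk z h1 h2 h3
      rcases Finset.mem_insert.1 hi with rfl | hi'
      · have hj' := (Finset.mem_insert.1 hj).resolve_left hij.symm
        have hk' := (Finset.mem_insert.1 hk).resolve_left hik.symm
        rw [hcf] at h1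
        rw [hcs j hj'] at h2
        rw [hcs k hk'] at h3
        exact one j hj' k hk' hjk z h2 h3 h1
      rw [hcs i hi'] at h1
      rcases Finset.mem_insert.1 hj with rfl | hj'
      · have hk' := (Finset.mem_insert.1 hk).resolve_left hjk.symm
        rw [hcf] at h2
        rw [hcs k hk'] at h3
        exact one i hi' k hk' hik z h1 h3 h2
      rw [hcs j hj'] at h2
      rcases Finset.mem_insert.1 hk with rfl | hk'
      · rw [hcf] at h3
        exact one i hi' j hj' hij z h1 h2 h3
      rw [hcs k hk'] at h3
      obtain ⟨l, hl, h⟩ := htriple i hi' j hj' k hk' hij hik hjk z h1 h2 h3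
      exact ⟨l, Finset.mem_insert_of_mem hl, h⟩

/-- Every combination of edge-vertex switches of the convex drawing is drawn. -/
theorem exists_drawing_of_switches {V : Type*} [Finite V] (G : SimpleGraph V) :
    ∃ t : V → V → ZMod 2, (∀ u v, u ≠ v → t u v + t v u = 1) ∧
      ∀ y : Sym2 V → V → ZMod 2, ∃ D : Drawing G,
        ∀ (e e' : G.edgeSet) (a b c d : V), (e : Sym2 V) = s(a, b) → (e' : Sym2 V) = s(c, d) →
          IndependentEdges (e : Sym2 V) (e' : Sym2 V) →
          ((D.crossings e e').ncard : ZMod 2) = flipSum t a b c d + switchSum y a b c d := by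
  classical
  obtain ⟨m, ⟨rank⟩⟩ := Finite.exists_equiv_fin V
  set x : V → ℝ := fun v => ((rank v : ℕ) : ℝ)
  have hx : Function.Injective x := fun u v h =>
    rank.injective (Fin.ext (Nat.cast_injective (R := ℝ) h))
  set vert : V → ℂ := fun v => (x v : ℂ)
  have hvert : ∀ u, vert u = x u := fun _ => rfl
  have hvi : Function.Injective vert := fun u v h => hx (Complex.ofReal_injective h)
  obtain ⟨t, ht⟩ := exists_isFlip hvi
  -- The tournament depends only on the positions of the vertices, so it is available before `y` is
  -- chosen.
  refine ⟨fun u v => t u v, fun u v huv => ?_, fun y => ?_⟩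
  · have := ht.add_eq_one huv
    dsimp only
    exact_mod_cast congrArg (Int.cast : ℤ → ZMod 2) this
  have hex : ∀ e : G.edgeSet, ∃ (a b : V) (q P : ℝ[X]), (e : Sym2 V) = s(a, b) ∧
      polyCurve q P 0 = vert a ∧ polyCurve q P 1 = vert b ∧
      ∀ c : ℝ, |c| < 1 → ∀ v, v ≠ a → v ≠ b → vert v ∉ polyArc q (pencil P c) ∧
        ∀ n : ℤ, HasTurns vert (polyCurve q (pencil P c)) a b v n → (n : ZMod 2) = y e v := by
    rintro ⟨e, he⟩
    induction e with | _ a b =>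
    have hab : a ≠ b := G.ne_of_adj he
    obtain ⟨q, P, h⟩ := exists_edge_pencil hx hvert hab (y s(a, b))
    exact ⟨a, b, q, P, rfl, h⟩
  choose src tgt q P hends h0 h1 hedge using hex
  have := Fintype.ofFinite V
  obtain ⟨c, hc, hpair, htriple⟩ := exists_general_position q P (Finset.univ : Finset G.edgeSet)
  have hnv : ∀ (e : G.edgeSet) (v : V), v ∉ (e : Sym2 V) → v ≠ src e ∧ v ≠ tgt e := by
    intro e v hv
    rw [hends e, Sym2.mem_iff, not_or] at hv
    exact hv
  have hvm : ∀ (v : V) (e : G.edgeSet), vert v ∈ polyArc (q e) (pencil (P e) (c e)) →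
      v ∈ (e : Sym2 V) := by
    intro v e hv
    by_contra hmem
    obtain ⟨n1, n2⟩ := hnv e v hmem
    exact (hedge e (c e) (hc e) v n1 n2).1 hv
  have hparam : ∀ e : G.edgeSet, IsArcParam vert (polyArc (q e) (pencil (P e) (c e)))
      (polyCurve (q e) (pencil (P e) (c e))) (src e) (tgt e) := fun e =>
    ⟨continuous_polyCurve _ _, (polyCurve_injective _ _).injOn, rfl,
      by rw [polyCurve_pencil_zero, h0], by rw [polyCurve_pencil_one, h1]⟩
  let D : Drawing G :=
    { vert := vert
      vert_injective := hvi
      edge := fun e => polyArc (q e) (pencil (P e) (c e))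
      edge_arc := fun e => by
        refine ⟨⟨fun s => polyCurve (q e) (pencil (P e) (c e)) s,
          (continuous_polyCurve _ _).comp continuous_subtype_val⟩,
          (polyCurve_injective _ _).comp Subtype.val_injective, ?_, ?_⟩
        · ext z
          constructor
          · rintro ⟨s, rfl⟩
            exact ⟨s, s.2, rfl⟩
          · rintro ⟨s, hs, rfl⟩
            exact ⟨⟨s, hs⟩, rfl⟩
        · rw [hends e, Sym2.map_mk, ← (hparam e).zero, ← (hparam e).one]
          rfl
      vert_mem_edge := hvm
      inter_finite := fun e f hef => (hpair e (Finset.mem_univ _) f (Finset.mem_univ _) hef).1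
      inter_proper := fun e f hef p hp => by
        by_cases hv : ∃ v, vert v = p
        · obtain ⟨v, rfl⟩ := hv
          exact Or.inl ⟨v, hvm v e hp.1, hvm v f hp.2, rfl⟩
        · push Not at hv
          refine Or.inr ((hpair e (Finset.mem_univ _) f (Finset.mem_univ _) hef).2 p hp ?_ ?_ ?_ ?_)
          · rw [h0]; exact (hv _).symm
          · rw [h1]; exact (hv _).symm
          · rw [h0]; exact (hv _).symm
          · rw [h1]; exact (hv _).symm
      no_triple := fun e f g hef heg hfg p hpe hpf hpg => by
        obtain ⟨l, -, h | h⟩ := htriple e (Finset.mem_univ _) f (Finset.mem_univ _) g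
          (Finset.mem_univ _) hef heg hfg p hpe hpf hpg
        · exact ⟨src l, by rw [h, h0]⟩
        · exact ⟨tgt l, by rw [h, h1]⟩ }
  refine ⟨D, fun e e' a b c' d' hab hcd hind => ?_⟩
  refine D.parity_of_turns ht hends hparam (y := y) (fun e v hv => ?_) e e' hab hcd hind
  obtain ⟨n1, n2⟩ := hnv e v hv
  obtain ⟨hv', hn⟩ := hedge e (c e) (hc e) v n1 n2
  obtain ⟨n, hn'⟩ := exists_hasTurns (hparam e) hv'
  exact ⟨n, hn', hn n hn'⟩

end PolynomialCurves

/-! ### Realizability -/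

theorem ATGraph.realizable_of_parities {V : Type*} [Finite V] {A : ATGraph V} (hA : A.graph = ⊤)
    (hK5 : ¬ A.ContainsEven graphK5) (h2K3 : ¬ A.ContainsOdd graph2K3) :
    A.IndepZ2Realizable := by
  rw [not_containsEven_iff] at hK5
  rw [not_containsOdd_iff] at h2K3
  obtain ⟨t, ht, hdraw⟩ := exists_drawing_of_switches A.graph
  classical
  -- Modulo two, adding `flipSum t` removes the part common to all drawings on this vertex set. The
  -- value is set to 0 on degenerate quadruples, where `flipSum` need not vanish.
  let X : V → V → V → V → ZMod 2 := fun a b c d =>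
    if a ≠ b ∧ c ≠ d ∧ a ≠ c ∧ a ≠ d ∧ b ≠ c ∧ b ≠ d then
      A.pairVal a b c d + flipSum t a b c d else 0
  have hX : ∀ {a b c d}, a ≠ b → c ≠ d → a ≠ c → a ≠ d → b ≠ c → b ≠ d →
      X a b c d = A.pairVal a b c d + flipSum t a b c d := fun h1 h2 h3 h4 h5 h6 =>
    if_pos ⟨h1, h2, h3, h4, h5, h6⟩
  have fl : ∀ {u v}, u ≠ v → t v u = 1 - t u v := fun h => by rw [← ht _ _ h]; ring
  obtain ⟨Y, hY⟩ := exists_switchSum_eq_of_sums (X := X) ‹_›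
    (fun a b c d => by
      simp only [X]
      rw [A.pairVal_swap_left a b c d]
      refine if_congr (by grind) ?_ rfl
      simp only [flipSum]; ring)
    (fun a b c d => by
      simp only [X]
      by_cases h : a ≠ b ∧ c ≠ d ∧ a ≠ c ∧ a ≠ d ∧ b ≠ c ∧ b ≠ d
      · rw [if_pos h, if_pos (by grind), A.pairVal_swap]
        simp only [flipSum]
        -- Exchanging the two edges replaces each of the four terms `t` by its complement; the four
        -- ones cancel.
        rw [fl h.2.2.1, fl h.2.2.2.1, fl h.2.2.2.2.1, fl h.2.2.2.2.2]
        grind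
      · rw [if_neg h, if_neg (by grind)])
    (fun a b c d => by
      simp only [X]
      rw [A.pairVal_swap_right a b c d]
      refine if_congr (by grind) ?_ rfl
      simp only [flipSum]; ring)
    (fun a b c => if_neg (by simp)) (fun a b c => if_neg (by simp))
    (fun a b c d e hab hac had hae hbc hbd hbe hcd hce hde => by
      have h1 := sumK5_pairVal_of_copies hA hK5 hab hac had hae hbc hbd hbe hcd hce hde
      have h2 := sumK5_flipSum ht hab hac had hae hbc hbd hbe hcd hce hde
      have h3 : sumK5 X a b c d e =
          sumK5 (fun p q r s => A.pairVal p q r s + flipSum t p q r s) a b c d e := by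
        simp only [sumK5, X]
        simp only [ne_eq, hab, hac, had, hae, hbc, hbd, hbe, hcd, hce, hde, hbc.symm, hcd.symm,
          hbd.symm, hde.symm, hce.symm, hbe.symm, not_false_eq_true, and_self, if_true]
      rw [h3, sumK5_add, h1, h2]
      rfl)
    (fun a b c d e f hab hac hbc hde hdf hef had hae haf hbd hbe hbf hcd hce hcf => by
      have h1 := sum2K3_pairVal_of_copies hA h2K3 hab hac hbc hde hdf hef had hae haf hbd hbe hbf
        hcd hce hcf
      have h2 := sum2K3_flipSum t a b c d e f
      have h3 : sum2K3 X a b c d e f =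
          sum2K3 (fun p q r s => A.pairVal p q r s + flipSum t p q r s) a b c d e f := by
        simp only [sum2K3, X]
        simp only [ne_eq, hab, hac, hbc, hde, hdf, hef, had, hae, haf, hbd, hbe, hbf, hcd, hce, hcf,
          not_false_eq_true, and_self, if_true]
      rw [h3, sum2K3_add, h1, h2, add_zero])
  obtain ⟨D, hD⟩ := hdraw Y
  refine ⟨D, ?_⟩
  rintro ⟨e, he⟩ ⟨f, hf⟩ hind
  induction e with | _ a b =>
  induction f with | _ c d =>
  have hac : a ≠ c := fun h => hind a ⟨by simp, by simp [h]⟩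
  have had : a ≠ d := fun h => hind a ⟨by simp, by simp [h]⟩
  have hbc : b ≠ c := fun h => hind b ⟨by simp, by simp [h]⟩
  have hbd : b ≠ d := fun h => hind b ⟨by simp, by simp [h]⟩
  have hab : a ≠ b := A.graph.ne_of_adj he
  have hcd : c ≠ d := A.graph.ne_of_adj hf
  have key := hD ⟨s(a, b), he⟩ ⟨s(c, d), hf⟩ a b c d rfl rfl hind
  rw [← hY a b c d hab hac had hbc hbd hcd, hX hab hcd hac had hbc hbd] at key
  have key' : ((D.crossings ⟨s(a, b), he⟩ ⟨s(c, d), hf⟩).ncard : ZMod 2) = A.pairVal a b c d := by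
    rw [key]; grind
  rw [← ZMod.natCast_eq_one_iff_odd, key', pairVal]
  split_ifs with h <;> simp [h]

theorem theorem3 {V : Type*} [Finite V] :
    (∀ A : ATGraph V, A.IsComplete →
      (A.IndepZ2Realizable ↔ ¬ A.ContainsEven graphK5 ∧ ¬ A.ContainsOdd graph2K3)) ∧
    (∀ A : ATGraph V, A.IsComplete → ¬ A.IndepZ2Realizable →
      ∃ H : A.graph.Subgraph, H.verts.ncard ≤ 6 ∧ ¬ (A.sub H).IndepZ2Realizable) ∧
    (switchSpace (⊤ : SimpleGraph V) : Set (indepPairs (⊤ : SimpleGraph V) → ZMod 2)) =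
      propertyVectors (⊤ : SimpleGraph V) := by
  refine ⟨fun A hA => ⟨fun h => ?_, fun h => ATGraph.realizable_of_parities hA h.1 h.2⟩,
    fun A hA hn => ?_, switchSpace_eq_propertyVectors⟩
  · rw [ATGraph.not_containsEven_iff, ATGraph.not_containsOdd_iff]
    exact ⟨fun j => ZMod.natCast_eq_one_iff_odd.2 (h.odd_copyPairs_K5 j),
      fun j => ZMod.natCast_eq_zero_iff_even.2 (h.even_copyPairs_2K3 j)⟩
  -- The forbidden subgraph has five or six vertices and violates the parity condition itself, so it
  -- is the desired AT-subgraph.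
  · by_cases h1 : A.ContainsEven graphK5
    · obtain ⟨H, ⟨ι⟩, heven⟩ := h1
      refine ⟨H, ?_, A.not_realizable_sub_of_iso_K5 ι heven⟩
      rw [← Nat.card_coe_set_eq, Nat.card_congr ι.toEquiv]
      simp
    by_cases h2 : A.ContainsOdd graph2K3
    · obtain ⟨H, ⟨ι⟩, hodd⟩ := h2
      refine ⟨H, ?_, A.not_realizable_sub_of_iso_2K3 ι hodd⟩
      rw [← Nat.card_coe_set_eq, Nat.card_congr ι.toEquiv]
      simp
    exact absurd (ATGraph.realizable_of_parities hA h1 h2) hn
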